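/- **Setting.** Let $B$ be a quaternion algebra over $\mathbb Q$ ramified at infinity, with conjugation $x\mapsto x^*$, trace $\operatorname{tr}(x)=x+x^*$ and norm $n(x)=xx^*$. For a field $K\supseteq\mathbb Q$ put $B_K=B\otimes K$ and let $H_3(B_K)$ be the space of hermitian matrices $h=\begin{pmatrix}c_1&a_3&a_2^*\\a_3^*&c_2&a_1\\a_2&a_1^*&c_3\end{pmatrix}$ ($c_i\in K$, $a_i\in B_K$), with the pairing $\operatorname{tr}(x,y)=\frac12\operatorname{tr}(xy+yx)$, the norm $N(h)=c_1c_2c_3-\sum_i c_in(a_i)+\operatorname{tr}(a_1a_2a_3)$ and the quadratic adjoint $h^\#$ (the hermitian matrix with diagonal entries $c_2c_3-n(a_1)$, $c_1c_3-n(a_2)$, $c_1c_2-n(a_3)$ and with entries $a_2^*a_1^*-c_3a_3$, $a_3^*a_2^*-c_1a_1$, $a_1^*a_3^*-c_2a_2$ in positions $(1,2)$, $(2,3)$, $(3,1)$). An element $h\in H_3(B_K)$ is of rank one if $h\ne0$ and $h^\#=0$. Freudenthal's space is $W(K)=K\oplus H_3(B_K)\oplus H_3(B_K)\oplus K$, with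 the symplectic form $\langle(a,b,c,d),(a',b',c',d')\rangle=ad'-\operatorname{tr}(b,c')+\operatorname{tr}(c,b')-da'$ and the quartic form $Q(a,b,c,d)=(ad-\operatorname{tr}(b,c))^2+4aN(c)+4dN(b)-4\operatorname{tr}(b^\#,c^\#)$; let $(\cdot,\cdot,\cdot,\cdot)$ be the symmetric $4$-linear form with $(w,w,w,w)=Q(w)$. An element $v\in W(K)$ has rank one if $v\neq0$ and $(v,v,w,w')=0$ for all $w,w'\in W(K)$ with $\langle v,w'\rangle=0$. The group $G(K)$, acting on the right of $W(K)$, consists of the pairs $(g,\nu)\in \mathrm{GL}(W(K))\times K^\times$ with $\langle ug,vg\rangle=\nu\langle u,v\rangle$ and $Q(wg)=\nu^2Q(w)$. Let $f=(0,0,0,1)$, and let $P(K)\subseteq G(K)$ be the stabilizer of the line $Kf$. Let $\mathrm{GSp}_6(K)$ be the group of $g$ with $gJ\,{}^tg=\nu(g)J$, $J=\begin{pmatrix}0&1_3\\-1_3&0\end{pmatrix}$, $\nu(g)\in K^\times$, acting on the right of the space $W_6$ of row vectors, with basis $e_1,e_2,e_3,f_1,f_2,f_3$. It acts on $W(K)$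 and maps to $G(K)$ through the embedding $W\hookrightarrow(\bigwedge^3W_6\otimes\nu^{-1})\otimes B$, $$(a,b,c,d)\mapsto a\,e_1\wedge e_2\wedge e_3+\sum_{i,j} b_{ij}\,e_{i+1}\wedge e_{i+2}\wedge f_j+\sum_{i,j} c_{ij}\,f_{i+1}\wedge f_{i+2}\wedge e_j+d\,f_1\wedge f_2\wedge f_3$$ (indices modulo $3$). The orbit of a rank one line $\mathbb Qv\subseteq W(\mathbb Q)$ under $\mathrm{GSp}_6(\mathbb Q)$ is called *negligible* if the stabilizer of $\mathbb Qv$ in $\mathrm{GSp}_6(\mathbb Q)$ contains the unipotent radical of a proper parabolic subgroup of $\mathrm{GSp}_6$ defined over $\mathbb Q$. Let $B_0$ be a maximal order of $B$, $1,v_1,v_2,v_3$ a $\mathbb Z$-basis of $B_0$ and $a,b,c\in\mathbb Z$ such that $A=\begin{pmatrix}a&v_3&v_2^*\\v_3^*&b&v_1\\v_2&v_1^*&c\end{pmatrix}$ is of rank one. Put $$T=\begin{pmatrix}a&\operatorname{tr}(v_3)/2&\operatorname{tr}(v_2)/2\\\operatorname{tr}(v_3)/2&b&\operatorname{tr}(v_1)/2\\\operatorname{tr}(v_2)/2&\operatorname{tr}(v_1)/2&c\end{pmatrix},\qquad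 f_{\mathcal O}=(0,0,A,0)\in W(\mathbb Q).$$ **Proposition 3.5.** 1. The element $f_{\mathcal O}$ has rank one. The map $\gamma\mapsto\mathbb Qf\gamma$ identifies $P(\mathbb Q)\backslash G(\mathbb Q)$ with the set of rank one lines in $W(\mathbb Q)$ (indeed $f\,G(\mathbb Q)$ is the set of all rank one elements), and $P(\mathbb Q)\backslash G(\mathbb Q)/\mathrm{GSp}_6(\mathbb Q)$ with the set of $\mathrm{GSp}_6(\mathbb Q)$-orbits on these lines. 2. The line $\mathbb Qf_{\mathcal O}$ represents the unique open orbit. That is, for a rank one line $\ell$ in $W(\mathbb Q)$, the following are equivalent: $\ell$ is in the $\mathrm{GSp}_6(\mathbb Q)$-orbit of $\mathbb Qf_{\mathcal O}$; the orbit of $\ell\otimes\overline{\mathbb Q}$ under $\mathrm{GSp}_6(\overline{\mathbb Q})$ is Zariski open in the variety of rank one lines in $W(\overline{\mathbb Q})$; the orbit of $\ell$ under $\mathrm{GSp}_6(\mathbb Q)$ is Zariski open in the set of rank one lines in $W(\mathbb Q)$. 3. There are infinitely many other $\mathrm{GSp}_6(\mathbb Q)$-orbits on the rank one lines in $W(\mathbb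 Q)$, and all of them are negligible. 4. The stabilizer of the line $\mathbb Qf_{\mathcal O}$ in $\mathrm{GSp}_6(\mathbb Q)$ is the set of the elements of $\mathrm{GSp}_6(\mathbb Q)$ of the form $\begin{pmatrix}\lambda_1&\\&\lambda_2\end{pmatrix}\begin{pmatrix}1&U\\&1\end{pmatrix}$ with $\lambda_1,\lambda_2\in\mathbb Q^\times$ and $\operatorname{tr}(TU)=0$. -/

import Mathlib

open scoped Quaternion TensorProduct Matrix

noncomputable section

namespace Freudenthal

/-! ### Hermitian 3 × 3 matrices over the quaternion algebra `B = ℍ[K,α,β]`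

Here `ℍ[K,α,β]` is the quaternion algebra over `K` with `i² = α`, `j² = β`, `ij = -ji`, and `star` is
its conjugation. -/

section Hermitian

variable {K : Type*} [Field K] {α β : K}

/-- The trace `x + x*` of a quaternion, as an element of the ground field. -/
def qtr (x : ℍ[K,α,β]) : K := (x + star x).re

/-- The norm `x x*` of a quaternion, as an element of the ground field. -/
def qnorm (x : ℍ[K,α,β]) : K := (x * star x).re

/-- `H₃(B)`: the pair `((c₁, c₂, c₃), (a₁, a₂, a₃))` stands for the hermitian matrix with diagonal
`c₁, c₂, c₃` and off-diagonal entries `a₃` (1,2), `a₁` (2,3), `a₂` (3,1); see `H3.toMatrix`. -/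
abbrev H3 (K : Type*) [Field K] (α β : K) : Type _ := (Fin 3 → K) × (Fin 3 → ℍ[K,α,β])

/-- The hermitian matrix over `B` given by its coordinates. -/
def H3.toMatrix (h : H3 K α β) : Matrix (Fin 3) (Fin 3) ℍ[K,α,β] :=
  !![(h.1 0 : ℍ[K,α,β]), h.2 2, star (h.2 1);
     star (h.2 2), (h.1 1 : ℍ[K,α,β]), h.2 0;
     h.2 1, star (h.2 0), (h.1 2 : ℍ[K,α,β])]

/-- The cubic norm `N(h)`. -/
def H3.norm (h : H3 K α β) : K :=
  h.1 0 * h.1 1 * h.1 2 - h.1 0 * qnorm (h.2 0) - h.1 1 * qnorm (h.2 1) - h.1 2 * qnorm (h.2 2)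
    + qtr (h.2 0 * h.2 1 * h.2 2)

/-- The quadratic adjoint `h^#`. -/
def H3.sharp (h : H3 K α β) : H3 K α β :=
  (![h.1 1 * h.1 2 - qnorm (h.2 0), h.1 0 * h.1 2 - qnorm (h.2 1), h.1 0 * h.1 1 - qnorm (h.2 2)],
   ![star (h.2 2) * star (h.2 1) - h.1 0 • h.2 0,
     star (h.2 0) * star (h.2 2) - h.1 1 • h.2 1,
     star (h.2 1) * star (h.2 0) - h.1 2 • h.2 2])

/-- An element of `H₃(B)` is of rank one if it is nonzero and its adjoint vanishes. -/
def H3.IsRankOne (h : H3 K α β) : Prop := h.sharp = 0 ∧ h ≠ 0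

/-- The pairing `tr(x, y) = ½ tr(xy + yx)`; this trace lies in `K`, so it equals its real part. -/
def H3.pair (x y : H3 K α β) : K :=
  (x.toMatrix * y.toMatrix + y.toMatrix * x.toMatrix).trace.re / 2

end Hermitian

/-! ### Freudenthal's space and the group `G` -/

section Space

variable {K : Type*} [Field K] {α β : K}

/-- Freudenthal's space `W = K ⊕ H₃(B) ⊕ H₃(B) ⊕ K`, with elements `(a, b, c, d)`. -/
abbrev W (K : Type*) [Field K] (α β : K) : Type _ := K × H3 K α β × H3 K α β × K

/-- The symplectic form on `W`. -/
def symp (u v : W K α β) : K :=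
  u.1 * v.2.2.2 - H3.pair u.2.1 v.2.2.1 + H3.pair u.2.2.1 v.2.1 - u.2.2.2 * v.1

/-- The quartic form on `W`. -/
def quartic (w : W K α β) : K :=
  (w.1 * w.2.2.2 - H3.pair w.2.1 w.2.2.1) ^ 2 + 4 * w.1 * H3.norm w.2.2.1
    + 4 * w.2.2.2 * H3.norm w.2.1 - 4 * H3.pair (H3.sharp w.2.1) (H3.sharp w.2.2.1)

/-- The symmetric 4-linear form with `(w, w, w, w) = quartic w` (polarization formula). -/
def fourForm (w : Fin 4 → W K α β) : K :=
  (1 / 24) * ∑ S : Finset (Fin 4), (-1) ^ S.card * quartic (∑ i ∈ S, w i)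

/-- An element `v` of `W` has rank one if it is nonzero and `(v, v, x, y) = 0` for all `x` in `W` and
all `y` orthogonal to `v`. -/
def IsRankOne (v : W K α β) : Prop :=
  v ≠ 0 ∧ ∀ x y : W K α β, symp v y = 0 → fourForm ![v, v, x, y] = 0

/-- The rank one element `f = (0, 0, 0, 1)`. -/
def f₀ : W K α β := (0, 0, 0, 1)

variable (K α β) in
/-- `G(K)`: the pairs `(γ, ν)` with `γ` an automorphism of `W` that preserves the symplectic form up
to `ν` and the quartic form up to `ν²`. The paper's right action `w γ` is written `γ w`. -/
def GG : Set ((W K α β ≃ₗ[K] W K α β) × Kˣ) :=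
  {γ | (∀ u v, symp (γ.1 u) (γ.1 v) = γ.2 * symp u v) ∧
    ∀ w, quartic (γ.1 w) = (γ.2 : K) ^ 2 * quartic w}

variable (K α β) in
/-- `P(K)`: the stabilizer in `G(K)` of the line spanned by `f₀`. -/
def PP : Set ((W K α β ≃ₗ[K] W K α β) × Kˣ) :=
  {γ | γ ∈ GG K α β ∧ ∃ t : Kˣ, γ.1 f₀ = (t : K) • f₀}

end Space

/-! ### `GSp₆` and its action on `W` -/

section GSp

variable {K : Type*} [Field K] {α β : K}

/-- The row space `W₆` of `GSp₆`, with basis `e₁, e₂, e₃, f₁, f₂, f₃`. -/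
abbrev W6 (K : Type*) : Type _ := Fin 3 ⊕ Fin 3 → K

variable (K) in
/-- The matrix `(0, 1; -1, 0)`. -/
def J6 : Matrix (Fin 3 ⊕ Fin 3) (Fin 3 ⊕ Fin 3) K := Matrix.fromBlocks 0 1 (-1) 0

/-- `g` is an element of `GSp₆(K)` with similitude `ν`. -/
def IsGSp6 (g : Matrix (Fin 3 ⊕ Fin 3) (Fin 3 ⊕ Fin 3) K) (ν : Kˣ) : Prop :=
  g * J6 K * gᵀ = (ν : K) • J6 K

/-- The basis vector `eᵢ` of `W₆`. -/
def eV (i : Fin 3) : W6 K := Pi.single (Sum.inl i) 1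

/-- The basis vector `fᵢ` of `W₆`. -/
def fV (i : Fin 3) : W6 K := Pi.single (Sum.inr i) 1

/-- The element `x ∧ y ∧ z` of `⋀³ W₆`. -/
def wedge (x y z : W6 K) : ⋀[K]^3 (W6 K) := exteriorPower.ιMulti K 3 ![x, y, z]

/-- The embedding of `W` in `⋀³ W₆ ⊗ B`:
`(a, b, c, d) ↦ a e₁∧e₂∧e₃ + ∑ bᵢⱼ eᵢ*∧fⱼ + ∑ cᵢⱼ fᵢ*∧eⱼ + d f₁∧f₂∧f₃`, where
`eᵢ* = eᵢ₊₁ ∧ eᵢ₊₂`, `fᵢ* = fᵢ₊₁ ∧ fᵢ₊₂`, the indices being taken modulo 3. -/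
def emb (w : W K α β) : ⋀[K]^3 (W6 K) ⊗[K] ℍ[K,α,β] :=
  wedge (eV 0) (eV 1) (eV 2) ⊗ₜ (w.1 : ℍ[K,α,β])
    + ∑ i : Fin 3, ∑ j : Fin 3, wedge (eV (i + 1)) (eV (i + 2)) (fV j) ⊗ₜ w.2.1.toMatrix i j
    + ∑ i : Fin 3, ∑ j : Fin 3, wedge (fV (i + 1)) (fV (i + 2)) (eV j) ⊗ₜ w.2.2.1.toMatrix i j
    + wedge (fV 0) (fV 1) (fV 2) ⊗ₜ (w.2.2.2 : ℍ[K,α,β])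

/-- `(g, ν)` acts on `(⋀³ W₆ ⊗ ν⁻¹) ⊗ B` through the right action `x ↦ x g` on row vectors. -/
def act (g : Matrix (Fin 3 ⊕ Fin 3) (Fin 3 ⊕ Fin 3) K) (ν : Kˣ)
    (t : ⋀[K]^3 (W6 K) ⊗[K] ℍ[K,α,β]) : ⋀[K]^3 (W6 K) ⊗[K] ℍ[K,α,β] :=
  ((ν⁻¹ : Kˣ) : K) • LinearMap.rTensor ℍ[K,α,β] (exteriorPower.map 3 g.vecMulLinear) t

variable (K α β) in
/-- The image of `GSp₆(K)` in `GL(W) × GL₁`: pairs `(h, ν)` such that some `g` in `GSp₆(K)` of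
similitude `ν` acts on `W`, seen in `⋀³ W₆ ⊗ B`, as `h`. -/
def imageGSp6 : Set ((W K α β ≃ₗ[K] W K α β) × Kˣ) :=
  {h | ∃ g, IsGSp6 g h.2 ∧ ∀ w, emb (h.1 w) = act g h.2 (emb w)}

/-- The `GSp₆(K)`-orbit of the line `K w`, as the set of all nonzero vectors on the lines of the
orbit (for `w ≠ 0`). -/
def lineOrbit (w : W K α β) : Set (W K α β) :=
  {w' | ∃ g ν, IsGSp6 g ν ∧ ∃ t : Kˣ, emb w' = (t : K) • act g ν (emb w)}

/-- The stabilizer in `GSp₆(K)` of the line `K w`. -/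
def lineStabilizer (w : W K α β) : Set (Matrix (Fin 3 ⊕ Fin 3) (Fin 3 ⊕ Fin 3) K) :=
  {g | ∃ ν, IsGSp6 g ν ∧ ∃ t : Kˣ, act g ν (emb w) = (t : K) • emb w}

/-- `γ'` lies in the double coset `P(K) γ GSp₆(K)`. As `G` acts on the right of `W`, the product
`p γ h` is `p` followed by `γ` followed by `h`. -/
def InDoubleCoset (γ γ' : (W K α β ≃ₗ[K] W K α β) × Kˣ) : Prop :=
  ∃ p ∈ PP K α β, ∃ h ∈ imageGSp6 K α β,
    γ'.1 = (p.1.trans γ.1).trans h.1 ∧ γ'.2 = p.2 * γ.2 * h.2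

end GSp

/-! ### Open orbits -/

section Open

/-- The algebra of polynomial functions on a vector space. -/
def polyFun (K V : Type*) [Field K] [AddCommGroup V] [Module K V] : Subalgebra K (V → K) :=
  Algebra.adjoin K (Set.range fun φ : Module.Dual K V => (φ : V → K))

/-- The `GSp₆(K)`-orbit of the line `K w` is Zariski open in the set of rank one lines of `W(K)`.
Openness is tested on the cone of rank one vectors over this set; the Zariski topology of the set of
lines is the quotient of that of the cone. -/
def IsOpenOrbit {K : Type*} [Field K] {α β : K} (w : W K α β) : Prop :=
  ∃ I : Set (W K α β → K), I ⊆ polyFun K (W K α β) ∧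
    ∀ x, IsRankOne x → (x ∈ lineOrbit w ↔ ∃ F ∈ I, F x ≠ 0)

/-- Extension of scalars `ℍ[K,α,β] → ℍ[L,α,β]`. -/
def qBaseChange {K : Type*} [Field K] {α β : K} (L : Type*) [Field L] [Algebra K L]
    (x : ℍ[K,α,β]) : ℍ[L,algebraMap K L α,algebraMap K L β] :=
  ⟨algebraMap K L x.re, algebraMap K L x.imI, algebraMap K L x.imJ, algebraMap K L x.imK⟩

/-- Extension of scalars `H₃(B) → H₃(B ⊗ L)`. -/
def H3.baseChange {K : Type*} [Field K] {α β : K} (L : Type*) [Field L] [Algebra K L]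
    (h : H3 K α β) : H3 L (algebraMap K L α) (algebraMap K L β) :=
  (fun i => algebraMap K L (h.1 i), fun i => qBaseChange L (h.2 i))

/-- Extension of scalars `W(K) → W(L)`. -/
def wBaseChange {K : Type*} [Field K] {α β : K} (L : Type*) [Field L] [Algebra K L]
    (w : W K α β) : W L (algebraMap K L α) (algebraMap K L β) :=
  (algebraMap K L w.1, H3.baseChange L w.2.1, H3.baseChange L w.2.2.1, algebraMap K L w.2.2.2)

/-- The orbit of the `K`-rational line `K w` under the algebraic group `GSp₆` is an open subvariety
of the variety of rank one lines: its points over the algebraic closure form a Zariski open set. -/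
def IsGeomOpenOrbit {K : Type*} [Field K] {α β : K} (w : W K α β) : Prop :=
  IsOpenOrbit (wBaseChange (AlgebraicClosure K) w)

end Open

/-! ### Parabolic subgroups of `GSp₆` and negligible orbits -/

section Parabolic

variable {K : Type*} [Field K]

variable (K) in
/-- The symplectic form on `W₆`, with `⟨eᵢ, fⱼ⟩ = δᵢⱼ`. -/
def form6 : LinearMap.BilinForm K (W6 K) := Matrix.toBilin' (J6 K)

/-- A nonempty flag of nonzero totally isotropic subspaces of `W₆`. The proper parabolic subgroups of
`GSp₆` defined over `K` are the stabilizers of these flags. -/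
def IsIsotropicFlag (F : Set (Submodule K (W6 K))) : Prop :=
  F.Nonempty ∧ IsChain (· ≤ ·) F ∧ ∀ V ∈ F, V ≠ ⊥ ∧ V ≤ (form6 K).orthogonal V

/-- The members of an isotropic flag, their orthogonal complements, `0` and `W₆`. -/
def fullFlag (F : Set (Submodule K (W6 K))) : Set (Submodule K (W6 K)) :=
  {⊥, ⊤} ∪ F ∪ (form6 K).orthogonal '' F

/-- The unipotent radical of the parabolic subgroup of `GSp₆` stabilizing the flag `F`: the elements
that act trivially on all successive quotients of the full flag, that is, for every member `X` the
map `g - 1` sends `X` into the next smaller member. -/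
def unipotentRadical (F : Set (Submodule K (W6 K))) :
    Set (Matrix (Fin 3 ⊕ Fin 3) (Fin 3 ⊕ Fin 3) K) :=
  {g | (∃ ν, IsGSp6 g ν) ∧
    ∀ X ∈ fullFlag F, ∀ x ∈ X, x ᵥ* g - x ∈ sSup {Y | Y ∈ fullFlag F ∧ Y < X}}

/-- The orbit of the line `K w` is negligible: the stabilizer of `K w` in `GSp₆(K)` contains the
unipotent radical of a (proper) parabolic subgroup of `GSp₆`. -/
def IsNegligible {α β : K} (w : W K α β) : Prop :=
  ∃ F : Set (Submodule K (W6 K)), IsIsotropicFlag F ∧ unipotentRadical F ⊆ lineStabilizer w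

end Parabolic

/-! ### Quaternion orders and the element `f_O` -/

section Order

/-- The rational quaternion algebra `ℍ[ℚ,α,β]` is ramified at infinity: `B ⊗ ℝ` is a division
algebra. -/
def RamifiedAtInfinity (α β : ℚ) : Prop := ∀ x : ℍ[ℝ,(α : ℝ),(β : ℝ)], x ≠ 0 → IsUnit x

/-- An order in a rational quaternion algebra: a subring that is finitely generated as an abelian
group and spans the algebra over `ℚ`. -/
def IsOrder {α β : ℚ} (O : Subring ℍ[ℚ,α,β]) : Prop :=
  O.toAddSubgroup.FG ∧ Submodule.span ℚ (O : Set ℍ[ℚ,α,β]) = ⊤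

/-- `1, v₁, v₂, v₃` is a basis of `O` as an abelian group. -/
def IsOrderBasis {α β : ℚ} (O : Subring ℍ[ℚ,α,β]) (v : Fin 3 → ℍ[ℚ,α,β]) : Prop :=
  LinearIndependent ℤ ![1, v 0, v 1, v 2] ∧
    AddSubgroup.closure (Set.range ![1, v 0, v 1, v 2]) = O.toAddSubgroup

/-- The hermitian matrix `A(T)` with diagonal `n₁, n₂, n₃` and off-diagonal entries `vᵢ`. -/
def matA {α β : ℚ} (n : Fin 3 → ℤ) (v : Fin 3 → ℍ[ℚ,α,β]) : H3 ℚ α β := (fun i => (n i : ℚ), v)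

/-- The half-integral symmetric matrix `T`. -/
def matT {α β : ℚ} (n : Fin 3 → ℤ) (v : Fin 3 → ℍ[ℚ,α,β]) : Matrix (Fin 3) (Fin 3) ℚ :=
  !![(n 0 : ℚ), qtr (v 2) / 2, qtr (v 1) / 2;
     qtr (v 2) / 2, (n 1 : ℚ), qtr (v 0) / 2;
     qtr (v 1) / 2, qtr (v 0) / 2, (n 2 : ℚ)]

/-- The element `f_O = (0, 0, A(T), 0)` of `W(ℚ)`. -/
def fO {α β : ℚ} (n : Fin 3 → ℤ) (v : Fin 3 → ℍ[ℚ,α,β]) : W ℚ α β := (0, 0, matA n v, 0)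

end Order

end Freudenthal

end

open Freudenthal

namespace Freudenthal
noncomputable section
set_option linter.unusedSimpArgs false
set_option linter.unusedSectionVars false

/-! ### Jordan identities in `H₃(B)` and the Siegel translations -/

section Coordinates
variable {K : Type*} [Field K] {α β : K}

/-! The carrier of the proof is the contraction of `⋀³ W₆ ⊗ ν⁻¹` by the symplectic form. It gives a
`GSp₆`-equivariant map from `W` to `W₆ ⊗ B` whose components `b_k* - b_k` and `c_k - c_k*` are
quaternions of trace zero. An element of `GSp₆` replaces these six quaternions by `K`-linear
combinations of them, so their span in the three-dimensional space of trace zero quaternions is an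
invariant of the orbit of a line. Over `ℚ`, with `B` definite, this span has dimension three on the
orbit of `f_O` and at most one on every other rank one line.

Normal form. The translations `siegel X` lie in `G`, and a rank one element with first coordinate `a
≠ 0` is `a` times `rankOne X = (1, X, X^#, N(X))` (`IsRankOne.eq_smul_rankOne`). Definiteness of the
norm lets every rational rank one line be moved by `GSp₆` to one with `a ≠ 0`
(`IsRankOne.exists_rankOne`); this also gives the transitivity of `G(ℚ)`. Translations by real `X`
come from `GSp₆` and the Levi factor `GL₃` multiplies the matrix `imMat X` of imaginary parts on the
left, so only `imMat X` up to `GL₃` matters.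

Dichotomy (`exists_generic_or_collinear`). If `det (imMat X) ≠ 0`, all such lines form a single
orbit, which is open, being the union of the translates of a nonvanishing locus. If the determinant
vanishes, opposite unipotent elements change it by a negative definite form in the 2 × 2 minors; so
either the line can be moved to a generic one, or all minors vanish and `imMat X` has rank at most
one. In the second case the whole orbit has collinear contractions, and deforming `X` along a line
with generic points shows that it is not open, over `ℚ` or over the algebraic closure.

Degenerate orbits. These are represented by `rankOne (corner q)`. The line spanned by the imaginary
part of `q` is an invariant, hence there are infinitely many. In `⋀³ W₆ ⊗ B` such an element is
divisible by `eV 0` with quotient supported on the orthogonal of `eV 0`, so it is fixed up to a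
scalar by the unipotent radical attached to that line.

Stabilizer. The contraction of `f_O` has no `e`-components, and its `f`-components `v_k - v_k*` are
linearly independent because `1, v₁, v₂, v₃` are. Fixing the line therefore forces the lower blocks
of `g` to be `0` and a scalar, and the remaining unipotent factor adds `tr(TU)` to the last
coordinate. -/

theorem qtr_eq (x : ℍ[K,α,β]) : qtr x = 2 * x.re := by
  simp [qtr]; ring

theorem qnorm_eq (x : ℍ[K,α,β]) :
    qnorm x = x.re ^ 2 - α * x.imI ^ 2 - β * x.imJ ^ 2 + α * β * x.imK ^ 2 := by
  simp [qnorm]; ring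

theorem H3.pair_eq [CharZero K] (x y : H3 K α β) :
    H3.pair x y = x.1 0 * y.1 0 + x.1 1 * y.1 1 + x.1 2 * y.1 2 +
      (qtr (x.2 0 * star (y.2 0)) + qtr (x.2 1 * star (y.2 1)) + qtr (x.2 2 * star (y.2 2))) := by
  simp [H3.pair, H3.toMatrix, Matrix.trace, Fin.sum_univ_three, qtr_eq]
  ring

theorem H3.ext_coord {x y : H3 K α β} (h0 : x.1 0 = y.1 0) (h1 : x.1 1 = y.1 1)
    (h2 : x.1 2 = y.1 2) (k0 : x.2 0 = y.2 0) (k1 : x.2 1 = y.2 1) (k2 : x.2 2 = y.2 2) :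
    x = y := by
  refine Prod.ext (funext fun i => ?_) (funext fun i => ?_) <;> fin_cases i <;> assumption

/-- The polarization of the adjoint. -/
def H3.cross (x y : H3 K α β) : H3 K α β := H3.sharp (x + y) - H3.sharp x - H3.sharp y

/-- The underlying function of the unipotent element `siegel X`. -/
def siegelFun (X : H3 K α β) (w : W K α β) : W K α β :=
  (w.1, w.2.1 + w.1 • X, w.2.2.1 + H3.cross w.2.1 X + w.1 • H3.sharp X,
    w.2.2.2 + H3.pair w.2.2.1 X + H3.pair w.2.1 (H3.sharp X) + w.1 * H3.norm X)

theorem qtr_add (x y : ℍ[K,α,β]) : qtr (x + y) = qtr x + qtr y := by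
  simp [qtr_eq]; ring

theorem qtr_smul (a : K) (x : ℍ[K,α,β]) : qtr (a • x) = a * qtr x := by
  simp [qtr_eq]; ring

theorem H3.sharp_fst (x : H3 K α β) : (H3.sharp x).1 =
    ![x.1 1 * x.1 2 - qnorm (x.2 0), x.1 0 * x.1 2 - qnorm (x.2 1),
      x.1 0 * x.1 1 - qnorm (x.2 2)] := rfl

theorem H3.sharp_snd (x : H3 K α β) : (H3.sharp x).2 =
    ![star (x.2 2) * star (x.2 1) - x.1 0 • x.2 0, star (x.2 0) * star (x.2 2) - x.1 1 • x.2 1,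
      star (x.2 1) * star (x.2 0) - x.1 2 • x.2 2] := rfl

theorem qnorm_add (x y : ℍ[K,α,β]) : qnorm (x + y) = qnorm x + qnorm y + qtr (x * star y) := by
  simp [qnorm_eq, qtr_eq]; ring

theorem qnorm_smul (a : K) (x : ℍ[K,α,β]) : qnorm (a • x) = a ^ 2 * qnorm x := by
  simp [qnorm_eq]; ring

theorem H3.cross_fst (x y : H3 K α β) : (H3.cross x y).1 =
    ![x.1 1 * y.1 2 + x.1 2 * y.1 1 - qtr (x.2 0 * star (y.2 0)),
      x.1 0 * y.1 2 + x.1 2 * y.1 0 - qtr (x.2 1 * star (y.2 1)),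
      x.1 0 * y.1 1 + x.1 1 * y.1 0 - qtr (x.2 2 * star (y.2 2))] := by
  funext i
  fin_cases i <;> simp [H3.cross, H3.sharp_fst, qnorm_add] <;> ring

theorem H3.cross_snd (x y : H3 K α β) : (H3.cross x y).2 =
    ![star (x.2 2) * star (y.2 1) + star (y.2 2) * star (x.2 1) - x.1 0 • y.2 0 - y.1 0 • x.2 0,
      star (x.2 0) * star (y.2 2) + star (y.2 0) * star (x.2 2) - x.1 1 • y.2 1 - y.1 1 • x.2 1,
      star (x.2 1) * star (y.2 0) + star (y.2 1) * star (x.2 0) - x.1 2 • y.2 2 - y.1 2 • x.2 2] := by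
  funext i
  fin_cases i <;> simp [H3.cross, H3.sharp_snd, mul_add, add_mul, add_smul] <;> abel

theorem H3.cross_add_left (x y z : H3 K α β) :
    H3.cross (x + y) z = H3.cross x z + H3.cross y z := by
  apply H3.ext_coord <;> simp only [H3.cross_fst, H3.cross_snd, Prod.fst_add, Prod.snd_add,
    Pi.add_apply, Matrix.cons_val, add_mul, mul_add, qtr_add, star_add, add_smul, smul_add]
  iterate 3 ring
  all_goals abel

theorem H3.cross_smul_left (a : K) (x z : H3 K α β) :
    H3.cross (a • x) z = a • H3.cross x z := by
  apply H3.ext_coord <;> simp only [H3.cross_fst, H3.cross_snd, Prod.smul_fst, Prod.smul_snd,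
    Pi.smul_apply, Matrix.cons_val, smul_mul_assoc, qtr_smul, QuaternionAlgebra.star_smul,
    smul_eq_mul, mul_smul_comm]
  iterate 3 ring
  all_goals module

theorem H3.cross_comm (x z : H3 K α β) : H3.cross x z = H3.cross z x := by
  simp only [H3.cross, add_comm x z]; abel

theorem H3.sharp_smul (a : K) (x : H3 K α β) : H3.sharp (a • x) = a ^ 2 • H3.sharp x := by
  apply H3.ext_coord <;> simp only [H3.sharp_fst, H3.sharp_snd, Prod.smul_fst, Prod.smul_snd,
    Pi.smul_apply, Matrix.cons_val, qnorm_smul, QuaternionAlgebra.star_smul,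
    smul_eq_mul, mul_smul_comm, smul_mul_assoc]
  iterate 3 ring
  all_goals module

theorem H3.sharp_add (x y : H3 K α β) :
    H3.sharp (x + y) = H3.sharp x + H3.cross x y + H3.sharp y := by
  simp only [H3.cross]; abel

theorem H3.norm_smul (a : K) (x : H3 K α β) : H3.norm (a • x) = a ^ 3 * H3.norm x := by
  simp [H3.norm, qnorm_eq, qtr_eq]; ring

variable [CharZero K]

theorem H3.pair_add_left (x y z : H3 K α β) :
    H3.pair (x + y) z = H3.pair x z + H3.pair y z := by
  simp [H3.pair_eq, qtr_eq]; ring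

theorem H3.pair_smul_left (a : K) (x z : H3 K α β) :
    H3.pair (a • x) z = a * H3.pair x z := by
  simp [H3.pair_eq, qtr_eq]; ring

theorem H3.pair_comm (x y : H3 K α β) : H3.pair x y = H3.pair y x := by
  simp [H3.pair_eq, qtr_eq]; ring

theorem H3.pair_add_right (x y z : H3 K α β) :
    H3.pair x (y + z) = H3.pair x y + H3.pair x z := by
  rw [H3.pair_comm, H3.pair_add_left, H3.pair_comm y, H3.pair_comm z]

theorem H3.pair_smul_right (a : K) (x z : H3 K α β) :
    H3.pair x (a • z) = a * H3.pair x z := by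
  rw [H3.pair_comm, H3.pair_smul_left, H3.pair_comm]

/-- Both sides are the symmetric trilinear form obtained by polarizing the cubic norm. -/
theorem H3.pair_cross (x y z : H3 K α β) :
    H3.pair (H3.cross x y) z = H3.pair x (H3.cross y z) := by
  simp [H3.pair_eq, H3.cross, H3.sharp, qnorm_eq, qtr_eq]; ring

theorem H3.norm_add (x y : H3 K α β) :
    H3.norm (x + y) = H3.norm x + H3.pair (H3.sharp x) y + H3.pair x (H3.sharp y) + H3.norm y := by
  simp [H3.pair_eq, H3.norm, H3.sharp, qnorm_eq, qtr_eq]; ring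

theorem H3.pair_sharp_self (x : H3 K α β) : H3.pair (H3.sharp x) x = 3 * H3.norm x := by
  simp [H3.pair_eq, H3.norm, H3.sharp, qnorm_eq, qtr_eq]; ring

/-- The translations form a commutative group; in particular `siegelFun (-X)` is the inverse of
`siegelFun X`. -/
theorem siegelFun_add (X Y : H3 K α β) (w : W K α β) :
    siegelFun (X + Y) w = siegelFun X (siegelFun Y w) := by
  obtain ⟨a, b, c, d⟩ := w
  refine Prod.ext rfl (Prod.ext ?_ (Prod.ext ?_ ?_))
  · simp only [siegelFun, smul_add]; abel
  · simp only [siegelFun, H3.sharp_add, smul_add, H3.cross_add_left, H3.cross_smul_left]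
    rw [H3.cross_comm b, H3.cross_add_left, H3.cross_comm X, H3.cross_comm Y b,
      H3.cross_comm Y X]; abel
  · simp only [siegelFun, H3.norm_add, H3.sharp_add, H3.pair_add_left, H3.pair_add_right,
      H3.pair_smul_left, H3.pair_cross, H3.cross_comm Y X]
    rw [H3.pair_comm X (H3.sharp Y), H3.pair_comm (H3.sharp X) Y]
    ring

end Coordinates

/-! ### Invariance of the two forms under the Siegel translations -/

section Invariance
variable {K : Type*} [Field K] {α β : K}

@[simp] theorem H3.sharp_zero : H3.sharp (0 : H3 K α β) = 0 := by
  simpa using H3.sharp_smul 0 (0 : H3 K α β)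

@[simp] theorem H3.norm_zero : H3.norm (0 : H3 K α β) = 0 := by
  simpa using H3.norm_smul 0 (0 : H3 K α β)

@[simp] theorem H3.cross_zero_right (x : H3 K α β) : H3.cross x 0 = 0 := by simp [H3.cross]

@[simp] theorem H3.cross_zero_left (x : H3 K α β) : H3.cross 0 x = 0 := by simp [H3.cross]

theorem H3.sharp_neg (x : H3 K α β) : H3.sharp (-x) = H3.sharp x := by
  simpa using H3.sharp_smul (-1) x

theorem H3.norm_neg (x : H3 K α β) : H3.norm (-x) = - H3.norm x := by
  have := H3.norm_smul (-1) x
  rw [neg_one_smul] at this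
  rw [this]; ring

theorem qtr_mul_comm (x y : ℍ[K,α,β]) : qtr (x * y) = qtr (y * x) := by
  rw [qtr_eq, qtr_eq]
  congr 1
  simp
  ring

/-- One off-diagonal entry of the adjoint identity for `x^##`; the other two follow by cyclic
rotation. Since `B` is not commutative the identity is not a polynomial one in `x, y, z`: it rests
on `p p* = n(p)` and `p + p* = tr(p)`, the latter for the product `p = x y z`. -/
theorem sharp_sharp_aux (a b c : K) (x y z : ℍ[K,α,β]) :
    (x * y - c • star z) * (z * x - b • star y) - (b * c - qnorm x) • (star z * star y - a • x) =
      (a * b * c - a * qnorm x - b * qnorm y - c * qnorm z + qtr (x * y * z)) • x := by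
  have h1 : star z * z = qnorm z • 1 := by ext <;> simp [qnorm_eq] <;> ring
  have h2 : y * star y = qnorm y • 1 := by ext <;> simp [qnorm_eq] <;> ring
  have h3 : qnorm x • (star z * star y) = star z * star y * star x * x := by
    have : star x * x = qnorm x • 1 := by ext <;> simp [qnorm_eq] <;> ring
    rw [mul_assoc, this, mul_smul_comm, mul_one]
  have h4 : qtr (x * y * z) • x = x * y * z * x + star z * star y * star x * x := by
    have : qtr (x * y * z) • (1 : ℍ[K,α,β]) = x * y * z + star (x * y * z) := by
      generalize x * y * z = p
      ext <;> simp [qtr_eq]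
      ring
    rw [← one_mul x, ← smul_mul_assoc, one_mul, this, add_mul, star_mul, star_mul, ← mul_assoc (star z)]
  have e1 : (x * y - c • star z) * (z * x - b • star y) = x * y * z * x - b • (x * (y * star y))
      - c • (star z * z * x) + (b * c) • (star z * star y) := by
    simp only [sub_mul, mul_sub, smul_mul_assoc, mul_smul_comm, mul_assoc]
    module
  have e2 : (b * c - qnorm x) • (star z * star y - a • x) = (b * c) • (star z * star y)
      - qnorm x • (star z * star y) - (a * b * c - a * qnorm x) • x := by module
  rw [e1, e2, h1, h2, h3, add_smul _ (qtr _), h4]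
  simp only [smul_mul_assoc, mul_smul_comm, mul_one, one_mul]
  module

theorem H3.sharp_sharp (x : H3 K α β) : H3.sharp (H3.sharp x) = H3.norm x • x := by
  apply H3.ext_coord
  iterate 3
    simp [H3.sharp_fst, H3.sharp_snd, H3.norm, qnorm_eq, qtr_eq]
    ring
  all_goals simp only [H3.sharp_snd, H3.sharp_fst, H3.norm, Prod.smul_snd, Pi.smul_apply,
    Matrix.cons_val, star_sub, star_mul, star_star, QuaternionAlgebra.star_smul]
  · exact sharp_sharp_aux (x.1 0) (x.1 1) (x.1 2) (x.2 0) (x.2 1) (x.2 2)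
  · have := sharp_sharp_aux (x.1 1) (x.1 2) (x.1 0) (x.2 1) (x.2 2) (x.2 0)
    rw [mul_comm (x.1 2)] at this
    convert this using 2
    rw [qtr_mul_comm (x.2 1 * x.2 2), ← mul_assoc]
    ring
  · have := sharp_sharp_aux (x.1 2) (x.1 0) (x.1 1) (x.2 2) (x.2 0) (x.2 1)
    convert this using 2
    rw [qtr_mul_comm, ← mul_assoc]
    ring

variable [CharZero K]

@[simp] theorem H3.pair_zero_left (x : H3 K α β) : H3.pair 0 x = 0 := by
  simpa using H3.pair_smul_left 0 (0 : H3 K α β) x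

@[simp] theorem H3.pair_zero_right (x : H3 K α β) : H3.pair x 0 = 0 := by
  rw [H3.pair_comm, H3.pair_zero_left]

theorem H3.pair_neg_left (x y : H3 K α β) : H3.pair (-x) y = - H3.pair x y := by
  simpa using H3.pair_smul_left (-1) x y

theorem H3.pair_neg_right (x y : H3 K α β) : H3.pair x (-y) = - H3.pair x y := by
  rw [H3.pair_comm, H3.pair_neg_left, H3.pair_comm]

theorem H3.pair_cross_self (x y : H3 K α β) :
    H3.pair (H3.cross x y) y = 2 * H3.pair x (H3.sharp y) := by
  have h : H3.cross y y = (2 : K) • H3.sharp y := by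
    have h2 : H3.sharp (y + y) = (4 : K) • H3.sharp y := by
      rw [← two_smul K y, H3.sharp_smul]; norm_num
    rw [H3.cross, h2]; module
  rw [H3.pair_cross, h, H3.pair_smul_right]

/-- Pairing `x^##`, a multiple of `x`, with `x^#` computes `3 N(x^#)` in two ways. -/
theorem H3.norm_sharp (x : H3 K α β) : H3.norm (H3.sharp x) = H3.norm x ^ 2 := by
  have h := H3.pair_sharp_self (H3.sharp x)
  rw [H3.sharp_sharp, H3.pair_smul_left, H3.pair_comm, H3.pair_sharp_self] at h
  linear_combination - h / 3

/-- Completing the square, as if `b` had been translated to zero. The gain is that the base of the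
square and the argument of the norm are separately invariant under Siegel translations. -/
theorem sq_mul_quartic (a d : K) (b c : H3 K α β) :
    a ^ 2 * quartic ((a, b, c, d) : W K α β) =
      (a ^ 2 * d - a * H3.pair b c + 2 * H3.norm b) ^ 2 +
        4 * H3.norm (a • c + (-1 : K) • H3.sharp b) := by
  simp only [quartic, H3.norm_add, H3.norm_smul, H3.sharp_smul, H3.pair_smul_left,
    H3.pair_smul_right, H3.sharp_sharp, H3.norm_sharp]
  rw [H3.pair_comm c b, H3.pair_comm (H3.sharp c)]
  ring

theorem symp_siegelFun (X : H3 K α β) (u v : W K α β) :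
    symp (siegelFun X u) (siegelFun X v) = symp u v := by
  obtain ⟨a, b, c, d⟩ := u
  obtain ⟨a', b', c', d'⟩ := v
  simp only [symp, siegelFun, H3.pair_add_left, H3.pair_add_right, H3.pair_smul_left,
    H3.pair_smul_right]
  have h1 := H3.pair_cross_self b X
  have h2 := H3.pair_cross_self b' X
  have h3 := H3.pair_sharp_self X
  have h4 := H3.pair_cross b X b'
  rw [H3.cross_comm X, H3.pair_comm b (H3.cross b' X)] at h4
  rw [H3.pair_comm b (H3.cross b' X)]
  rw [H3.pair_comm X (H3.cross b' X), H3.pair_comm X (H3.sharp X), H3.pair_comm X c',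
    H3.pair_comm (H3.sharp X) b']
  linear_combination a' * h1 - a * h2 + h4

theorem quartic_siegelFun_of_ne (X : H3 K α β) (w : W K α β) (h : w.1 ≠ 0) :
    quartic (siegelFun X w) = quartic w := by
  obtain ⟨a, b, c, d⟩ := w
  have h : a ≠ 0 := h
  refine mul_left_cancel₀ (pow_ne_zero 2 h) ?_
  simp only [siegelFun]
  rw [sq_mul_quartic, sq_mul_quartic]
  have e1 : a • (c + H3.cross b X + a • H3.sharp X) + (-1 : K) • H3.sharp (b + a • X) =
      a • c + (-1 : K) • H3.sharp b := by
    rw [H3.sharp_add, H3.sharp_smul, H3.cross_comm b (a • X), H3.cross_smul_left, H3.cross_comm X]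
    module
  rw [e1]
  congr 2
  simp only [H3.pair_add_left, H3.pair_add_right, H3.pair_smul_left,
    H3.pair_smul_right, H3.norm_add, H3.norm_smul, H3.sharp_smul]
  have h1 := H3.pair_cross_self b X
  have h2 := H3.pair_cross_self X b
  have h3 := H3.pair_sharp_self X
  rw [H3.pair_comm b (H3.cross b X), H3.pair_comm X (H3.cross b X), H3.pair_comm X (H3.sharp X),
    H3.pair_comm X c]
  rw [H3.cross_comm X b, H3.pair_comm X] at h2
  linear_combination -a * h2 - a ^ 2 * h1 - a ^ 3 * h3

/-- Functions of one variable that are given by a polynomial. -/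
def IsPolyFun (f : K → K) : Prop := ∃ p : Polynomial K, ∀ t, f t = p.eval t

omit [CharZero K] in
theorem isPolyFun_const (c : K) : IsPolyFun (fun _ => c) := ⟨.C c, by simp⟩
omit [CharZero K] in
theorem isPolyFun_id : IsPolyFun (fun t : K => t) := ⟨.X, by simp⟩
omit [CharZero K] in
theorem IsPolyFun.add {f g : K → K} (hf : IsPolyFun f) (hg : IsPolyFun g) :
    IsPolyFun (fun t => f t + g t) := by
  obtain ⟨p, hp⟩ := hf; obtain ⟨q, hq⟩ := hg
  exact ⟨p + q, by simp [hp, hq]⟩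
omit [CharZero K] in
theorem IsPolyFun.sub {f g : K → K} (hf : IsPolyFun f) (hg : IsPolyFun g) :
    IsPolyFun (fun t => f t - g t) := by
  obtain ⟨p, hp⟩ := hf; obtain ⟨q, hq⟩ := hg
  exact ⟨p - q, by simp [hp, hq]⟩
omit [CharZero K] in
theorem IsPolyFun.mul {f g : K → K} (hf : IsPolyFun f) (hg : IsPolyFun g) :
    IsPolyFun (fun t => f t * g t) := by
  obtain ⟨p, hp⟩ := hf; obtain ⟨q, hq⟩ := hg
  exact ⟨p * q, by simp [hp, hq]⟩
omit [CharZero K] in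
theorem IsPolyFun.pow {f : K → K} (hf : IsPolyFun f) (n : ℕ) :
    IsPolyFun (fun t => f t ^ n) := by
  obtain ⟨p, hp⟩ := hf
  exact ⟨p ^ n, by simp [hp]⟩

/-- A polynomial function vanishing outside finitely many points vanishes. -/
theorem IsPolyFun.eq_zero {f : K → K} (hf : IsPolyFun f) (s : Set K) (hs : s.Finite)
    (h : ∀ t ∉ s, f t = 0) (t : K) : f t = 0 := by
  obtain ⟨p, hp⟩ := hf
  have : p = 0 := Polynomial.eq_zero_of_infinite_isRoot p
    (hs.infinite_compl.mono fun t ht => by simpa [hp] using h t ht)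
  simp [hp, this]

/-- For fixed `b, c, d` the difference of the two sides is a polynomial in the first coordinate. It
vanishes away from `0`, hence also at `0` because `K` is infinite. -/
theorem quartic_siegelFun (X : H3 K α β) (w : W K α β) :
    quartic (siegelFun X w) = quartic w := by
  obtain ⟨a, b, c, d⟩ := w
  have hp : IsPolyFun (fun t : K =>
      quartic (siegelFun X ((t, b, c, d) : W K α β)) - quartic ((t, b, c, d) : W K α β)) := by
    simp only [quartic, siegelFun, H3.pair_add_left, H3.pair_add_right, H3.pair_smul_left,
      H3.pair_smul_right, H3.norm_add, H3.norm_smul, H3.sharp_smul, H3.sharp_add,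
      H3.cross_comm _ (_ • X), H3.cross_smul_left, H3.cross_comm _ (_ • H3.sharp X)]
    repeat' first
      | exact isPolyFun_const _
      | exact isPolyFun_id
      | apply IsPolyFun.sub
      | apply IsPolyFun.add
      | apply IsPolyFun.mul
      | apply IsPolyFun.pow
  exact sub_eq_zero.1 (hp.eq_zero {0} (Set.finite_singleton 0)
    (fun t ht => sub_eq_zero.2 (quartic_siegelFun_of_ne X _ ht)) a)

end Invariance

/-! ### Elements of `G` and their effect on rank one elements -/

section Group
variable {K : Type*} [Field K] {α β : K}

theorem GG_trans {g h : (W K α β ≃ₗ[K] W K α β) × Kˣ} (hg : g ∈ GG K α β) (hh : h ∈ GG K α β) :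
    (g.1.trans h.1, g.2 * h.2) ∈ GG K α β :=
  ⟨fun u v => by simp [hh.1, hg.1]; ring, fun w => by simp [hh.2, hg.2]; ring⟩

theorem GG_symm {g : (W K α β ≃ₗ[K] W K α β) × Kˣ} (hg : g ∈ GG K α β) :
    (g.1.symm, g.2⁻¹) ∈ GG K α β := by
  refine ⟨fun u v => ?_, fun w => ?_⟩
  · have := hg.1 (g.1.symm u) (g.1.symm v)
    simp only [LinearEquiv.apply_symm_apply] at this
    simp [this]
  · have := hg.2 (g.1.symm w)
    simp only [LinearEquiv.apply_symm_apply] at this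
    simp [this]

variable [CharZero K]

/-- The element `(a, b, c, d) ↦ (a, b + aX, c + b × X + aX^#, d + tr(c, X) + tr(b, X^#) + aN(X))`
of `G(K)`. -/
def siegel (X : H3 K α β) : W K α β ≃ₗ[K] W K α β where
  toFun := siegelFun X
  invFun := siegelFun (-X)
  map_add' u v := by
    refine Prod.ext rfl (Prod.ext ?_ (Prod.ext ?_ ?_))
    · simp only [siegelFun, Prod.fst_add, Prod.snd_add]; module
    · simp only [siegelFun, Prod.fst_add, Prod.snd_add, H3.cross_add_left]; module
    · simp only [siegelFun, Prod.fst_add, Prod.snd_add, H3.pair_add_left]; ring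
  map_smul' t u := by
    refine Prod.ext rfl (Prod.ext ?_ (Prod.ext ?_ ?_))
    · simp only [siegelFun, Prod.smul_fst, Prod.smul_snd, RingHom.id_apply, smul_eq_mul]; module
    · simp only [siegelFun, Prod.smul_fst, Prod.smul_snd, RingHom.id_apply, smul_eq_mul,
        H3.cross_smul_left]; module
    · simp only [siegelFun, Prod.smul_fst, Prod.smul_snd, RingHom.id_apply, smul_eq_mul,
        H3.pair_smul_left]; ring
  left_inv w := by
    rw [← siegelFun_add]; simp [siegelFun]
  right_inv w := by
    rw [← siegelFun_add]; simp [siegelFun]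

@[simp] theorem siegel_apply (X : H3 K α β) (w : W K α β) : siegel X w = siegelFun X w := rfl

theorem siegel_mem_GG (X : H3 K α β) : (siegel X, 1) ∈ GG K α β :=
  ⟨fun u v => by simp [symp_siegelFun], fun w => by simp [quartic_siegelFun]⟩

omit [CharZero K] in
variable (K α β) in
/-- The action of `J6` on `W`. -/
def weyl : W K α β ≃ₗ[K] W K α β where
  toFun w := (-w.2.2.2, w.2.2.1, -w.2.1, w.1)
  invFun w := (w.2.2.2, -w.2.2.1, w.2.1, -w.1)
  map_add' u v := by
    refine Prod.ext ?_ (Prod.ext ?_ (Prod.ext ?_ ?_)) <;> simp [add_comm]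
  map_smul' t u := by
    refine Prod.ext ?_ (Prod.ext ?_ (Prod.ext ?_ ?_)) <;> simp
  left_inv w := by simp
  right_inv w := by simp

omit [CharZero K] in
theorem weyl_apply (w : W K α β) : weyl K α β w = (-w.2.2.2, w.2.2.1, -w.2.1, w.1) := rfl

theorem weyl_mem_GG : (weyl K α β, 1) ∈ GG K α β := by
  refine ⟨fun u v => ?_, fun w => ?_⟩
  · simp only [symp, weyl_apply, H3.pair_neg_left, H3.pair_neg_right, Units.val_one]
    rw [H3.pair_comm u.2.1, H3.pair_comm u.2.2.1]
    ring
  · simp only [quartic, weyl_apply, H3.pair_neg_right, H3.sharp_neg,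
      H3.norm_neg, Units.val_one]
    rw [H3.pair_comm w.2.1, H3.pair_comm (H3.sharp w.2.1)]
    ring

omit [CharZero K] in
variable (α β) in
/-- The action of `diag(1, ν)` on `W`. -/
def simil (ν : Kˣ) : W K α β ≃ₗ[K] W K α β where
  toFun w := ((ν⁻¹ : Kˣ) * w.1, w.2.1, (ν : K) • w.2.2.1, (ν : K) ^ 2 * w.2.2.2)
  invFun w := ((ν : K) * w.1, w.2.1, ((ν⁻¹ : Kˣ) : K) • w.2.2.1, ((ν⁻¹ : Kˣ) : K) ^ 2 * w.2.2.2)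
  map_add' u v := by
    refine Prod.ext ?_ (Prod.ext ?_ (Prod.ext ?_ ?_)) <;> simp [mul_add]
  map_smul' t u := by
    refine Prod.ext ?_ (Prod.ext rfl (Prod.ext ?_ ?_))
    · exact mul_left_comm _ _ _
    · exact smul_comm _ _ _
    · exact mul_left_comm _ _ _
  left_inv w := by
    refine Prod.ext ?_ (Prod.ext rfl (Prod.ext ?_ ?_)) 
    · simp [← mul_assoc]
    · simp [smul_smul]
    · simp [← mul_assoc, ← mul_pow]
  right_inv w := by
    refine Prod.ext ?_ (Prod.ext rfl (Prod.ext ?_ ?_)) 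
    · simp [← mul_assoc]
    · simp [smul_smul]
    · simp [← mul_assoc, ← mul_pow]

omit [CharZero K] in
theorem simil_apply (ν : Kˣ) (w : W K α β) : simil α β ν w =
    ((ν⁻¹ : Kˣ) * w.1, w.2.1, (ν : K) • w.2.2.1, (ν : K) ^ 2 * w.2.2.2) := rfl

theorem simil_mem_GG (ν : Kˣ) : (simil α β ν, ν) ∈ GG K α β := by
  refine ⟨fun u v => ?_, fun w => ?_⟩
  · simp only [symp, simil_apply, H3.pair_smul_left, H3.pair_smul_right, Units.val_inv_eq_inv_val]
    field_simp
  · simp only [quartic, simil_apply, H3.pair_smul_right, H3.sharp_smul,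
      H3.norm_smul, Units.val_inv_eq_inv_val]
    field_simp

theorem fourForm_GG {g : (W K α β ≃ₗ[K] W K α β) × Kˣ} (hg : g ∈ GG K α β)
    (w : Fin 4 → W K α β) : fourForm (fun i => g.1 (w i)) = (g.2 : K) ^ 2 * fourForm w := by
  simp only [fourForm, ← map_sum, hg.2, Finset.mul_sum]
  refine Finset.sum_congr rfl fun S _ => by ring

theorem IsRankOne.map {g : (W K α β ≃ₗ[K] W K α β) × Kˣ} (hg : g ∈ GG K α β) {v : W K α β}
    (hv : IsRankOne v) : IsRankOne (g.1 v) := by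
  refine ⟨by simpa using hv.1, fun x y hy => ?_⟩
  obtain ⟨x, rfl⟩ := g.1.surjective x
  obtain ⟨y, rfl⟩ := g.1.surjective y
  rw [hg.1] at hy
  have h := fourForm_GG hg ![v, v, x, y]
  rw [hv.2 x y (by simpa using hy), mul_zero] at h
  refine Eq.trans (congrArg fourForm ?_) h
  funext i; fin_cases i <;> rfl

theorem isRankOne_map_iff {g : (W K α β ≃ₗ[K] W K α β) × Kˣ} (hg : g ∈ GG K α β) {v : W K α β} :
    IsRankOne (g.1 v) ↔ IsRankOne v :=
  ⟨fun h => by simpa using h.map (GG_symm hg), fun h => h.map hg⟩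

end Group

/-! ### The embedding in the exterior cube and the generators of `GSp₆` -/

section Wedge
variable {K : Type*} [Field K] {α β : K}

theorem wedge_add_left (x x' y z : W6 K) : wedge (x + x') y z = wedge x y z + wedge x' y z :=
  (exteriorPower.ιMulti K 3).toMultilinearMap.cons_add ![y, z] x x'

theorem wedge_smul_left (t : K) (x y z : W6 K) : wedge (t • x) y z = t • wedge x y z :=
  (exteriorPower.ιMulti K 3).toMultilinearMap.cons_smul ![y, z] t x

theorem wedge_swap_left (x y z : W6 K) : wedge x y z = - wedge y x z := by
  have h := (exteriorPower.ιMulti K 3).map_swap ![y, x, z] (i := 0) (j := 1) (by decide)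
  rw [wedge, wedge, ← h]
  congr 1
  funext i; fin_cases i <;> simp [Equiv.swap_apply_of_ne_of_ne]

theorem wedge_swap_right (x y z : W6 K) : wedge x y z = - wedge x z y := by
  have h := (exteriorPower.ιMulti K 3).map_swap ![x, z, y] (i := 1) (j := 2) (by decide)
  rw [wedge, wedge, ← h]
  congr 1
  funext i; fin_cases i <;> simp [Equiv.swap_apply_of_ne_of_ne]

theorem wedge_add_mid (x y y' z : W6 K) : wedge x (y + y') z = wedge x y z + wedge x y' z := by
  rw [wedge_swap_left, wedge_add_left, neg_add, ← wedge_swap_left, ← wedge_swap_left]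

theorem wedge_smul_mid (t : K) (x y z : W6 K) : wedge x (t • y) z = t • wedge x y z := by
  rw [wedge_swap_left, wedge_smul_left, wedge_swap_left x, smul_neg]

theorem wedge_add_right (x y z z' : W6 K) : wedge x y (z + z') = wedge x y z + wedge x y z' := by
  rw [wedge_swap_right, wedge_add_mid, neg_add, ← wedge_swap_right, ← wedge_swap_right]

theorem wedge_smul_right (t : K) (x y z : W6 K) : wedge x y (t • z) = t • wedge x y z := by
  rw [wedge_swap_right, wedge_smul_mid, wedge_swap_right x y, smul_neg]

@[simp] theorem wedge_self_left (x z : W6 K) : wedge x x z = 0 :=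
  (exteriorPower.ιMulti K 3).map_eq_zero_of_eq ![x, x, z] (i := 0) (j := 1) rfl (by decide)

@[simp] theorem wedge_self_right (x z : W6 K) : wedge z x x = 0 :=
  (exteriorPower.ιMulti K 3).map_eq_zero_of_eq ![z, x, x] (i := 1) (j := 2) rfl (by decide)

@[simp] theorem wedge_self_outer (x z : W6 K) : wedge x z x = 0 :=
  (exteriorPower.ιMulti K 3).map_eq_zero_of_eq ![x, z, x] (i := 0) (j := 2) rfl (by decide)

theorem wedge_neg_left (x y z : W6 K) : wedge (-x) y z = - wedge x y z := by
  rw [← neg_one_smul K, wedge_smul_left]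
  exact neg_one_smul K (_ : ⋀[K]^3 (W6 K))

theorem wedge_neg_mid (x y z : W6 K) : wedge x (-y) z = - wedge x y z := by
  rw [← neg_one_smul K, wedge_smul_mid]
  exact neg_one_smul K (_ : ⋀[K]^3 (W6 K))

theorem wedge_neg_right (x y z : W6 K) : wedge x y (-z) = - wedge x y z := by
  rw [← neg_one_smul K, wedge_smul_right]
  exact neg_one_smul K (_ : ⋀[K]^3 (W6 K))

theorem act_wedge_tmul (g : Matrix (Fin 3 ⊕ Fin 3) (Fin 3 ⊕ Fin 3) K) (ν : Kˣ) (x y z : W6 K)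
    (q : ℍ[K,α,β]) : act g ν (wedge x y z ⊗ₜ q) =
      ((ν⁻¹ : Kˣ) : K) • (wedge (x ᵥ* g) (y ᵥ* g) (z ᵥ* g) ⊗ₜ[K] q) := by
  simp only [act, LinearMap.rTensor_tmul, wedge, exteriorPower.map_apply_ιMulti]
  congr 4
  funext i; fin_cases i <;> rfl

theorem act_add (g : Matrix (Fin 3 ⊕ Fin 3) (Fin 3 ⊕ Fin 3) K) (ν : Kˣ)
    (s t : ⋀[K]^3 (W6 K) ⊗[K] ℍ[K,α,β]) : act g ν (s + t) = act g ν s + act g ν t := by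
  simp [act]

theorem act_smul (g : Matrix (Fin 3 ⊕ Fin 3) (Fin 3 ⊕ Fin 3) K) (ν : Kˣ) (k : K)
    (t : ⋀[K]^3 (W6 K) ⊗[K] ℍ[K,α,β]) : act g ν (k • t) = k • act g ν t := by
  rw [act, act, map_smul, smul_comm]

theorem act_mul (g g' : Matrix (Fin 3 ⊕ Fin 3) (Fin 3 ⊕ Fin 3) K) (ν ν' : Kˣ)
    (t : ⋀[K]^3 (W6 K) ⊗[K] ℍ[K,α,β]) : act (g * g') (ν * ν') t = act g' ν' (act g ν t) := by
  have : (g * g').vecMulLinear = g'.vecMulLinear ∘ₗ g.vecMulLinear := by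
    refine LinearMap.ext fun x => ?_
    simp [Matrix.vecMul_vecMul]
  simp only [act, this, exteriorPower.map_comp, LinearMap.rTensor_comp, LinearMap.map_smul,
    LinearMap.comp_apply, smul_smul]
  simp [mul_comm]

theorem act_one (t : ⋀[K]^3 (W6 K) ⊗[K] ℍ[K,α,β]) : act 1 1 t = t := by
  have : (1 : Matrix (Fin 3 ⊕ Fin 3) (Fin 3 ⊕ Fin 3) K).vecMulLinear = LinearMap.id := by
    ext; simp
  simp [act, this]

theorem emb_eq (w : W K α β) : emb w =
    wedge (eV 0) (eV 1) (eV 2) ⊗ₜ[K] (w.1 : ℍ[K,α,β])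
    + ((wedge (eV 1) (eV 2) (fV 0) ⊗ₜ[K] (w.2.1.1 0 : ℍ[K,α,β])
      + wedge (eV 1) (eV 2) (fV 1) ⊗ₜ[K] w.2.1.2 2
      + wedge (eV 1) (eV 2) (fV 2) ⊗ₜ[K] star (w.2.1.2 1))
    + (wedge (eV 2) (eV 0) (fV 0) ⊗ₜ[K] star (w.2.1.2 2)
      + wedge (eV 2) (eV 0) (fV 1) ⊗ₜ[K] (w.2.1.1 1 : ℍ[K,α,β])
      + wedge (eV 2) (eV 0) (fV 2) ⊗ₜ[K] w.2.1.2 0)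
    + (wedge (eV 0) (eV 1) (fV 0) ⊗ₜ[K] w.2.1.2 1
      + wedge (eV 0) (eV 1) (fV 1) ⊗ₜ[K] star (w.2.1.2 0)
      + wedge (eV 0) (eV 1) (fV 2) ⊗ₜ[K] (w.2.1.1 2 : ℍ[K,α,β])))
    + ((wedge (fV 1) (fV 2) (eV 0) ⊗ₜ[K] (w.2.2.1.1 0 : ℍ[K,α,β])
      + wedge (fV 1) (fV 2) (eV 1) ⊗ₜ[K] w.2.2.1.2 2
      + wedge (fV 1) (fV 2) (eV 2) ⊗ₜ[K] star (w.2.2.1.2 1))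
    + (wedge (fV 2) (fV 0) (eV 0) ⊗ₜ[K] star (w.2.2.1.2 2)
      + wedge (fV 2) (fV 0) (eV 1) ⊗ₜ[K] (w.2.2.1.1 1 : ℍ[K,α,β])
      + wedge (fV 2) (fV 0) (eV 2) ⊗ₜ[K] w.2.2.1.2 0)
    + (wedge (fV 0) (fV 1) (eV 0) ⊗ₜ[K] w.2.2.1.2 1
      + wedge (fV 0) (fV 1) (eV 1) ⊗ₜ[K] star (w.2.2.1.2 0)
      + wedge (fV 0) (fV 1) (eV 2) ⊗ₜ[K] (w.2.2.1.1 2 : ℍ[K,α,β])))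
    + wedge (fV 0) (fV 1) (fV 2) ⊗ₜ[K] (w.2.2.2 : ℍ[K,α,β]) := by
  simp only [emb, Fin.sum_univ_three, H3.toMatrix]
  rfl

theorem coe_eq_smul_one (k : K) : (k : ℍ[K,α,β]) = k • 1 := by
  ext <;> simp

theorem star_eq_sub (x : ℍ[K,α,β]) : star x = qtr x • 1 - x := by
  ext <;> simp [qtr_eq]; ring

/-- The matrix of the element `siegel X` for real `X`. -/
def siegelMat (S : Matrix (Fin 3) (Fin 3) K) : Matrix (Fin 3 ⊕ Fin 3) (Fin 3 ⊕ Fin 3) K :=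
  Matrix.fromBlocks 1 S 0 1

theorem eV_siegelMat (S : Matrix (Fin 3) (Fin 3) K) (i : Fin 3) :
    eV i ᵥ* siegelMat S = eV i + (S i 0 • fV 0 + S i 1 • fV 1 + S i 2 • fV 2) := by
  funext j
  rcases j with j | j <;> fin_cases i <;> fin_cases j <;> simp [eV, fV, siegelMat, Matrix.one_apply]

theorem fV_siegelMat (S : Matrix (Fin 3) (Fin 3) K) (i : Fin 3) :
    fV i ᵥ* siegelMat S = fV i := by
  funext j
  rcases j with j | j <;> fin_cases i <;> fin_cases j <;> simp [eV, fV, siegelMat, Matrix.one_apply]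

theorem eV_J6 (i : Fin 3) : eV i ᵥ* J6 K = fV i := by
  funext j
  rcases j with j | j <;> fin_cases i <;> fin_cases j <;> simp [eV, fV, J6, Matrix.one_apply]

theorem fV_J6 (i : Fin 3) : fV i ᵥ* J6 K = - eV i := by
  funext j
  rcases j with j | j <;> fin_cases i <;> fin_cases j <;> simp [eV, fV, J6, Matrix.one_apply]

/-- Real elements of `H₃(B)`, with diagonal `c` and off-diagonal entries `r`. -/
def realH3 (c r : Fin 3 → K) : H3 K α β := (c, fun i => (r i : ℍ[K,α,β]))

theorem emb_weyl (w : W K α β) : emb (weyl K α β w) = act (J6 K) 1 (emb w) := by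
  simp only [emb_eq, act_add, act_wedge_tmul, eV_J6, fV_J6, weyl_apply, wedge_neg_left,
    wedge_neg_right, wedge_neg_mid]
  simp [TensorProduct.neg_tmul, TensorProduct.tmul_neg]
  abel

theorem wedge_rot (x y z : W6 K) : wedge y z x = wedge x y z := by
  rw [wedge_swap_left x y z, wedge_swap_right y x z, neg_neg]

theorem wedge_eV_fV_fV (i j k : Fin 3) : wedge (eV i) (fV j) (fV k) =
    wedge (fV j) (fV k) (eV i : W6 K) := by
  rw [wedge_swap_left, wedge_swap_right, neg_neg]

theorem wedge_fV_eV_fV (i j k : Fin 3) : wedge (fV j) (eV i) (fV k) =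
    - wedge (fV j) (fV k) (eV i : W6 K) := by
  rw [wedge_swap_right]

theorem wedge_eV_fV_eV (i j k : Fin 3) : wedge (eV i) (fV j) (eV k) =
    - wedge (eV i) (eV k) (fV j : W6 K) := by
  rw [wedge_swap_right]

theorem wedge_fV_eV_eV (i j k : Fin 3) : wedge (fV i) (eV j) (eV k) =
    wedge (eV j) (eV k) (fV i : W6 K) := by
  rw [wedge_swap_left, wedge_swap_right, neg_neg]

set_option maxHeartbeats 4000000 in
-- The space of real symmetric matrices is spanned by six coordinate directions. Compatibility of
-- the translation with the exterior cube is expanded in each direction separately, here the first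
-- diagonal one, and assembled in `emb_siegel`.
theorem emb_siegel_diag0 [CharZero K] (t : K) (w : W K α β) :
    emb (siegel (realH3 ![t, 0, 0] 0) w) =
      act (siegelMat !![t, 0, 0; 0, 0, 0; 0, 0, 0]) 1 (emb w) := by
  simp only [emb_eq, act_add, act_wedge_tmul, eV_siegelMat, fV_siegelMat, siegel_apply, siegelFun,
    realH3, H3.norm, H3.pair_eq, coe_eq_smul_one, star_eq_sub]
  simp [H3.cross_fst, H3.cross_snd, H3.sharp_fst, H3.sharp_snd, star_eq_sub,
    wedge_add_left, wedge_add_mid, wedge_add_right, wedge_smul_left, wedge_smul_mid,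
    wedge_smul_right, TensorProduct.add_tmul, TensorProduct.tmul_add, TensorProduct.tmul_sub,
    wedge_eV_fV_fV, wedge_fV_eV_fV, wedge_eV_fV_eV, wedge_fV_eV_eV,
    wedge_swap_left (fV 1) (fV 0), wedge_swap_left (fV 2) (fV 1), wedge_swap_left (fV 0) (fV 2),
    wedge_swap_left (eV 1) (eV 0), wedge_swap_left (eV 2) (eV 1), wedge_swap_left (eV 0) (eV 2),
    TensorProduct.neg_tmul, TensorProduct.tmul_neg, TensorProduct.tmul_smul,
    ← TensorProduct.smul_tmul', qtr_eq, qnorm_eq, Matrix.vecHead, Matrix.vecTail, wedge_rot (fV 0) (fV 1) (fV 2),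
    ← wedge_rot (fV 2) (fV 0) (fV 1)]
  module

set_option maxHeartbeats 4000000 in
theorem emb_siegel_off0 [CharZero K] (t : K) (w : W K α β) :
    emb (siegel (realH3 0 ![t, 0, 0]) w) =
      act (siegelMat !![0, 0, 0; 0, 0, t; 0, t, 0]) 1 (emb w) := by
  simp only [emb_eq, act_add, act_wedge_tmul, eV_siegelMat, fV_siegelMat, siegel_apply, siegelFun,
    realH3, H3.norm, H3.pair_eq, coe_eq_smul_one, star_eq_sub]
  simp [H3.cross_fst, H3.cross_snd, H3.sharp_fst, H3.sharp_snd, star_eq_sub,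
    wedge_add_left, wedge_add_mid, wedge_add_right, wedge_smul_left, wedge_smul_mid,
    wedge_smul_right, TensorProduct.add_tmul, TensorProduct.tmul_add, TensorProduct.tmul_sub,
    wedge_eV_fV_fV, wedge_fV_eV_fV, wedge_eV_fV_eV, wedge_fV_eV_eV,
    wedge_swap_left (fV 1) (fV 0), wedge_swap_left (fV 2) (fV 1), wedge_swap_left (fV 0) (fV 2),
    wedge_swap_left (eV 1) (eV 0), wedge_swap_left (eV 2) (eV 1), wedge_swap_left (eV 0) (eV 2),
    TensorProduct.neg_tmul, TensorProduct.tmul_neg, TensorProduct.tmul_smul,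
    ← TensorProduct.smul_tmul', qtr_eq, qnorm_eq, Matrix.vecHead, Matrix.vecTail, wedge_rot (fV 0) (fV 1) (fV 2),
    ← wedge_rot (fV 2) (fV 0) (fV 1)]
  module

set_option maxHeartbeats 4000000 in
theorem emb_siegel_diag1 [CharZero K] (t : K) (w : W K α β) :
    emb (siegel (realH3 ![0, t, 0] 0) w) =
      act (siegelMat !![0, 0, 0; 0, t, 0; 0, 0, 0]) 1 (emb w) := by
  simp only [emb_eq, act_add, act_wedge_tmul, eV_siegelMat, fV_siegelMat, siegel_apply, siegelFun,
    realH3, H3.norm, H3.pair_eq, coe_eq_smul_one, star_eq_sub]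
  simp [H3.cross_fst, H3.cross_snd, H3.sharp_fst, H3.sharp_snd, star_eq_sub,
    wedge_add_left, wedge_add_mid, wedge_add_right, wedge_smul_left, wedge_smul_mid,
    wedge_smul_right, TensorProduct.add_tmul, TensorProduct.tmul_add, TensorProduct.tmul_sub,
    wedge_eV_fV_fV, wedge_fV_eV_fV, wedge_eV_fV_eV, wedge_fV_eV_eV,
    wedge_swap_left (fV 1) (fV 0), wedge_swap_left (fV 2) (fV 1), wedge_swap_left (fV 0) (fV 2),
    wedge_swap_left (eV 1) (eV 0), wedge_swap_left (eV 2) (eV 1), wedge_swap_left (eV 0) (eV 2),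
    TensorProduct.neg_tmul, TensorProduct.tmul_neg, TensorProduct.tmul_smul,
    ← TensorProduct.smul_tmul', qtr_eq, qnorm_eq, Matrix.vecHead, Matrix.vecTail, wedge_rot (fV 0) (fV 1) (fV 2),
    ← wedge_rot (fV 2) (fV 0) (fV 1)]
  module

set_option maxHeartbeats 4000000 in
theorem emb_siegel_off1 [CharZero K] (t : K) (w : W K α β) :
    emb (siegel (realH3 0 ![0, t, 0]) w) =
      act (siegelMat !![0, 0, t; 0, 0, 0; t, 0, 0]) 1 (emb w) := by
  simp only [emb_eq, act_add, act_wedge_tmul, eV_siegelMat, fV_siegelMat, siegel_apply, siegelFun,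
    realH3, H3.norm, H3.pair_eq, coe_eq_smul_one, star_eq_sub]
  simp [H3.cross_fst, H3.cross_snd, H3.sharp_fst, H3.sharp_snd, star_eq_sub,
    wedge_add_left, wedge_add_mid, wedge_add_right, wedge_smul_left, wedge_smul_mid,
    wedge_smul_right, TensorProduct.add_tmul, TensorProduct.tmul_add, TensorProduct.tmul_sub,
    wedge_eV_fV_fV, wedge_fV_eV_fV, wedge_eV_fV_eV, wedge_fV_eV_eV,
    wedge_swap_left (fV 1) (fV 0), wedge_swap_left (fV 2) (fV 1), wedge_swap_left (fV 0) (fV 2),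
    wedge_swap_left (eV 1) (eV 0), wedge_swap_left (eV 2) (eV 1), wedge_swap_left (eV 0) (eV 2),
    TensorProduct.neg_tmul, TensorProduct.tmul_neg, TensorProduct.tmul_smul,
    ← TensorProduct.smul_tmul', qtr_eq, qnorm_eq, Matrix.vecHead, Matrix.vecTail, wedge_rot (fV 0) (fV 1) (fV 2),
    ← wedge_rot (fV 2) (fV 0) (fV 1)]
  module

set_option maxHeartbeats 4000000 in
theorem emb_siegel_diag2 [CharZero K] (t : K) (w : W K α β) :
    emb (siegel (realH3 ![0, 0, t] 0) w) =
      act (siegelMat !![0, 0, 0; 0, 0, 0; 0, 0, t]) 1 (emb w) := by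
  simp only [emb_eq, act_add, act_wedge_tmul, eV_siegelMat, fV_siegelMat, siegel_apply, siegelFun,
    realH3, H3.norm, H3.pair_eq, coe_eq_smul_one, star_eq_sub]
  simp [H3.cross_fst, H3.cross_snd, H3.sharp_fst, H3.sharp_snd, star_eq_sub,
    wedge_add_left, wedge_add_mid, wedge_add_right, wedge_smul_left, wedge_smul_mid,
    wedge_smul_right, TensorProduct.add_tmul, TensorProduct.tmul_add, TensorProduct.tmul_sub,
    wedge_eV_fV_fV, wedge_fV_eV_fV, wedge_eV_fV_eV, wedge_fV_eV_eV,
    wedge_swap_left (fV 1) (fV 0), wedge_swap_left (fV 2) (fV 1), wedge_swap_left (fV 0) (fV 2),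
    wedge_swap_left (eV 1) (eV 0), wedge_swap_left (eV 2) (eV 1), wedge_swap_left (eV 0) (eV 2),
    TensorProduct.neg_tmul, TensorProduct.tmul_neg, TensorProduct.tmul_smul,
    ← TensorProduct.smul_tmul', qtr_eq, qnorm_eq, Matrix.vecHead, Matrix.vecTail, wedge_rot (fV 0) (fV 1) (fV 2),
    ← wedge_rot (fV 2) (fV 0) (fV 1)]
  module

set_option maxHeartbeats 4000000 in
theorem emb_siegel_off2 [CharZero K] (t : K) (w : W K α β) :
    emb (siegel (realH3 0 ![0, 0, t]) w) =
      act (siegelMat !![0, t, 0; t, 0, 0; 0, 0, 0]) 1 (emb w) := by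
  simp only [emb_eq, act_add, act_wedge_tmul, eV_siegelMat, fV_siegelMat, siegel_apply, siegelFun,
    realH3, H3.norm, H3.pair_eq, coe_eq_smul_one, star_eq_sub]
  simp [H3.cross_fst, H3.cross_snd, H3.sharp_fst, H3.sharp_snd, star_eq_sub,
    wedge_add_left, wedge_add_mid, wedge_add_right, wedge_smul_left, wedge_smul_mid,
    wedge_smul_right, TensorProduct.add_tmul, TensorProduct.tmul_add, TensorProduct.tmul_sub,
    wedge_eV_fV_fV, wedge_fV_eV_fV, wedge_eV_fV_eV, wedge_fV_eV_eV,
    wedge_swap_left (fV 1) (fV 0), wedge_swap_left (fV 2) (fV 1), wedge_swap_left (fV 0) (fV 2),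
    wedge_swap_left (eV 1) (eV 0), wedge_swap_left (eV 2) (eV 1), wedge_swap_left (eV 0) (eV 2),
    TensorProduct.neg_tmul, TensorProduct.tmul_neg, TensorProduct.tmul_smul,
    ← TensorProduct.smul_tmul', qtr_eq, qnorm_eq, Matrix.vecHead, Matrix.vecTail, wedge_rot (fV 0) (fV 1) (fV 2),
    ← wedge_rot (fV 2) (fV 0) (fV 1)]
  module

end Wedge

/-! ### Coordinates on the exterior cube, the contraction, and lifts of generators -/

section Coord
variable {K : Type*} [Field K] {α β : K}

/-- The minor of three row vectors with column indices `p`, as a function on `⋀³ W₆`. -/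
def minor (p : Fin 3 → Fin 3 ⊕ Fin 3) : ⋀[K]^3 (W6 K) →ₗ[K] K :=
  exteriorPower.alternatingMapLinearEquiv
    (Matrix.detRowAlternating.compLinearMap (LinearMap.funLeft K K p))

theorem minor_wedge (p : Fin 3 → Fin 3 ⊕ Fin 3) (x y z : W6 K) :
    minor p (wedge x y z) = x (p 0) * y (p 1) * z (p 2) - x (p 0) * y (p 2) * z (p 1)
      - x (p 1) * y (p 0) * z (p 2) + x (p 1) * y (p 2) * z (p 0)
      + x (p 2) * y (p 0) * z (p 1) - x (p 2) * y (p 1) * z (p 0) := by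
  rw [minor, wedge, exteriorPower.alternatingMapLinearEquiv_apply_ιMulti]
  exact Matrix.det_fin_three (Matrix.of fun i j => ![x, y, z] i (p j))

/-- The coordinate in `B` of an element of `⋀³ W₆ ⊗ B`. -/
def coord (p : Fin 3 → Fin 3 ⊕ Fin 3) : ⋀[K]^3 (W6 K) ⊗[K] ℍ[K,α,β] →ₗ[K] ℍ[K,α,β] :=
  (TensorProduct.lid K _).toLinearMap ∘ₗ LinearMap.rTensor _ (minor p)

theorem coord_tmul (p : Fin 3 → Fin 3 ⊕ Fin 3) (x y z : W6 K) (q : ℍ[K,α,β]) :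
    coord p (wedge x y z ⊗ₜ[K] q) = minor p (wedge x y z) • q := by
  simp [coord]

theorem coord_emb (w : W K α β) :
    coord ![.inl 0, .inl 1, .inl 2] (emb w) = (w.1 : ℍ[K,α,β]) ∧
    coord ![.inl 1, .inl 2, .inr 0] (emb w) = (w.2.1.1 0 : ℍ[K,α,β]) ∧
    coord ![.inl 2, .inl 0, .inr 1] (emb w) = (w.2.1.1 1 : ℍ[K,α,β]) ∧
    coord ![.inl 0, .inl 1, .inr 2] (emb w) = (w.2.1.1 2 : ℍ[K,α,β]) ∧
    coord ![.inl 2, .inl 0, .inr 2] (emb w) = w.2.1.2 0 ∧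
    coord ![.inl 0, .inl 1, .inr 0] (emb w) = w.2.1.2 1 ∧
    coord ![.inl 1, .inl 2, .inr 1] (emb w) = w.2.1.2 2 ∧
    coord ![.inr 1, .inr 2, .inl 0] (emb w) = (w.2.2.1.1 0 : ℍ[K,α,β]) ∧
    coord ![.inr 2, .inr 0, .inl 1] (emb w) = (w.2.2.1.1 1 : ℍ[K,α,β]) ∧
    coord ![.inr 0, .inr 1, .inl 2] (emb w) = (w.2.2.1.1 2 : ℍ[K,α,β]) ∧
    coord ![.inr 2, .inr 0, .inl 2] (emb w) = w.2.2.1.2 0 ∧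
    coord ![.inr 0, .inr 1, .inl 0] (emb w) = w.2.2.1.2 1 ∧
    coord ![.inr 1, .inr 2, .inl 1] (emb w) = w.2.2.1.2 2 ∧
    coord ![.inr 0, .inr 1, .inr 2] (emb w) = (w.2.2.2 : ℍ[K,α,β]) := by
  refine ⟨?_, ?_, ?_, ?_, ?_, ?_, ?_, ?_, ?_, ?_, ?_, ?_, ?_, ?_⟩ <;>
  · simp only [emb_eq, map_add, coord_tmul, minor_wedge]
    simp [eV, fV]

theorem emb_injective : Function.Injective (emb : W K α β → _) := by
  intro u v h
  have hu := coord_emb u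
  have hv := coord_emb v
  rw [h] at hu
  obtain ⟨a, b0, b1, b2, b3, b4, b5, c0, c1, c2, c3, c4, c5, d⟩ := hu
  obtain ⟨a', b0', b1', b2', b3', b4', b5', c0', c1', c2', c3', c4', c5', d'⟩ := hv
  have key : ∀ {x y : K} {q : ℍ[K,α,β]}, q = x → q = y → x = y := by
    rintro x y q rfl h
    simpa using congrArg QuaternionAlgebra.re h
  exact Prod.ext (key a a') (Prod.ext
    (H3.ext_coord (key b0 b0') (key b1 b1') (key b2 b2') (b3.symm.trans b3') (b4.symm.trans b4')
      (b5.symm.trans b5')) (Prod.ext (H3.ext_coord (key c0 c0') (key c1 c1') (key c2 c2')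
        (c3.symm.trans c3') (c4.symm.trans c4') (c5.symm.trans c5')) (key d d')))

theorem emb_smul (t : K) (w : W K α β) : emb (t • w) = t • emb w := by
  simp only [emb_eq, coe_eq_smul_one, Prod.smul_fst, Prod.smul_snd, Pi.smul_apply, smul_eq_mul,
    mul_smul, TensorProduct.tmul_smul, smul_add, QuaternionAlgebra.star_smul]

/-- The contraction `⋀³ W₆ ⊗ B → W₆ ⊗ B` on the image of `W`, in coordinates. -/
def contract (w : W K α β) : Fin 3 ⊕ Fin 3 → ℍ[K,α,β] :=
  Sum.elim (fun k => star (w.2.1.2 k) - w.2.1.2 k) (fun k => w.2.2.1.2 k - star (w.2.2.1.2 k))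

/-- The element `g` of `GSp₆(K)` of similitude `ν` acts on `W` as `h`. -/
structure ActsAs (g : Matrix (Fin 3 ⊕ Fin 3) (Fin 3 ⊕ Fin 3) K) (ν : Kˣ)
    (h : W K α β ≃ₗ[K] W K α β) : Prop where
  mem : (h, ν) ∈ GG K α β
  emb_apply : ∀ w, emb (h w) = act g ν (emb w)
  contract_apply : ∀ w l, contract (h w) l = ∑ m, g m l • contract w m

/-- All three properties of `ActsAs` pass to products, so they need checking on generators only. The
contraction is equivariant without a factor: the form contributes `ν`, which the twist by `ν⁻¹`
cancels. -/
theorem ActsAs.mul {g g' : Matrix (Fin 3 ⊕ Fin 3) (Fin 3 ⊕ Fin 3) K} {ν ν' : Kˣ}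
    {h h' : W K α β ≃ₗ[K] W K α β} (H : ActsAs g ν h) (H' : ActsAs g' ν' h') :
    ActsAs (g * g') (ν * ν') (h.trans h') where
  mem := GG_trans H.mem H'.mem
  emb_apply w := by rw [act_mul, ← H.emb_apply, ← H'.emb_apply]; rfl
  contract_apply w l := by
    simp only [LinearEquiv.trans_apply, H'.contract_apply, H.contract_apply, Matrix.mul_apply,
      Finset.smul_sum, Finset.sum_smul, smul_smul]
    rw [Finset.sum_comm]
    simp only [mul_comm]

theorem ActsAs.smul_eq {g : Matrix (Fin 3 ⊕ Fin 3) (Fin 3 ⊕ Fin 3) K} {ν : Kˣ}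
    {h : W K α β ≃ₗ[K] W K α β} (H : ActsAs g ν h) {w w' : W K α β} {t : K} :
    emb w' = t • act g ν (emb w) ↔ w' = t • h w := by
  rw [← H.emb_apply, ← emb_smul, emb_injective.eq_iff]

variable [CharZero K]

/-- The real element of `H₃(B)` with matrix `S`. -/
def ofSymm (S : Matrix (Fin 3) (Fin 3) K) : H3 K α β :=
  realH3 ![S 0 0, S 1 1, S 2 2] ![S 1 2, S 0 2, S 0 1]

omit [CharZero K] in
theorem siegelMat_add (S T : Matrix (Fin 3) (Fin 3) K) :
    siegelMat (S + T) = siegelMat T * siegelMat S := by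
  simp [siegelMat, Matrix.fromBlocks_multiply]

theorem emb_siegel_add {X Y : H3 K α β} {S T : Matrix (Fin 3) (Fin 3) K}
    (h : ∀ w, emb (siegel X w) = act (siegelMat S) 1 (emb w))
    (h' : ∀ w, emb (siegel Y w) = act (siegelMat T) 1 (emb w)) (w : W K α β) :
    emb (siegel (X + Y) w) = act (siegelMat (S + T)) 1 (emb w) := by
  have : siegel (X + Y) w = siegel X (siegel Y w) := siegelFun_add X Y w
  rw [this, h, h', ← act_mul, one_mul, siegelMat_add]

theorem emb_siegel {S : Matrix (Fin 3) (Fin 3) K} (hS : S.IsSymm) (w : W K α β) :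
    emb (siegel (ofSymm S) w) = act (siegelMat S) 1 (emb w) := by
  have h := emb_siegel_add (emb_siegel_add (emb_siegel_add (emb_siegel_add (emb_siegel_add
    (emb_siegel_diag0 (α := α) (β := β) (S 0 0)) (emb_siegel_diag1 (S 1 1)))
    (emb_siegel_diag2 (S 2 2)))
    (emb_siegel_off0 (S 1 2))) (emb_siegel_off1 (S 0 2))) (emb_siegel_off2 (S 0 1)) w
  convert h using 3
  · congr 1
    apply H3.ext_coord <;> simp [ofSymm, realH3]
  · ext i j
    have h1 := hS.apply 0 1
    have h2 := hS.apply 0 2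
    have h3 := hS.apply 1 2
    fin_cases i <;> fin_cases j <;> simp [h1, h2, h3]

theorem actsAs_siegel {S : Matrix (Fin 3) (Fin 3) K} (hS : S.IsSymm) :
    ActsAs (siegelMat S) 1 (siegel (ofSymm S) : W K α β ≃ₗ[K] W K α β) where
  mem := siegel_mem_GG _
  emb_apply := emb_siegel hS
  contract_apply w l := by
    have h1 := hS.apply 0 1
    have h2 := hS.apply 0 2
    have h3 := hS.apply 1 2
    simp only [Fintype.sum_sum_type, Fin.sum_univ_three]
    rcases l with l | l <;> fin_cases l <;>
    · simp [contract, siegelMat, siegelFun, ofSymm, realH3, H3.cross_snd, H3.sharp_snd, h1, h2, h3,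
        Matrix.vecHead, Matrix.vecTail, coe_eq_smul_one]
      try module

theorem actsAs_weyl : ActsAs (J6 K) 1 (weyl K α β) where
  mem := weyl_mem_GG
  emb_apply := emb_weyl
  contract_apply w l := by
    simp only [Fintype.sum_sum_type, Fin.sum_univ_three]
    rcases l with l | l <;> fin_cases l <;>
    · simp [contract, J6, weyl_apply]
      try abel

/-- The element `diag(1, ν)` of `GSp₆`. -/
def similMat (ν : Kˣ) : Matrix (Fin 3 ⊕ Fin 3) (Fin 3 ⊕ Fin 3) K :=
  Matrix.fromBlocks 1 0 0 ((ν : K) • 1)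

omit [CharZero K] in
theorem eV_similMat (ν : Kˣ) (i : Fin 3) : eV i ᵥ* similMat ν = eV i := by
  funext j
  rcases j with j | j <;> fin_cases i <;> fin_cases j <;> simp [eV, fV, similMat]

omit [CharZero K] in
theorem fV_similMat (ν : Kˣ) (i : Fin 3) : fV i ᵥ* similMat ν = (ν : K) • fV i := by
  funext j
  rcases j with j | j <;> fin_cases i <;> fin_cases j <;> simp [eV, fV, similMat]

theorem actsAs_simil (ν : Kˣ) : ActsAs (similMat ν) ν (simil α β ν) where
  mem := simil_mem_GG ν
  emb_apply w := by
    simp only [emb_eq, act_add, act_smul, act_wedge_tmul, eV_similMat, fV_similMat, simil_apply,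
      wedge_smul_left, wedge_smul_right, wedge_smul_mid, TensorProduct.tmul_smul,
      ← TensorProduct.smul_tmul', coe_eq_smul_one, Prod.smul_fst, Prod.smul_snd, Pi.smul_apply,
      QuaternionAlgebra.star_smul, smul_eq_mul, Units.val_inv_eq_inv_val]
    have h : (ν : K) ≠ 0 := ν.ne_zero

    match_scalars <;> field_simp
  contract_apply w l := by
    simp only [Fintype.sum_sum_type, Fin.sum_univ_three]
    rcases l with l | l <;> fin_cases l <;> simp [contract, similMat, simil_apply, smul_sub]

end Coord

/-! ### Generation of `GSp₆` by Siegel unipotents, `J6` and similitudes -/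

section Generation
variable {K : Type*} [Field K]

theorem IsGSp6.mul {g g' : Matrix (Fin 3 ⊕ Fin 3) (Fin 3 ⊕ Fin 3) K} {ν ν' : Kˣ}
    (h : IsGSp6 g ν) (h' : IsGSp6 g' ν') : IsGSp6 (g * g') (ν * ν') := by
  unfold IsGSp6 at *
  calc g * g' * J6 K * (g * g')ᵀ = g * (g' * J6 K * g'ᵀ) * gᵀ := by
        simp only [Matrix.transpose_mul, Matrix.mul_assoc]
    _ = _ := by rw [h', Matrix.mul_smul, Matrix.smul_mul, h, smul_smul, Units.val_mul, mul_comm]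

theorem J6_mul_neg_J6 : J6 K * -J6 K = 1 := by
  simp [J6, Matrix.fromBlocks_multiply, Matrix.fromBlocks_neg]

theorem IsGSp6.isUnit {g : Matrix (Fin 3 ⊕ Fin 3) (Fin 3 ⊕ Fin 3) K} {ν : Kˣ}
    (h : IsGSp6 g ν) : IsUnit g := by
  have : g * (((ν⁻¹ : Kˣ) : K) • (J6 K * gᵀ * -J6 K)) = 1 := by
    have h' : g * J6 K * gᵀ = (ν : K) • J6 K := h
    rw [Matrix.mul_smul, ← Matrix.mul_assoc, ← Matrix.mul_assoc, h', Matrix.smul_mul, smul_smul,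
      J6_mul_neg_J6]
    simp
  exact IsUnit.of_mul_eq_one _ this

theorem IsGSp6.inv {g : Matrix (Fin 3 ⊕ Fin 3) (Fin 3 ⊕ Fin 3) K} {ν : Kˣ}
    (h : IsGSp6 g ν) : IsGSp6 g⁻¹ ν⁻¹ := by
  have hg := (Matrix.isUnit_iff_isUnit_det g).1 h.isUnit
  have h' : g * J6 K * gᵀ = (ν : K) • J6 K := h
  have h2 : g⁻¹ * ((ν : K) • J6 K) * (g⁻¹)ᵀ = J6 K := by
    rw [← h', Matrix.mul_assoc g, Matrix.nonsing_inv_mul_cancel_left g _ hg, Matrix.mul_assoc,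
      ← Matrix.transpose_mul, Matrix.nonsing_inv_mul g hg]
    simp
  rw [Matrix.mul_smul, Matrix.smul_mul] at h2
  unfold IsGSp6
  conv_rhs => rw [← h2, smul_smul]
  simp

theorem isGSp6_one : IsGSp6 (1 : Matrix (Fin 3 ⊕ Fin 3) (Fin 3 ⊕ Fin 3) K) 1 := by simp [IsGSp6]

theorem isGSp6_J6 : IsGSp6 (J6 K) 1 := by
  simp [IsGSp6, J6, Matrix.fromBlocks_multiply, Matrix.fromBlocks_transpose]

theorem isGSp6_similMat (ν : Kˣ) : IsGSp6 (similMat ν) ν := by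
  simp [IsGSp6, similMat, J6, Matrix.fromBlocks_multiply, Matrix.fromBlocks_transpose,
    Matrix.fromBlocks_smul]

theorem isGSp6_fromBlocks_iff (A B C D : Matrix (Fin 3) (Fin 3) K) (ν : Kˣ) :
    IsGSp6 (Matrix.fromBlocks A B C D) ν ↔
      A * Bᵀ = B * Aᵀ ∧ A * Dᵀ - B * Cᵀ = (ν : K) • 1 ∧ C * Bᵀ - D * Aᵀ = -((ν : K) • 1) ∧
        C * Dᵀ = D * Cᵀ := by
  simp only [IsGSp6, J6, Matrix.fromBlocks_multiply, Matrix.fromBlocks_transpose,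
    Matrix.fromBlocks_smul, Matrix.fromBlocks_inj, Matrix.mul_zero, Matrix.mul_one, Matrix.mul_neg,
    zero_add, add_zero, smul_zero, Matrix.neg_mul, smul_neg]
  constructor
  · rintro ⟨h1, h2, h3, h4⟩
    refine ⟨by rw [← sub_eq_zero, ← h1]; abel, by rw [← h2]; abel, by rw [← h3]; abel,
      by rw [← sub_eq_zero, ← h4]; abel⟩
  · rintro ⟨h1, h2, h3, h4⟩
    refine ⟨by rw [h1]; abel, by rw [← h2]; abel, by rw [← h3]; abel, by rw [h4]; abel⟩

theorem isGSp6_siegelMat {S : Matrix (Fin 3) (Fin 3) K} (hS : S.IsSymm) :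
    IsGSp6 (siegelMat S) 1 := by
  rw [siegelMat, isGSp6_fromBlocks_iff]
  simp [hS.eq]

variable {α β : K} [CharZero K]

variable (α β) in
/-- `g` is an element of `GSp₆(K)` that acts on `W`. -/
def Acts (g : Matrix (Fin 3 ⊕ Fin 3) (Fin 3 ⊕ Fin 3) K) (ν : Kˣ) : Prop :=
  ∃ h : W K α β ≃ₗ[K] W K α β, ActsAs g ν h

theorem Acts.mul {g g' : Matrix (Fin 3 ⊕ Fin 3) (Fin 3 ⊕ Fin 3) K} {ν ν' : Kˣ}
    (h : Acts α β g ν) (h' : Acts α β g' ν') : Acts α β (g * g') (ν * ν') := by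
  obtain ⟨a, ha⟩ := h
  obtain ⟨b, hb⟩ := h'
  exact ⟨_, ha.mul hb⟩

theorem Acts.mul_one {g g' : Matrix (Fin 3 ⊕ Fin 3) (Fin 3 ⊕ Fin 3) K}
    (h : Acts α β g 1) (h' : Acts α β g' 1) : Acts α β (g * g') 1 := by
  simpa using h.mul h'

theorem acts_siegelMat {S : Matrix (Fin 3) (Fin 3) K} (hS : S.IsSymm) :
    Acts α β (siegelMat S) 1 := ⟨_, actsAs_siegel hS⟩

theorem acts_J6 : Acts α β (J6 K) 1 := ⟨_, actsAs_weyl⟩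

theorem acts_neg_J6 : Acts α β (-J6 K) 1 := by
  have := ((acts_J6 (α := α) (β := β)).mul_one acts_J6).mul_one acts_J6
  convert this using 1
  simp [J6, Matrix.fromBlocks_multiply, Matrix.fromBlocks_neg]

/-- The lower triangular analogue of `siegelMat`. -/
def lowerMat (S : Matrix (Fin 3) (Fin 3) K) : Matrix (Fin 3 ⊕ Fin 3) (Fin 3 ⊕ Fin 3) K :=
  Matrix.fromBlocks 1 0 S 1

omit [CharZero K] in
theorem lowerMat_eq (S : Matrix (Fin 3) (Fin 3) K) :
    lowerMat S = -J6 K * siegelMat (-S) * J6 K := by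
  simp [lowerMat, siegelMat, J6, Matrix.fromBlocks_multiply, Matrix.fromBlocks_neg]

theorem acts_lowerMat {S : Matrix (Fin 3) (Fin 3) K} (hS : S.IsSymm) :
    Acts α β (lowerMat S) 1 := by
  rw [lowerMat_eq]
  exact (acts_neg_J6.mul_one (acts_siegelMat hS.neg)).mul_one acts_J6

/-- The element `diag(A, ᵗA⁻¹)` of `Sp₆`. -/
def leviMat (A : Matrix (Fin 3) (Fin 3) K) : Matrix (Fin 3 ⊕ Fin 3) (Fin 3 ⊕ Fin 3) K :=
  Matrix.fromBlocks A 0 0 (A⁻¹)ᵀ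

omit [CharZero K] in
theorem leviMat_mul (A B : Matrix (Fin 3) (Fin 3) K) :
    leviMat (A * B) = leviMat A * leviMat B := by
  simp [leviMat, Matrix.fromBlocks_multiply, Matrix.mul_inv_rev]

omit [CharZero K] in
theorem isGSp6_leviMat {A : Matrix (Fin 3) (Fin 3) K} (hA : A.det ≠ 0) :
    IsGSp6 (leviMat A) 1 := by
  have hA := hA.isUnit
  rw [leviMat, isGSp6_fromBlocks_iff]
  simp [Matrix.mul_nonsing_inv A hA, ← Matrix.transpose_mul]

/-- The analogue of the `SL₂` identity writing a diagonal matrix through unipotent ones: the product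
of upper `S`, lower `-S⁻¹`, upper `S` is antidiagonal, and `-J6` makes it `diag(S, S⁻¹)`. -/
theorem acts_leviMat_symm {S : Matrix (Fin 3) (Fin 3) K} (hS : S.IsSymm) (hd : S.det ≠ 0) :
    Acts α β (leviMat S) 1 := by
  have hu := hd.isUnit
  have hi : (S⁻¹).IsSymm := hS.inv
  have := (((acts_siegelMat (α := α) (β := β) hS).mul_one (acts_lowerMat hi.neg)).mul_one
    (acts_siegelMat hS)).mul_one acts_neg_J6
  convert this using 1
  simp [leviMat, siegelMat, lowerMat, J6, Matrix.fromBlocks_multiply, Matrix.fromBlocks_neg,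
    Matrix.mul_nonsing_inv S hu, Matrix.nonsing_inv_mul S hu, hi.eq]

/-- Invertible matrices are products of diagonal matrices and transvections. Diagonal ones are
symmetric, and each transvection is a product of two symmetric invertible matrices. -/
theorem acts_leviMat {A : Matrix (Fin 3) (Fin 3) K} (hA : A.det ≠ 0) :
    Acts α β (leviMat A) 1 := by
  refine Matrix.diagonal_transvection_induction_of_det_ne_zero
    (fun A => Acts α β (leviMat A) 1) A hA (fun D hD => ?_)
    (fun t => ?_) (fun A B _ _ hA hB => ?_)
  · exact acts_leviMat_symm (Matrix.isSymm_diagonal D) hD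
  · obtain ⟨i, j, hij, c⟩ := t
    have key : ∃ S P : Matrix (Fin 3) (Fin 3) K, S.IsSymm ∧ P.IsSymm ∧ S.det ≠ 0 ∧ P.det ≠ 0 ∧
        Matrix.transvection i j c = S * P := by
      -- `P` is the permutation matrix exchanging `i` and `j`. Multiplying the transvection by it
      -- turns the extra entry at `(i, j)` into a diagonal one at `(i, i)`, which leaves a symmetric
      -- matrix.
      let P : Matrix (Fin 3) (Fin 3) K :=
        Matrix.of fun a b => if Equiv.swap i j a = b then 1 else 0
      have hP : P * P = 1 := by
        ext a b
        rw [Matrix.mul_apply, Finset.sum_eq_single (Equiv.swap i j a)]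
        · simp [P, Matrix.one_apply]
        · intro x _ hx
          simp [P, hx.symm]
        · simp
      have hPs : P.IsSymm := by
        ext a b
        have : Equiv.swap i j b = a ↔ Equiv.swap i j a = b :=
          ⟨fun h => by rw [← h]; simp, fun h => by rw [← h]; simp⟩
        simp [P, this]
      have hdP : P.det ≠ 0 := fun h => by
        have := congrArg Matrix.det hP
        simp [h] at this
      have hST : Matrix.transvection i j c * P = P + Matrix.single i i c := by
        rw [Matrix.transvection, Matrix.add_mul, one_mul]
        congr 1
        ext a b
        rw [Matrix.mul_apply, Finset.sum_eq_single j]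
        · simp only [P, Matrix.single_apply, Matrix.of_apply, Equiv.swap_apply_right, true_and,
            and_true, ite_and, mul_ite, mul_one, mul_zero]
          split_ifs <;> rfl
        · intro x _ hx
          simp [Matrix.single_apply, hx.symm]
        · simp
      refine ⟨Matrix.transvection i j c * P, P, ?_, hPs, ?_, hdP, ?_⟩
      · rw [hST]
        exact hPs.add (by simp [Matrix.IsSymm, Matrix.transpose_single])
      · rw [Matrix.det_mul, Matrix.det_transvection_of_ne i j hij]
        simpa using hdP
      · rw [Matrix.mul_assoc, hP, Matrix.mul_one]
    obtain ⟨S, P, hS, hP, hdS, hdP, h⟩ := key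
    change Acts α β (leviMat (Matrix.transvection i j c)) 1
    rw [h, leviMat_mul]
    exact (acts_leviMat_symm hS hdS).mul_one (acts_leviMat_symm hP hdP)
  · rw [leviMat_mul]
    exact hA.mul_one hB

/-- The big cell: an element with invertible upper left block factors as lower unipotent, Levi,
upper unipotent, with parameters `C A⁻¹` and `A⁻¹ B` that the symplectic relations make symmetric.
-/
theorem acts_of_det_ne_zero {A B C D : Matrix (Fin 3) (Fin 3) K}
    (h : IsGSp6 (Matrix.fromBlocks A B C D) 1) (hA : A.det ≠ 0) :
    Acts α β (Matrix.fromBlocks A B C D) 1 := by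
  obtain ⟨h1, h2, -, h4⟩ := (isGSp6_fromBlocks_iff A B C D 1).1 h
  have hu := hA.isUnit
  have hut : IsUnit (Aᵀ).det := by rwa [Matrix.det_transpose]
  simp only [Units.val_one, one_smul] at h2
  have hX : (A⁻¹ * B).IsSymm := by
    have : A⁻¹ * (A * Bᵀ) * (Aᵀ)⁻¹ = A⁻¹ * (B * Aᵀ) * (Aᵀ)⁻¹ := by rw [h1]
    rw [Matrix.nonsing_inv_mul_cancel_left A _ hu, Matrix.mul_assoc, Matrix.mul_assoc,
      Matrix.mul_nonsing_inv _ hut, Matrix.mul_one] at this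
    rw [Matrix.IsSymm, Matrix.transpose_mul, Matrix.transpose_nonsing_inv, this]
  have hD : D = (A⁻¹)ᵀ + C * A⁻¹ * B := by
    have : A⁻¹ * (A * Dᵀ - B * Cᵀ) = A⁻¹ := by rw [h2, Matrix.mul_one]
    rw [Matrix.mul_sub, Matrix.nonsing_inv_mul_cancel_left A _ hu, sub_eq_iff_eq_add] at this
    rw [← Matrix.transpose_transpose D, this, Matrix.transpose_add, ← Matrix.mul_assoc,
      Matrix.transpose_mul, hX.eq, Matrix.transpose_transpose, Matrix.mul_assoc]
  have hY : (C * A⁻¹).IsSymm := by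
    rw [hD, Matrix.transpose_add, Matrix.mul_assoc C, Matrix.transpose_mul C, hX.eq, Matrix.mul_add,
      Matrix.add_mul, Matrix.transpose_transpose, Matrix.mul_assoc C,
      add_left_inj] at h4
    rw [Matrix.IsSymm, Matrix.transpose_mul, h4]
  have := ((acts_lowerMat (α := α) (β := β) hY).mul_one (acts_leviMat hA)).mul_one
    (acts_siegelMat hX)
  convert this using 1
  simp [lowerMat, leviMat, siegelMat, Matrix.fromBlocks_multiply, Matrix.mul_nonsing_inv A hu,
    Matrix.nonsing_inv_mul_cancel_right A _ hu, Matrix.mul_nonsing_inv_cancel_left A _ hu]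
  rw [hD, ← Matrix.mul_assoc, add_comm]

omit [CharZero K] in
-- Take `ε` to be the indicator of the zeros of `E`. A row vector `y` killed by `E + B ε` is
-- supported on these zeros, and `y B` vanishes there. At the other positions the symmetry of `E Bᵀ`
-- kills the relevant entries of `B`. So `y` kills both upper blocks, against the relation `E Dᵀ - B
-- Cᵀ = 1`.
theorem exists_diagonal_det_ne_zero {E : Fin 3 → K} {B C D : Matrix (Fin 3) (Fin 3) K}
    (h : IsGSp6 (Matrix.fromBlocks (Matrix.diagonal E) B C D) 1) :
    ∃ ε : Fin 3 → K, (Matrix.diagonal E + B * Matrix.diagonal ε).det ≠ 0 := by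
  classical
  obtain ⟨h1, h2, -, h4⟩ := (isGSp6_fromBlocks_iff _ B C D 1).1 h
  refine ⟨fun i => if E i = 0 then 1 else 0, fun hdet => ?_⟩
  obtain ⟨y, hy0, hy⟩ := Matrix.exists_vecMul_eq_zero_iff.2 hdet
  have e1 : ∀ i j, E i * B j i = B i j * E j := fun i j => by
    have := congrFun (congrFun h1 i) j
    simpa [Matrix.diagonal_mul, Matrix.mul_diagonal, Matrix.diagonal_transpose] using this
  have e2 : ∀ j, y j * E j + (y ᵥ* B) j * (if E j = 0 then 1 else 0) = 0 := fun j => by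
    have := congrFun hy j
    simpa [Matrix.vecMul_add, ← Matrix.vecMul_vecMul, Matrix.vecMul_diagonal] using this
  have e3 : ∀ j, E j ≠ 0 → y j = 0 := fun j hj => by simpa [hj] using e2 j
  have e4 : y ᵥ* B = 0 := by
    funext j
    by_cases hj : E j = 0
    · simpa [hj] using e2 j
    · change ∑ i, y i * B i j = 0
      refine Finset.sum_eq_zero fun i _ => ?_
      by_cases hi : E i = 0
      · have := e1 i j
        rw [hi, zero_mul, eq_comm, mul_eq_zero] at this
        simp [this.resolve_right hj]
      · simp [e3 i hi]
  have e5 : y ᵥ* Matrix.diagonal E = 0 := by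
    funext j
    by_cases hj : E j = 0 <;> simp [Matrix.vecMul_diagonal, hj, e3 j]
  apply hy0
  have : y ᵥ* (Matrix.diagonal E * Dᵀ - B * Cᵀ) = 0 := by
    rw [Matrix.vecMul_sub, ← Matrix.vecMul_vecMul, ← Matrix.vecMul_vecMul, e4, e5]
    simp
  rw [h2] at this
  simpa using this

/-- Every element of `GSp₆(K)` acts on `W` by an element of `G(K)`. -/
theorem IsGSp6.acts {g : Matrix (Fin 3 ⊕ Fin 3) (Fin 3 ⊕ Fin 3) K} {ν : Kˣ} (h : IsGSp6 g ν) :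
    Acts α β g ν := by
  -- A factor `diag(1, ν)` reduces to similitude one.
  suffices H : ∀ g : Matrix (Fin 3 ⊕ Fin 3) (Fin 3 ⊕ Fin 3) K, IsGSp6 g 1 → Acts α β g 1 by
    have h1 : IsGSp6 (g * similMat ν⁻¹) 1 := by simpa using h.mul (isGSp6_similMat ν⁻¹)
    have := (H _ h1).mul ⟨_, actsAs_simil ν⟩
    rw [one_mul, Matrix.mul_assoc] at this
    simpa [similMat, Matrix.fromBlocks_multiply] using this
  clear h
  intro g h
  -- With a diagonal upper left block, a lower unipotent factor on the right moves the element into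
  -- the big cell.
  have key : ∀ (E : Fin 3 → K) (B C D : Matrix (Fin 3) (Fin 3) K),
      IsGSp6 (Matrix.fromBlocks (Matrix.diagonal E) B C D) 1 →
      Acts α β (Matrix.fromBlocks (Matrix.diagonal E) B C D) 1 := by
    intro E B C D h
    obtain ⟨ε, hε⟩ := exists_diagonal_det_ne_zero h
    have hs := Matrix.isSymm_diagonal ε
    have h1 : IsGSp6 (lowerMat (Matrix.diagonal ε)) 1 := by
      rw [lowerMat, isGSp6_fromBlocks_iff]; simp
    have h2 := h.mul h1
    simp only [lowerMat, Matrix.fromBlocks_multiply, Matrix.mul_one, Matrix.mul_zero, zero_add,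
      _root_.mul_one] at h2
    have h3 := (acts_of_det_ne_zero (α := α) (β := β) h2 hε).mul_one (acts_lowerMat hs.neg)
    convert h3 using 1
    simp only [lowerMat, Matrix.fromBlocks_multiply, Matrix.mul_one, Matrix.mul_zero, zero_add,
      Matrix.mul_neg, add_neg_cancel_right]
  -- Levi factors built from transvections diagonalize the upper left block.
  obtain ⟨L, L', E, hA⟩ := Matrix.Pivot.exists_list_transvec_mul_diagonal_mul_list_transvec g.toBlocks₁₁
  set P := (L.map Matrix.TransvectionStruct.toMatrix).prod
  set Q := (L'.map Matrix.TransvectionStruct.toMatrix).prod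
  have hP : P.det = 1 := by simp [P, Matrix.TransvectionStruct.det_toMatrix_prod]
  have hQ : Q.det = 1 := by simp [Q, Matrix.TransvectionStruct.det_toMatrix_prod]
  have hPi : (P⁻¹).det ≠ 0 := by simp [Matrix.det_nonsing_inv, hP]
  have hQi : (Q⁻¹).det ≠ 0 := by simp [Matrix.det_nonsing_inv, hQ]
  have hPu : IsUnit P.det := by simp [hP]
  have hQu : IsUnit Q.det := by simp [hQ]
  have h1 : IsGSp6 (leviMat P⁻¹ * g * leviMat Q⁻¹) 1 := by
    simpa using ((isGSp6_leviMat hPi).mul h).mul (isGSp6_leviMat hQi)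
  have h2 : (leviMat P⁻¹ * g * leviMat Q⁻¹).toBlocks₁₁ = Matrix.diagonal E := by
    conv_lhs => rw [← Matrix.fromBlocks_toBlocks g]
    simp only [leviMat, Matrix.fromBlocks_multiply, Matrix.toBlocks_fromBlocks₁₁, hA]
    simp [← Matrix.mul_assoc, Matrix.nonsing_inv_mul P hPu]
    simp [Matrix.mul_assoc, Matrix.mul_nonsing_inv Q hQu]
  have h3 : Acts α β (leviMat P⁻¹ * g * leviMat Q⁻¹) 1 := by
    rw [← Matrix.fromBlocks_toBlocks (leviMat P⁻¹ * g * leviMat Q⁻¹), h2] at h1 ⊢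
    exact key _ _ _ _ h1
  have h4 := ((acts_leviMat (α := α) (β := β) (A := P) (by simp [hP])).mul_one h3).mul_one
    (acts_leviMat (A := Q) (by simp [hQ]))
  have e : leviMat P * (leviMat P⁻¹ * g * leviMat Q⁻¹) * leviMat Q = g := by
    have e1 : leviMat P * leviMat P⁻¹ = 1 := by
      rw [← leviMat_mul, Matrix.mul_nonsing_inv P hPu]; simp [leviMat]
    have e2 : leviMat Q⁻¹ * leviMat Q = 1 := by
      rw [← leviMat_mul, Matrix.nonsing_inv_mul Q hQu]; simp [leviMat]
    rw [Matrix.mul_assoc, Matrix.mul_assoc _ (leviMat Q⁻¹), e2, Matrix.mul_one, ← Matrix.mul_assoc,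
      e1, Matrix.one_mul]
  rwa [e] at h4

end Generation

/-! ### Normal form of rank one elements -/

section RankOne
variable {K : Type*} [Field K] {α β : K} [CharZero K]

theorem fourForm_eq (v x y : W K α β) : fourForm ![v, v, x, y] = (1 / 24) *
    (quartic (v + v + x + y) - 2 * quartic (v + x + y) - quartic (v + v + x) - quartic (v + v + y)
      + quartic (v + v) + 2 * quartic (v + x) + 2 * quartic (v + y) + quartic (x + y)
      - 2 * quartic v - quartic x - quartic y) := by
  have hu : (Finset.univ : Finset (Finset (Fin 4))) = {∅, {0}, {1}, {2}, {3}, {0, 1}, {0, 2},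
      {0, 3}, {1, 2}, {1, 3}, {2, 3}, {0, 1, 2}, {0, 1, 3}, {0, 2, 3}, {1, 2, 3},
      {0, 1, 2, 3}} := by decide
  have h0 : quartic (0 : W K α β) = 0 := by simp [quartic]
  rw [fourForm, hu]
  repeat rw [Finset.sum_insert (by decide)]
  rw [Finset.sum_singleton]
  simp +decide [Finset.sum_insert, h0, ← add_assoc]
  ring

/-- The quartic form is quadratic in its last coordinate. The coefficients found here are all that
the values of the 4-linear form at `f₀` depend on. -/
theorem quartic_add_f₀ (w : W K α β) (t : K) : quartic (w + t • f₀) = quartic w +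
    t * (2 * w.1 * (w.1 * w.2.2.2 - H3.pair w.2.1 w.2.2.1) + 4 * H3.norm w.2.1)
      + t ^ 2 * w.1 ^ 2 := by
  simp [quartic, f₀]
  ring

theorem fourForm_f₀ (x y : W K α β) : fourForm ![f₀, f₀, x, y] = x.1 * y.1 / 6 := by
  rw [fourForm_eq]
  have e1 : (f₀ + f₀ + x + y : W K α β) = (x + y) + (2 : K) • f₀ := by module
  have e2 : (f₀ + x + y : W K α β) = (x + y) + (1 : K) • f₀ := by module
  have e3 : (f₀ + f₀ + x : W K α β) = x + (2 : K) • f₀ := by module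
  have e4 : (f₀ + f₀ + y : W K α β) = y + (2 : K) • f₀ := by module
  have e5 : (f₀ + f₀ : W K α β) = 0 + (2 : K) • f₀ := by module
  have e6 : (f₀ + x : W K α β) = x + (1 : K) • f₀ := by module
  have e7 : (f₀ + y : W K α β) = y + (1 : K) • f₀ := by module
  have e8 : quartic (f₀ : W K α β) = 0 := by simp [quartic, f₀]
  rw [e1, e2, e3, e4, e5, e6, e7, e8]
  simp only [quartic_add_f₀]
  have e9 : quartic (0 : W K α β) = 0 := by simp [quartic]
  rw [e9]
  simp
  ring

theorem isRankOne_f₀ : IsRankOne (f₀ : W K α β) := by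
  refine ⟨fun h => by simpa [f₀] using congrArg (fun w => w.2.2.2) h, fun x y hy => ?_⟩
  have : y.1 = 0 := by simpa [symp, f₀] using hy
  rw [fourForm_f₀, this]; simp

variable (α β) in
/-- Multiplication by a scalar. -/
def scal (t : Kˣ) : W K α β ≃ₗ[K] W K α β := LinearEquiv.smulOfUnit t

omit [CharZero K] in
theorem scal_apply (t : Kˣ) (w : W K α β) : scal α β t w = (t : K) • w := rfl

theorem scal_mem_GG (t : Kˣ) : (scal α β t, t ^ 2) ∈ GG K α β := by
  refine ⟨fun u v => ?_, fun w => ?_⟩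
  · simp [scal_apply, symp, H3.pair_smul_left, H3.pair_smul_right]; ring
  · simp [scal_apply, quartic, H3.pair_smul_left, H3.pair_smul_right, H3.sharp_smul, H3.norm_smul]
    ring

theorem isRankOne_smul_iff {t : K} (ht : t ≠ 0) {w : W K α β} :
    IsRankOne (t • w) ↔ IsRankOne w :=
  isRankOne_map_iff (scal_mem_GG (Units.mk0 t ht))

/-- The rank one element `(1, X, X^#, N(X))`. -/
def rankOne (X : H3 K α β) : W K α β := (1, X, H3.sharp X, H3.norm X)

theorem siegel_rankOne (X Y : H3 K α β) : siegel X (rankOne Y) = rankOne (X + Y) := by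
  have h : ∀ Z : H3 K α β, rankOne Z = siegelFun Z (1, 0, 0, 0) := fun Z => by
    simp [rankOne, siegelFun]
  rw [siegel_apply, h, h, siegelFun_add]

variable (α β) in
/-- The set of elements of the orbit `f G(K)`. -/
def orbitGG : Set (W K α β) := {w | ∃ γ ∈ GG K α β, γ.1 f₀ = w}

theorem orbitGG_map {g : (W K α β ≃ₗ[K] W K α β) × Kˣ} (hg : g ∈ GG K α β) {w : W K α β} :
    g.1 w ∈ orbitGG α β ↔ w ∈ orbitGG α β := by
  constructor
  · rintro ⟨γ, hγ, h⟩
    exact ⟨_, GG_trans hγ (GG_symm hg), by simp [h]⟩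
  · rintro ⟨γ, hγ, h⟩
    exact ⟨_, GG_trans hγ hg, by simp [h]⟩

theorem isRankOne_of_mem_orbitGG {w : W K α β} (h : w ∈ orbitGG α β) : IsRankOne w := by
  obtain ⟨γ, hγ, rfl⟩ := h
  exact isRankOne_f₀.map hγ

/-- The element `rankOne 0` is the image of `f₀` under the inverse of `weyl`; a translation and a
scalar do the rest. -/
theorem smul_rankOne_mem_orbitGG {a : K} (ha : a ≠ 0) (X : H3 K α β) :
    a • rankOne X ∈ orbitGG α β := by
  have h : a • rankOne X = scal α β (Units.mk0 a ha) (siegel X ((weyl K α β).symm f₀)) := by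
    have : (weyl K α β).symm f₀ = rankOne 0 := by simp [weyl, f₀, rankOne]
    rw [this, siegel_rankOne, add_zero]; rfl
  rw [h]
  exact (orbitGG_map (scal_mem_GG _)).2 ((orbitGG_map (siegel_mem_GG X)).2
    ((orbitGG_map (GG_symm weyl_mem_GG)).2 ⟨(LinearEquiv.refl K _, 1), by simp [GG], rfl⟩))

theorem isRankOne_rankOne (X : H3 K α β) : IsRankOne (rankOne X) := by
  simpa using isRankOne_of_mem_orbitGG (smul_rankOne_mem_orbitGG one_ne_zero X)

theorem H3.eq_zero_of_pair (hα : α ≠ 0) (hβ : β ≠ 0) {c : H3 K α β}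
    (h : ∀ X, H3.pair X c = 0) : c = 0 := by
  have hq : ∀ x : ℍ[K,α,β], (∀ q, qtr (q * star x) = 0) → x = 0 := fun x hx => by
    have h1 := hx 1
    have h2 := hx ⟨0, 1, 0, 0⟩
    have h3 := hx ⟨0, 0, 1, 0⟩
    have h4 := hx ⟨0, 0, 0, 1⟩
    simp [qtr_eq, hα, hβ] at h1 h2 h3 h4
    ext <;> simp [h1, h2, h3, h4]
  refine H3.ext_coord ?_ ?_ ?_ (hq _ fun q => ?_) (hq _ fun q => ?_) (hq _ fun q => ?_)
  · simpa [H3.pair_eq, qtr_eq] using h (![1, 0, 0], 0)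
  · simpa [H3.pair_eq, qtr_eq] using h (![0, 1, 0], 0)
  · simpa [H3.pair_eq, qtr_eq] using h (![0, 0, 1], 0)
  · simpa [H3.pair_eq, qtr_eq] using h (0, ![q, 0, 0])
  · simpa [H3.pair_eq, qtr_eq] using h (0, ![0, q, 0])
  · simpa [H3.pair_eq, qtr_eq] using h (0, ![0, 0, q])

theorem fourForm_f₀_left (v y : W K α β) : fourForm ![v, v, f₀, y] = (1 / 24) *
    ((2 * (v + v + y).1 * ((v + v + y).1 * (v + v + y).2.2.2
        - H3.pair (v + v + y).2.1 (v + v + y).2.2.1) + 4 * H3.norm (v + v + y).2.1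
        + (v + v + y).1 ^ 2)
      - 2 * (2 * (v + y).1 * ((v + y).1 * (v + y).2.2.2
        - H3.pair (v + y).2.1 (v + y).2.2.1) + 4 * H3.norm (v + y).2.1 + (v + y).1 ^ 2)
      - (2 * (v + v).1 * ((v + v).1 * (v + v).2.2.2
        - H3.pair (v + v).2.1 (v + v).2.2.1) + 4 * H3.norm (v + v).2.1 + (v + v).1 ^ 2)
      + 2 * (2 * v.1 * (v.1 * v.2.2.2 - H3.pair v.2.1 v.2.2.1) + 4 * H3.norm v.2.1 + v.1 ^ 2)
      + (2 * y.1 * (y.1 * y.2.2.2 - H3.pair y.2.1 y.2.2.1) + 4 * H3.norm y.2.1 + y.1 ^ 2)) := by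
  rw [fourForm_eq]
  have e1 : (v + v + f₀ + y : W K α β) = (v + v + y) + (1 : K) • f₀ := by module
  have e2 : (v + f₀ + y : W K α β) = (v + y) + (1 : K) • f₀ := by module
  have e3 : (v + v + f₀ : W K α β) = (v + v) + (1 : K) • f₀ := by module
  have e4 : (v + f₀ : W K α β) = v + (1 : K) • f₀ := by module
  have e5 : (f₀ + y : W K α β) = y + (1 : K) • f₀ := by module
  have e8 : quartic (f₀ : W K α β) = 0 := by simp [quartic, f₀]
  rw [e1, e2, e3, e4, e5, e8]
  simp only [quartic_add_f₀]
  ring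

/-- A rank one element with nonzero first coordinate is a multiple of some `rankOne X`. -/
theorem IsRankOne.eq_smul_rankOne (hα : α ≠ 0) (hβ : β ≠ 0) {w : W K α β} (hw : IsRankOne w)
    (h : w.1 ≠ 0) : w = w.1 • rankOne (w.1⁻¹ • w.2.1) := by
  -- The case `b = 0`, to which a Siegel translation by `-b/a` reduces.
  have key : ∀ (a d : K) (c : H3 K α β), a ≠ 0 → IsRankOne ((a, 0, c, d) : W K α β) →
      c = 0 ∧ d = 0 := by
    intro a d c ha hv
    have hc : c = 0 := by
      refine H3.eq_zero_of_pair hα hβ fun X => ?_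
      -- The last coordinate of the test vector is chosen to make it orthogonal to `v`; the rank one
      -- condition then reads `tr(c, X) = 0`.
      have := hv.2 f₀ (0, X, 0, -(H3.pair c X) / a) (by simp [symp]; field_simp; ring)
      rw [fourForm_f₀_left] at this
      simp [H3.pair_add_left, H3.pair_add_right, H3.pair_comm c X] at this
      field_simp at this
      ring_nf at this
      simpa [ha] using this
    subst hc
    refine ⟨rfl, ?_⟩
    -- With `c = 0` both test vectors are orthogonal to `v`, and their pairing `1` isolates the
    -- product `a d` coming from the square in the quartic form.
    have := hv.2 (0, (![1, 0, 0], 0), 0, 0) (0, 0, (![1, 0, 0], 0), 0) (by simp [symp])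
    rw [fourForm_eq] at this
    have hN : H3.norm ((![1, 0, 0], 0) : H3 K α β) = 0 := by simp [H3.norm, qtr_eq, qnorm_eq]
    have hS : H3.sharp ((![1, 0, 0], 0) : H3 K α β) = 0 := by
      apply H3.ext_coord <;> simp [H3.sharp_fst, H3.sharp_snd, qnorm_eq]
    have hp : H3.pair ((![1, 0, 0], 0) : H3 K α β) (![1, 0, 0], 0) = 1 := by
      simp [H3.pair_eq, qtr_eq]
    simp only [quartic, Prod.mk_add_mk, add_zero, zero_add, hN, hS, hp, H3.pair_zero_left,
      H3.pair_zero_right, H3.norm_zero, H3.sharp_zero] at this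
    ring_nf at this
    simpa [ha] using this
  have h2 := hw.map (siegel_mem_GG (-(w.1⁻¹ • w.2.1)))
  have e : siegel (-(w.1⁻¹ • w.2.1)) w = (w.1, 0, (siegel (-(w.1⁻¹ • w.2.1)) w).2.2.1,
      (siegel (-(w.1⁻¹ • w.2.1)) w).2.2.2) := by
    refine Prod.ext rfl (Prod.ext ?_ rfl)
    simp [siegelFun, smul_smul, h]
  change IsRankOne (siegel (-(w.1⁻¹ • w.2.1)) w) at h2
  rw [e] at h2
  obtain ⟨hc, hd⟩ := key _ _ _ h h2
  rw [hc, hd] at e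
  have e2 : siegel (-(w.1⁻¹ • w.2.1)) w = w.1 • rankOne 0 := by rw [e]; simp [rankOne]
  have e3 : w = siegel (w.1⁻¹ • w.2.1) (siegel (-(w.1⁻¹ • w.2.1)) w) := by
    rw [siegel_apply, siegel_apply, ← siegelFun_add]
    simp [siegelFun]
  conv_lhs => rw [e3, e2, map_smul, siegel_rankOne, add_zero]

theorem fourForm_comm (v x y : W K α β) : fourForm ![v, v, x, y] = fourForm ![v, v, y, x] := by
  rw [fourForm_eq, fourForm_eq, add_right_comm (v + v) x y, add_right_comm v x y, add_comm x y]
  ring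

/-- When the first coordinate is zero, `f₀` is orthogonal to the element, so it is a legitimate test
vector. The resulting value is a multiple of `tr(b^#, X)` for arbitrary `X`. -/
theorem IsRankOne.sharp_eq_zero {b c : H3 K α β} {d : K} (hα : α ≠ 0) (hβ : β ≠ 0)
    (hw : IsRankOne ((0, b, c, d) : W K α β)) : H3.sharp b = 0 := by
  refine H3.eq_zero_of_pair hα hβ fun X => ?_
  have h0 : fourForm ![((0, b, c, d) : W K α β), (0, b, c, d), (0, X, 0, 0), f₀] = 0 :=
    hw.2 (0, X, 0, 0) f₀ (by simp [symp, f₀])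
  rw [fourForm_comm, fourForm_f₀_left] at h0
  simp only [Prod.mk_add_mk, add_zero, ← two_smul K b, ← two_smul K (b + b), H3.norm_add,
    H3.norm_smul, H3.sharp_smul, H3.pair_smul_left] at h0
  ring_nf at h0
  rw [H3.pair_comm]
  simpa using h0

end RankOne

/-! ### Orbits of lines and the action on imaginary parts -/

section Orbits
variable {K : Type*} [Field K] {α β : K} [CharZero K]

theorem mem_lineOrbit_iff {w w' : W K α β} : w' ∈ lineOrbit w ↔
    ∃ g ν h, IsGSp6 g ν ∧ ActsAs g ν h ∧ ∃ t : Kˣ, w' = (t : K) • h w := by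
  constructor
  · rintro ⟨g, ν, hg, t, ht⟩
    obtain ⟨h, hh⟩ := hg.acts (α := α) (β := β)
    exact ⟨g, ν, h, hg, hh, t, hh.smul_eq.1 ht⟩
  · rintro ⟨g, ν, h, hg, hh, t, ht⟩
    exact ⟨g, ν, hg, t, hh.smul_eq.2 ht⟩

theorem ActsAs.one : ActsAs 1 1 (LinearEquiv.refl K (W K α β)) where
  mem := by simp [GG]
  emb_apply w := by simp [act_one]
  contract_apply w l := by simp [Matrix.one_apply]

/-- An inverse of an element of `GSp₆(K)` acts as the inverse. -/
theorem ActsAs.symm {g : Matrix (Fin 3 ⊕ Fin 3) (Fin 3 ⊕ Fin 3) K} {ν : Kˣ} (hg : IsGSp6 g ν)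
    {h : W K α β ≃ₗ[K] W K α β} (H : ActsAs g ν h) : ActsAs g⁻¹ ν⁻¹ h.symm := by
  obtain ⟨h', H'⟩ := hg.inv.acts (α := α) (β := β)
  have : h' = h.symm := by
    refine LinearEquiv.ext fun w => emb_injective ?_
    have h1 := H.emb_apply (h.symm w)
    rw [LinearEquiv.apply_symm_apply] at h1
    rw [H'.emb_apply, h1, ← act_mul, mul_inv_cancel, Matrix.mul_nonsing_inv g
      ((Matrix.isUnit_iff_isUnit_det g).1 hg.isUnit), act_one]
  rwa [← this]

theorem mem_lineOrbit_self (w : W K α β) : w ∈ lineOrbit w :=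
  mem_lineOrbit_iff.2 ⟨1, 1, _, isGSp6_one, ActsAs.one, 1, by simp⟩

theorem mem_lineOrbit_symm {w w' : W K α β} (h : w' ∈ lineOrbit w) : w ∈ lineOrbit w' := by
  obtain ⟨g, ν, h, hg, hh, t, rfl⟩ := mem_lineOrbit_iff.1 h
  exact mem_lineOrbit_iff.2 ⟨_, _, _, hg.inv, hh.symm hg, t⁻¹, by simp [smul_smul]⟩

theorem mem_lineOrbit_trans {w w' w'' : W K α β} (h : w' ∈ lineOrbit w)
    (h' : w'' ∈ lineOrbit w') : w'' ∈ lineOrbit w := by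
  obtain ⟨g, ν, h, hg, hh, t, rfl⟩ := mem_lineOrbit_iff.1 h
  obtain ⟨g', ν', k, hg', hk, t', rfl⟩ := mem_lineOrbit_iff.1 h'
  exact mem_lineOrbit_iff.2 ⟨_, _, _, hg.mul hg', hh.mul hk, t' * t, by simp [smul_smul]⟩

theorem lineOrbit_eq {w w' : W K α β} (h : w' ∈ lineOrbit w) : lineOrbit w' = lineOrbit w :=
  Set.ext fun _ => ⟨fun h' => mem_lineOrbit_trans h h',
    fun h' => mem_lineOrbit_trans (mem_lineOrbit_symm h) h'⟩

theorem smul_mem_lineOrbit {t : K} (ht : t ≠ 0) (w : W K α β) : t • w ∈ lineOrbit w :=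
  mem_lineOrbit_iff.2 ⟨1, 1, _, isGSp6_one, ActsAs.one, Units.mk0 t ht, by simp⟩

theorem ActsAs.mem_lineOrbit {g : Matrix (Fin 3 ⊕ Fin 3) (Fin 3 ⊕ Fin 3) K} {ν : Kˣ}
    (hg : IsGSp6 g ν) {h : W K α β ≃ₗ[K] W K α β} (H : ActsAs g ν h) (w : W K α β) :
    h w ∈ lineOrbit w :=
  mem_lineOrbit_iff.2 ⟨_, _, _, hg, H, 1, by simp⟩

theorem isRankOne_of_mem_lineOrbit {w w' : W K α β} (hw : IsRankOne w) (h : w' ∈ lineOrbit w) :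
    IsRankOne w' := by
  obtain ⟨g, ν, h, hg, hh, t, rfl⟩ := mem_lineOrbit_iff.1 h
  exact (isRankOne_smul_iff t.ne_zero).2 (hw.map hh.mem)

/-- The imaginary coordinates of the off-diagonal entries. -/
def imMat (X : H3 K α β) : Matrix (Fin 3) (Fin 3) K :=
  Matrix.of fun i => ![(X.2 i).imI, (X.2 i).imJ, (X.2 i).imK]

theorem exists_ofSymm_eq {D : H3 K α β} (h : imMat D = 0) :
    ∃ S : Matrix (Fin 3) (Fin 3) K, S.IsSymm ∧ ofSymm S = D := by
  refine ⟨!![D.1 0, (D.2 2).re, (D.2 1).re; (D.2 2).re, D.1 1, (D.2 0).re;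
    (D.2 1).re, (D.2 0).re, D.1 2], ?_, ?_⟩
  · ext i j; fin_cases i <;> fin_cases j <;> rfl
  have him : ∀ i, (D.2 i).imI = 0 ∧ (D.2 i).imJ = 0 ∧ (D.2 i).imK = 0 := fun i => by
    have h0 := congrFun (congrFun h i) 0
    have h1 := congrFun (congrFun h i) 1
    have h2 := congrFun (congrFun h i) 2
    simp [imMat] at h0 h1 h2
    simp [h0, h1, h2]
  apply H3.ext_coord <;> simp [ofSymm, realH3]
  all_goals ext <;> simp [him]

theorem imMat_smul (t : K) (X : H3 K α β) : imMat (t • X) = t • imMat X := by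
  ext i j
  fin_cases j <;> simp [imMat]

theorem imMat_add (X Y : H3 K α β) : imMat (X + Y) = imMat X + imMat Y := by
  ext i j
  fin_cases j <;> simp [imMat]

theorem imMat_sub (X Y : H3 K α β) : imMat (X - Y) = imMat X - imMat Y := by
  ext i j
  fin_cases j <;> simp [imMat]

/-- Two such `X` and `Y` differ by a real matrix, and translation by a real matrix comes from
`GSp₆`. -/
theorem rankOne_mem_of_imMat_eq {X Y : H3 K α β} (h : imMat Y = imMat X) :
    rankOne Y ∈ lineOrbit (rankOne X) := by
  obtain ⟨S, hS, hD⟩ := exists_ofSymm_eq (D := Y - X) (by rw [imMat_sub, h, sub_self])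
  have := (actsAs_siegel hS).mem_lineOrbit (isGSp6_siegelMat hS) (rankOne X)
  rwa [siegel_rankOne, hD, sub_add_cancel] at this

theorem rankOne_fst (X : H3 K α β) : (rankOne X).1 = 1 := rfl

theorem rankOne_snd_fst (X : H3 K α β) : (rankOne X).2.1 = X := rfl

theorem simil_rankOne (ν : Kˣ) (X : H3 K α β) :
    simil α β ν (rankOne X) = ((ν⁻¹ : Kˣ) : K) • rankOne ((ν : K) • X) := by
  have hν := ν.ne_zero
  rw [simil_apply]
  simp only [rankOne, H3.sharp_smul, H3.norm_smul, Prod.smul_mk, smul_smul, smul_eq_mul,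
    Units.val_inv_eq_inv_val]
  refine Prod.ext rfl (Prod.ext ?_ (Prod.ext ?_ ?_))
  · simp [hν]
  · simp only; congr 1; field_simp
  · simp only; field_simp

/-- A Levi element is block diagonal, so it acts on the leading coordinate through the top exterior
power of its first block. -/
theorem minor_leviMat (A : Matrix (Fin 3) (Fin 3) K) (t : ⋀[K]^3 (W6 K) ⊗[K] ℍ[K,α,β]) :
    coord ![.inl 0, .inl 1, .inl 2] (act (leviMat A) 1 t) =
      A.det • coord ![.inl 0, .inl 1, .inl 2] t := by
  have h1 : minor ![.inl 0, .inl 1, .inl 2] ∘ₗ exteriorPower.map 3 (leviMat A).vecMulLinear =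
      A.det • minor ![.inl 0, .inl 1, .inl 2] := by
    ext x
    obtain ⟨x, y, z, rfl⟩ : ∃ a b c, x = ![a, b, c] :=
      ⟨x 0, x 1, x 2, by funext i; fin_cases i <;> rfl⟩
    change minor _ (exteriorPower.map 3 _ (exteriorPower.ιMulti K 3 ![x, y, z])) =
      A.det • minor _ (wedge x y z)
    rw [exteriorPower.map_apply_ιMulti]
    have e : (⇑(leviMat A).vecMulLinear ∘ ![x, y, z]) =
        ![x ᵥ* leviMat A, y ᵥ* leviMat A, z ᵥ* leviMat A] := by
      funext i; fin_cases i <;> rfl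
    rw [e]
    change minor _ (wedge _ _ _) = _
    simp only [minor_wedge, smul_eq_mul, Matrix.det_fin_three]
    simp [leviMat, Matrix.vecMul, dotProduct, Fin.sum_univ_three]
    ring
  simp only [coord, act, LinearMap.comp_apply, LinearEquiv.coe_coe]
  rw [inv_one, Units.val_one, one_smul, ← LinearMap.comp_apply, ← LinearMap.rTensor_comp, h1]
  simp

variable (hα : α ≠ 0) (hβ : β ≠ 0)
include hα hβ

/-- The Levi action on `W` need not be computed in full. The first coordinate is known from
`minor_leviMat`, the rank one condition then puts the image in normal form, and equivariance of the
contraction determines its imaginary parts. -/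
theorem rankOne_mem_lineOrbit {X Y : H3 K α β} {A : Matrix (Fin 3) (Fin 3) K} (hA : A.det ≠ 0)
    (h : imMat Y = A * imMat X) : rankOne Y ∈ lineOrbit (rankOne X) := by
  have hAt : Aᵀ.det ≠ 0 := by rwa [Matrix.det_transpose]
  obtain ⟨k, hk⟩ := acts_leviMat (α := α) (β := β) hAt
  obtain ⟨w, hkw⟩ : ∃ w, w = k (rankOne X) := ⟨_, rfl⟩
  have hw : w ∈ lineOrbit (rankOne X) := hkw ▸ hk.mem_lineOrbit (isGSp6_leviMat hAt) _
  have h1 : w.1 = A.det := by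
    have := congrArg (coord ![.inl 0, .inl 1, .inl 2]) (hk.emb_apply (rankOne X))
    rw [minor_leviMat, (coord_emb _).1, (coord_emb _).1, ← hkw, rankOne_fst,
      Matrix.det_transpose] at this
    simpa using congrArg QuaternionAlgebra.re this
  have hr := (isRankOne_of_mem_lineOrbit (isRankOne_rankOne X) hw).eq_smul_rankOne hα hβ
    (by rwa [h1])
  obtain ⟨Z, hZ⟩ : ∃ Z, Z = w.1⁻¹ • w.2.1 := ⟨_, rfl⟩
  rw [← hZ, h1] at hr
  -- The second coordinate of `w` is `A.det • Z`; a similitude by `A.det` removes the discrepancy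
  -- between `Z` and it.
  have h2 : rankOne (A.det • Z) ∈ lineOrbit w := by
    have e1 := (actsAs_simil (α := α) (β := β) (Units.mk0 _ hA)).mem_lineOrbit
      (isGSp6_similMat _) (rankOne Z)
    rw [simil_rankOne] at e1
    have e2 := mem_lineOrbit_trans e1 (smul_mem_lineOrbit hA _)
    rw [Units.val_inv_eq_inv_val, Units.val_mk0, smul_smul, mul_inv_cancel₀ hA, one_smul] at e2
    refine mem_lineOrbit_trans ?_ e2
    rw [hr]
    exact mem_lineOrbit_symm (smul_mem_lineOrbit hA _)
  refine mem_lineOrbit_trans (mem_lineOrbit_trans hw h2) (rankOne_mem_of_imMat_eq ?_)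
  have h3 : A.det • Z = w.2.1 := by simp [hZ, h1, smul_smul, hA]
  rw [h, h3]
  ext l m
  have := hk.contract_apply (rankOne X) (.inl l)
  simp only [Fintype.sum_sum_type, contract, Sum.elim_inl, Sum.elim_inr, ← hkw,
    rankOne_snd_fst] at this
  have hI := congrArg QuaternionAlgebra.imI this
  have hJ := congrArg QuaternionAlgebra.imJ this
  have hK := congrArg QuaternionAlgebra.imK this
  simp [leviMat, Fin.sum_univ_three] at hI hJ hK
  fin_cases m <;> simp [imMat, Matrix.mul_apply, Fin.sum_univ_three]
  · linear_combination hI / 2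
  · linear_combination hJ / 2
  · linear_combination hK / 2

end Orbits

/-! ### The open orbit, and why collinear orbits are not open -/

section OpenOrbits
variable {K : Type*} [Field K] {α β : K} [CharZero K]

theorem linearMap_mem_polyFun {V : Type*} [AddCommGroup V] [Module K V] (φ : V →ₗ[K] K) :
    (φ : V → K) ∈ polyFun K V :=
  Algebra.subset_adjoin ⟨φ, rfl⟩

/-- The function `w ↦ a det(im b)` for `h w = (a, b, c, d)`. -/
def genericFun (h : W K α β ≃ₗ[K] W K α β) (w : W K α β) : K :=
  (h w).1 * (imMat (h w).2.1).det

theorem genericFun_mem_polyFun (h : W K α β ≃ₗ[K] W K α β) :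
    genericFun h ∈ polyFun K (W K α β) := by
  have h0 : (fun w => (h w).1) ∈ polyFun K (W K α β) :=
    linearMap_mem_polyFun (LinearMap.fst K _ _ ∘ₗ h.toLinearMap)
  have h1 : ∀ i j, (fun w => imMat (h w).2.1 i j) ∈ polyFun K (W K α β) := fun i j =>
    linearMap_mem_polyFun
      { toFun := fun w => imMat (h w).2.1 i j
        map_add' := fun u v => by simp [imMat_add]
        map_smul' := fun t u => by simp [imMat_smul] }
  have : genericFun h = (fun w => (h w).1) * ∑ σ : Equiv.Perm (Fin 3),
      (Equiv.Perm.sign σ : ℤ) • ∏ i, (fun w => imMat (h w).2.1 (σ i) i) := by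
    funext w
    simp [genericFun, Matrix.det_apply, Units.smul_def]
  rw [this]
  exact mul_mem h0 (sum_mem fun σ _ => zsmul_mem (prod_mem fun i _ => h1 _ _) _)

theorem contract_smul (t : K) (w : W K α β) (l : Fin 3 ⊕ Fin 3) :
    contract (t • w) l = t • contract w l := by
  rcases l with l | l <;> simp [contract, smul_sub]

/-- All the contractions of `w` are multiples of one quaternion. -/
def IsCollinear (w : W K α β) : Prop := ∃ y : ℍ[K,α,β], ∀ l, ∃ c : K, contract w l = c • y

/-- The group mixes the six contractions with coefficients in `K`, so their span does not grow. -/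
theorem IsCollinear.of_mem_lineOrbit {w w' : W K α β} (hw : IsCollinear w)
    (h : w' ∈ lineOrbit w) : IsCollinear w' := by
  obtain ⟨g, ν, k, hg, hk, t, rfl⟩ := mem_lineOrbit_iff.1 h
  obtain ⟨y, hy⟩ := hw
  choose c hc using hy
  refine ⟨y, fun l => ⟨t * ∑ m, g m l * c m, ?_⟩⟩
  rw [contract_smul, hk.contract_apply]
  simp only [hc, smul_smul, ← Finset.sum_smul]

theorem IsCollinear.exists_imMat {X : H3 K α β} (h : IsCollinear (rankOne X)) :
    ∃ c y : Fin 3 → K, imMat X = Matrix.vecMulVec c y := by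
  obtain ⟨y, hy⟩ := h
  choose c hc using hy
  refine ⟨fun i => c (.inl i), fun j => -(![y.imI, y.imJ, y.imK] j) / 2, ?_⟩
  ext i j
  have := hc (.inl i)
  simp only [contract, Sum.elim_inl, rankOne_snd_fst] at this
  have hI := congrArg QuaternionAlgebra.imI this
  have hJ := congrArg QuaternionAlgebra.imJ this
  have hK := congrArg QuaternionAlgebra.imK this
  simp at hI hJ hK
  fin_cases j <;> simp [imMat, Matrix.vecMulVec_apply]
  · linear_combination -hI / 2
  · linear_combination -hJ / 2
  · linear_combination -hK / 2

theorem IsCollinear.det_eq_zero {X : H3 K α β} (h : IsCollinear (rankOne X)) :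
    (imMat X).det = 0 := by
  obtain ⟨c, y, h⟩ := h.exists_imMat
  rw [h, Matrix.det_fin_three]
  simp only [Matrix.vecMulVec_apply]
  ring

theorem exists_rankOne_add_smul (X Z : H3 K α β) : ∃ u v w : W K α β, ∀ t : K,
    rankOne (X + t • Z) = rankOne X + t • u + t ^ 2 • v + t ^ 3 • w := by
  refine ⟨(0, Z, H3.cross X Z, H3.pair (H3.sharp X) Z), (0, 0, H3.sharp Z, H3.pair X (H3.sharp Z)),
    (0, 0, 0, H3.norm Z), fun t => ?_⟩
  simp only [rankOne, H3.sharp_add, H3.norm_add, H3.sharp_smul, H3.norm_smul, H3.cross_comm X, H3.cross_smul_left,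
    H3.pair_smul_right, Prod.smul_mk, Prod.mk_add_mk, smul_zero, add_zero, zero_add, smul_eq_mul, mul_zero]

/-- The curve `t ↦ rankOne (X + t • Z)` is cubic in `t`, so polynomial functions on `W` restrict to
polynomials in `t`. -/
theorem isPolyFun_curve {F : W K α β → K} (hF : F ∈ polyFun K (W K α β)) (X Z : H3 K α β) :
    IsPolyFun fun t : K => F (rankOne (X + t • Z)) := by
  obtain ⟨u, v, w, h⟩ := exists_rankOne_add_smul X Z
  simp only [h]
  induction hF using Algebra.adjoin_induction with
  | mem F hF =>
    obtain ⟨φ, rfl⟩ := hF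
    simp only [map_add, map_smul, smul_eq_mul]
    exact (((isPolyFun_const _).add (isPolyFun_id.mul (isPolyFun_const _))).add
      ((isPolyFun_id.pow 2).mul (isPolyFun_const _))).add
      ((isPolyFun_id.pow 3).mul (isPolyFun_const _))
  | algebraMap r => exact isPolyFun_const r
  | add F G _ _ hF hG => exact hF.add hG
  | mul F G _ _ hF hG => exact hF.mul hG

/-- An orbit with collinear contractions is not open. -/
theorem IsCollinear.not_isOpenOrbit {X : H3 K α β} (h : IsCollinear (rankOne X)) :
    ¬ IsOpenOrbit (rankOne X) := by
  rintro ⟨I, hI, hx⟩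
  obtain ⟨F, hF, hF0⟩ := (hx _ (isRankOne_rankOne X)).1 (mem_lineOrbit_self _)
  obtain ⟨c, y, hcy⟩ := h.exists_imMat
  -- A direction with `imMat Z = 1`. For `imMat X = c yᵀ` the determinant along `X + t Z` is `t² (t
  -- + c · y)`, so all but at most two points of the line are generic and lie outside the collinear
  -- orbit.
  let Z : H3 K α β := (0, ![⟨0, 1, 0, 0⟩, ⟨0, 0, 1, 0⟩, ⟨0, 0, 0, 1⟩])
  have hZ : imMat Z = 1 := by
    ext i j
    fin_cases i <;> fin_cases j <;> rfl
  have key := (isPolyFun_curve (hI hF) X Z).eq_zero {0, -(∑ i, c i * y i)} (Set.toFinite _) fun t ht => by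
    by_contra hne
    have h1 := (h.of_mem_lineOrbit ((hx _ (isRankOne_rankOne _)).2 ⟨F, hF, hne⟩)).det_eq_zero
    rw [imMat_add, imMat_smul, hZ, hcy, Matrix.det_fin_three] at h1
    simp [Matrix.vecMulVec_apply, Fin.sum_univ_three] at h1 ht
    have h2 : t * t * (t - -(c 0 * y 0 + c 1 * y 1 + c 2 * y 2)) = 0 := by
      linear_combination h1
    simp [ht.1, sub_eq_zero] at h2
    exact ht.2 (by rw [h2])
  have := key 0
  simp at this
  exact hF0 this

theorem isOpenOrbit_iff_of_mem {w w' : W K α β} (h : w' ∈ lineOrbit w) :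
    IsOpenOrbit w' ↔ IsOpenOrbit w := by
  simp only [IsOpenOrbit, lineOrbit_eq h]

variable (hα : α ≠ 0) (hβ : β ≠ 0)
include hα hβ

theorem rankOne_mem_of_det_ne_zero {X Y : H3 K α β} (hX : (imMat X).det ≠ 0)
    (hY : (imMat Y).det ≠ 0) : rankOne Y ∈ lineOrbit (rankOne X) := by
  refine rankOne_mem_lineOrbit hα hβ (A := imMat Y * (imMat X)⁻¹) ?_ ?_
  · rw [Matrix.det_mul, Matrix.det_nonsing_inv, Ring.inverse_eq_inv']
    exact mul_ne_zero hY (inv_ne_zero hX)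
  · rw [Matrix.mul_assoc, Matrix.nonsing_inv_mul _ (isUnit_iff_ne_zero.2 hX), Matrix.mul_one]

/-- The defining functions are `a det(im b)` composed with all group elements: a rank one line lies
in the orbit exactly when some translate of it has `a ≠ 0` and invertible imaginary part. -/
theorem isOpenOrbit_rankOne {X : H3 K α β} (hX : (imMat X).det ≠ 0) :
    IsOpenOrbit (rankOne X) := by
  refine ⟨{F | ∃ g ν h, IsGSp6 g ν ∧ ActsAs g ν h ∧ F = genericFun h}, ?_, fun x hx => ?_⟩
  · rintro F ⟨g, ν, h, -, -, rfl⟩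
    exact genericFun_mem_polyFun h
  · constructor
    · intro h
      obtain ⟨g, ν, h, hg, hh, t, ht⟩ := mem_lineOrbit_iff.1 (mem_lineOrbit_symm h)
      refine ⟨_, ⟨g, ν, h, hg, hh, rfl⟩, ?_⟩
      have e : h x = (t⁻¹ : K) • rankOne X := by rw [ht]; simp
      simp [genericFun, e, rankOne_fst, rankOne_snd_fst, imMat_smul, Matrix.det_smul, hX]
    · rintro ⟨F, ⟨g, ν, h, hg, hh, rfl⟩, hF⟩
      rw [genericFun] at hF
      have h1 := left_ne_zero_of_mul hF
      have h2 := (hx.map hh.mem).eq_smul_rankOne hα hβ h1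
      have h3 : (imMat ((h x).1⁻¹ • (h x).2.1)).det ≠ 0 := by
        rw [imMat_smul, Matrix.det_smul]
        exact mul_ne_zero (pow_ne_zero _ (inv_ne_zero h1)) (right_ne_zero_of_mul hF)
      have h4 := mem_lineOrbit_trans (rankOne_mem_of_det_ne_zero hα hβ hX h3)
        (smul_mem_lineOrbit h1 _)
      rw [← h2] at h4
      exact mem_lineOrbit_trans h4 (mem_lineOrbit_symm (hh.mem_lineOrbit hg x))

end OpenOrbits

/-! ### Explicit moves -/

section RealMoves
variable {K : Type*} [Field K] {α β : K} [CharZero K]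

/-- Generated by elements of `GSp₆` whose action is defined by explicit formulas. -/
inductive RealMove : W K α β → W K α β → Prop
  | refl (w : W K α β) : RealMove w w
  | weyl {w w' : W K α β} : RealMove w w' → RealMove w (Freudenthal.weyl K α β w')
  | siegel {w w' : W K α β} {X : H3 K α β} (hX : imMat X = 0) :
      RealMove w w' → RealMove w (siegelFun X w')
  | smul {w w' : W K α β} {t : K} (ht : t ≠ 0) : RealMove w w' → RealMove w (t • w')

theorem RealMove.trans {w w' w'' : W K α β} (h : RealMove w w') (h' : RealMove w' w'') :
    RealMove w w'' := by
  induction h' with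
  | refl => exact h
  | weyl _ ih => exact ih.weyl
  | siegel hX _ ih => exact ih.siegel hX
  | smul ht _ ih => exact ih.smul ht

theorem RealMove.mem_lineOrbit {w w' : W K α β} (h : RealMove w w') : w' ∈ lineOrbit w := by
  induction h with
  | refl => exact mem_lineOrbit_self _
  | weyl _ ih => exact mem_lineOrbit_trans ih (actsAs_weyl.mem_lineOrbit isGSp6_J6 _)
  | siegel hX _ ih =>
    obtain ⟨S, hS, rfl⟩ := exists_ofSymm_eq hX
    exact mem_lineOrbit_trans ih ((actsAs_siegel hS).mem_lineOrbit (isGSp6_siegelMat hS) _)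
  | smul ht _ ih => exact mem_lineOrbit_trans ih (smul_mem_lineOrbit ht _)

/-- The opposite Siegel unipotent element attached to `X`. -/
def lowerFun (X : H3 K α β) (w : W K α β) : W K α β :=
  (w.1 - H3.pair w.2.1 X + H3.pair w.2.2.1 (H3.sharp X) - w.2.2.2 * H3.norm X,
    w.2.1 - H3.cross w.2.2.1 X + w.2.2.2 • H3.sharp X, w.2.2.1 - w.2.2.2 • X, w.2.2.2)

theorem RealMove.lower {w w' : W K α β} {X : H3 K α β} (hX : imMat X = 0) (h : RealMove w w') :
    RealMove w (lowerFun X w') := by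
  -- Conjugation by `weyl` exchanges the two Siegel unipotent subgroups; the sign is due to `weyl`
  -- squaring to `-1`.
  have e : lowerFun X w' = (-1 : K) • Freudenthal.weyl K α β (siegelFun X
      (Freudenthal.weyl K α β w')) := by
    simp only [lowerFun, weyl_apply, siegelFun, H3.pair_neg_left, Prod.smul_mk]
    refine Prod.ext ?_ (Prod.ext ?_ (Prod.ext ?_ ?_)) <;> simp
    · ring
    · abel
    · abel
  rw [e]
  exact (h.weyl.siegel hX).weyl.smul (by simp)

theorem RealMove.rankOne_of_imMat_eq {X Y : H3 K α β} (h : imMat Y = imMat X) :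
    RealMove (rankOne X) (rankOne Y) := by
  have := (RealMove.refl (rankOne X)).siegel (X := Y - X) (by rw [imMat_sub, h, sub_self])
  rwa [← siegel_apply, siegel_rankOne, sub_add_cancel] at this

/-! ### Compatibility with extension of scalars -/

section BaseChange
variable (L : Type*) [Field L] [Algebra K L]

theorem qBaseChange_mul (x y : ℍ[K,α,β]) :
    qBaseChange L (x * y) = qBaseChange L x * qBaseChange L y := by
  ext <;> simp [qBaseChange]

theorem qBaseChange_star (x : ℍ[K,α,β]) : qBaseChange L (star x) = star (qBaseChange L x) := by
  ext <;> simp [qBaseChange]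

theorem qBaseChange_add (x y : ℍ[K,α,β]) :
    qBaseChange L (x + y) = qBaseChange L x + qBaseChange L y := by
  ext <;> simp [qBaseChange]

theorem qBaseChange_neg (x : ℍ[K,α,β]) : qBaseChange L (-x) = -qBaseChange L x := by
  ext <;> simp [qBaseChange]

theorem qBaseChange_smul (t : K) (x : ℍ[K,α,β]) :
    qBaseChange L (t • x) = algebraMap K L t • qBaseChange L x := by
  ext <;> simp only [qBaseChange, QuaternionAlgebra.re_smul, QuaternionAlgebra.imI_smul,
    QuaternionAlgebra.imJ_smul, QuaternionAlgebra.imK_smul, smul_eq_mul, map_mul]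

theorem qnorm_qBaseChange (x : ℍ[K,α,β]) : qnorm (qBaseChange L x) = algebraMap K L (qnorm x) := by
  simp [qnorm_eq, qBaseChange]

theorem H3.baseChange_add (X Y : H3 K α β) :
    H3.baseChange L (X + Y) = H3.baseChange L X + H3.baseChange L Y := by
  apply H3.ext_coord <;> simp [H3.baseChange, qBaseChange_add]

theorem H3.baseChange_smul (t : K) (X : H3 K α β) :
    H3.baseChange L (t • X) = algebraMap K L t • H3.baseChange L X := by
  apply H3.ext_coord <;> simp only [H3.baseChange, qBaseChange_smul, Prod.smul_fst, Prod.smul_snd,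
    Pi.smul_apply, smul_eq_mul, map_mul]

theorem H3.baseChange_neg (X : H3 K α β) : H3.baseChange L (-X) = -H3.baseChange L X := by
  apply H3.ext_coord <;> simp [H3.baseChange, qBaseChange_neg]

theorem H3.baseChange_sharp (X : H3 K α β) :
    H3.baseChange L (H3.sharp X) = H3.sharp (H3.baseChange L X) := by
  apply H3.ext_coord
  all_goals simp [-neg_smul, H3.baseChange, H3.sharp_fst, H3.sharp_snd, qnorm_qBaseChange,
    sub_eq_add_neg, qBaseChange_add, qBaseChange_neg, qBaseChange_mul, qBaseChange_star]
  all_goals simp only [qBaseChange_smul, algebraMap_smul]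

theorem H3.baseChange_cross (X Y : H3 K α β) :
    H3.baseChange L (H3.cross X Y) = H3.cross (H3.baseChange L X) (H3.baseChange L Y) := by
  simp only [H3.cross, sub_eq_add_neg, H3.baseChange_add, H3.baseChange_neg, H3.baseChange_sharp]

theorem H3.baseChange_norm (X : H3 K α β) :
    algebraMap K L (H3.norm X) = H3.norm (H3.baseChange L X) := by
  simp [H3.norm, H3.baseChange, qBaseChange, qnorm_eq, qtr_eq, map_ofNat]

theorem H3.baseChange_pair (X Y : H3 K α β) [CharZero L] :
    algebraMap K L (H3.pair X Y) = H3.pair (H3.baseChange L X) (H3.baseChange L Y) := by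
  simp [H3.pair_eq, H3.baseChange, qBaseChange, qtr_eq, map_ofNat]

theorem imMat_baseChange (X : H3 K α β) :
    imMat (H3.baseChange L X) = (imMat X).map (algebraMap K L) := by
  ext i j
  fin_cases j <;> rfl

theorem wBaseChange_rankOne (X : H3 K α β) :
    wBaseChange L (rankOne X) = rankOne (H3.baseChange L X) := by
  simp [wBaseChange, rankOne, H3.baseChange_sharp, H3.baseChange_norm]

/-- This is the purpose of `RealMove`: being given by formulas, the moves extend to any larger
field. A reduction found over `ℚ` thus remains valid over the algebraic closure, where definiteness
is not available. -/
theorem RealMove.baseChange [CharZero L] {w w' : W K α β} (h : RealMove w w') :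
    RealMove (wBaseChange L w) (wBaseChange L w') := by
  induction h with
  | refl => exact .refl _
  | weyl _ ih =>
    have := ih.weyl
    simpa [wBaseChange, weyl_apply, H3.baseChange_neg] using this
  | @siegel w' X hX _ ih =>
    have := ih.siegel (X := H3.baseChange L X) (by rw [imMat_baseChange, hX]; simp)
    simpa only [wBaseChange, siegelFun, map_add, map_mul, H3.baseChange_add, H3.baseChange_smul, H3.baseChange_cross,
      H3.baseChange_sharp, H3.baseChange_pair, H3.baseChange_norm] using this
  | @smul w' t ht _ ih =>
    have := ih.smul (t := algebraMap K L t) (by simpa using ht)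
    simpa only [wBaseChange, H3.baseChange_smul, Prod.smul_mk, smul_eq_mul, map_mul, Prod.smul_fst,
      Prod.smul_snd] using this

end BaseChange
end RealMoves

/-! ### Lines with collinear contractions -/

section Collinear
variable {K : Type*} [Field K] {α β : K} [CharZero K]

/-- All entries of `X` lie in the commutative algebra `K + K y` generated by one quaternion of trace
zero, hence so do those of `X^#`; imaginary parts there are multiples of `y`. -/
theorem isCollinear_of_imMat {X : H3 K α β} {c y : Fin 3 → K}
    (h : imMat X = Matrix.vecMulVec c y) : IsCollinear (rankOne X) := by
  have hI : ∀ i, (X.2 i).imI = c i * y 0 := fun i => congrFun (congrFun h i) 0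
  have hJ : ∀ i, (X.2 i).imJ = c i * y 1 := fun i => congrFun (congrFun h i) 1
  have hK : ∀ i, (X.2 i).imK = c i * y 2 := fun i => congrFun (congrFun h i) 2
  refine ⟨⟨0, y 0, y 1, y 2⟩, ?_⟩
  rintro (l | l)
  · refine ⟨-2 * c l, ?_⟩
    simp only [contract, Sum.elim_inl, rankOne_snd_fst]
    ext <;> simp [hI, hJ, hK] <;> ring
  · simp only [contract, Sum.elim_inr, rankOne, H3.sharp_snd]
    fin_cases l
    · refine ⟨-2 * ((X.2 2).re * c 1 + (X.2 1).re * c 2 + X.1 0 * c 0), ?_⟩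
      ext <;> simp [hI, hJ, hK] <;> ring
    · refine ⟨-2 * ((X.2 0).re * c 2 + (X.2 2).re * c 0 + X.1 1 * c 1), ?_⟩
      ext <;> simp [hI, hJ, hK] <;> ring
    · refine ⟨-2 * ((X.2 1).re * c 0 + (X.2 0).re * c 1 + X.1 2 * c 2), ?_⟩
      ext <;> simp [hI, hJ, hK] <;> ring

/-- The element of `H₃(B)` with off-diagonal entry `y` in position `(2, 3)`, up to conjugation. -/
def corner (y : ℍ[K,α,β]) : H3 K α β := (0, ![y, 0, 0])

/-- A nonzero column `c` is the first column of some invertible matrix, so `GL₃` can concentrate the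
imaginary part in one off-diagonal entry. -/
theorem rankOne_mem_lineOrbit_corner (hα : α ≠ 0) (hβ : β ≠ 0) {X : H3 K α β} {c y : Fin 3 → K}
    (h : imMat X = Matrix.vecMulVec c y) :
    ∃ q : ℍ[K,α,β], rankOne X ∈ lineOrbit (rankOne (corner q)) := by
  by_cases hc : c = 0
  · refine ⟨0, rankOne_mem_of_imMat_eq ?_⟩
    rw [h, hc]
    ext i j
    fin_cases i <;> fin_cases j <;> simp [imMat, corner, Matrix.vecMulVec_apply]
  · obtain ⟨A, hA, hAc⟩ : ∃ A : Matrix (Fin 3) (Fin 3) K, A.det ≠ 0 ∧ ∀ i, A i 0 = c i := by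
      have : c 0 ≠ 0 ∨ c 1 ≠ 0 ∨ c 2 ≠ 0 := by
        by_contra hh
        push Not at hh
        exact hc (funext fun i => by fin_cases i <;> simp [hh])
      rcases this with h0 | h0 | h0
      · exact ⟨!![c 0, 0, 0; c 1, 1, 0; c 2, 0, 1], by simpa [Matrix.det_fin_three] using h0,
          fun i => by fin_cases i <;> rfl⟩
      · exact ⟨!![c 0, 1, 0; c 1, 0, 0; c 2, 0, 1], by simpa [Matrix.det_fin_three] using h0,
          fun i => by fin_cases i <;> rfl⟩
      · exact ⟨!![c 0, 1, 0; c 1, 0, 1; c 2, 0, 0], by simpa [Matrix.det_fin_three] using h0,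
          fun i => by fin_cases i <;> rfl⟩
    refine ⟨⟨0, y 0, y 1, y 2⟩, rankOne_mem_lineOrbit hα hβ hA ?_⟩
    rw [h]
    ext i j
    fin_cases j <;>
      simp [Matrix.vecMulVec_apply, Matrix.mul_apply, Fin.sum_univ_three, imMat, corner, hAc]

end Collinear

/-! ### Consequences of definiteness over `ℚ` -/

section Definite
variable {α β : ℚ}

/-- If `α ≥ 0`, then `(√α - i)(√α + i) = 0` exhibits a zero divisor over `ℝ`; similarly for `β` with
`j`. -/
theorem RamifiedAtInfinity.neg (h : RamifiedAtInfinity α β) : α < 0 ∧ β < 0 := by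
  constructor <;> by_contra! hc
  · have hs : √(α : ℝ) * √(α : ℝ) = α := Real.mul_self_sqrt (by exact_mod_cast hc)
    have hu := h ⟨√(α : ℝ), -1, 0, 0⟩ fun e => by
      simpa using congrArg QuaternionAlgebra.imI e
    have h0 : (⟨√(α : ℝ), -1, 0, 0⟩ : ℍ[ℝ,(α : ℝ),(β : ℝ)]) * ⟨√(α : ℝ), 1, 0, 0⟩ = 0 := by
      ext <;> simp [hs]
    have := congrArg QuaternionAlgebra.imI ((hu.mul_right_eq_zero).1 h0)
    simp at this
  · have hs : √(β : ℝ) * √(β : ℝ) = β := Real.mul_self_sqrt (by exact_mod_cast hc)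
    have hu := h ⟨√(β : ℝ), 0, -1, 0⟩ fun e => by
      simpa using congrArg QuaternionAlgebra.imJ e
    have h0 : (⟨√(β : ℝ), 0, -1, 0⟩ : ℍ[ℝ,(α : ℝ),(β : ℝ)]) * ⟨√(β : ℝ), 0, 1, 0⟩ = 0 := by
      ext <;> simp [hs]
    have := congrArg QuaternionAlgebra.imJ ((hu.mul_right_eq_zero).1 h0)
    simp at this

variable (hα : α < 0) (hβ : β < 0)
include hα hβ

theorem qnorm_nonneg (x : ℍ[ℚ,α,β]) : 0 ≤ qnorm x := by
  rw [qnorm_eq]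
  have h1 := mul_nonneg (neg_pos.2 hα).le (sq_nonneg x.imI)
  have h2 := mul_nonneg (neg_pos.2 hβ).le (sq_nonneg x.imJ)
  have h3 := mul_nonneg (mul_pos_of_neg_of_neg hα hβ).le (sq_nonneg x.imK)
  have h4 := sq_nonneg x.re
  linarith

theorem qnorm_eq_zero {x : ℍ[ℚ,α,β]} (h : qnorm x = 0) : x = 0 := by
  rw [qnorm_eq] at h
  have h1 := mul_nonneg (neg_pos.2 hα).le (sq_nonneg x.imI)
  have h2 := mul_nonneg (neg_pos.2 hβ).le (sq_nonneg x.imJ)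
  have h3 := mul_nonneg (mul_pos_of_neg_of_neg hα hβ).le (sq_nonneg x.imK)
  have h4 := sq_nonneg x.re
  have e1 : -α * x.imI ^ 2 = 0 := by linarith
  have e2 : -β * x.imJ ^ 2 = 0 := by linarith
  have e3 : α * β * x.imK ^ 2 = 0 := by linarith
  have e4 : x.re ^ 2 = 0 := by linarith
  simp [hα.ne, hβ.ne] at e1 e2 e3 e4
  ext <;> simp [e1, e2, e3, e4]

theorem H3.eq_zero_of_sharp {b : H3 ℚ α β} (h : H3.sharp b = 0) (hd : b.1 = 0) : b = 0 := by
  have h1 : (H3.sharp b).1 = 0 := by rw [h]; rfl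
  rw [H3.sharp_fst, hd] at h1
  have k0 := congrFun h1 0
  have k1 := congrFun h1 1
  have k2 := congrFun h1 2
  simp at k0 k1 k2
  refine H3.ext_coord (by simp [hd]) (by simp [hd]) (by simp [hd]) ?_ ?_ ?_
  exacts [qnorm_eq_zero hα hβ k0, qnorm_eq_zero hα hβ k1, qnorm_eq_zero hα hβ k2]

/-- Vanishing of the adjoint makes the pairwise products of the diagonal entries equal to norms,
hence nonnegative. If the sum is zero, its square forces each diagonal entry to vanish, and then the
off-diagonal ones. -/
theorem H3.trace_ne_zero {b : H3 ℚ α β} (h : H3.sharp b = 0) (hb : b ≠ 0) :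
    b.1 0 + b.1 1 + b.1 2 ≠ 0 := by
  intro h0
  have h1 : (H3.sharp b).1 = 0 := by rw [h]; rfl
  rw [H3.sharp_fst] at h1
  have k0 := congrFun h1 0
  have k1 := congrFun h1 1
  have k2 := congrFun h1 2
  simp at k0 k1 k2
  have n0 := qnorm_nonneg hα hβ (b.2 0)
  have n1 := qnorm_nonneg hα hβ (b.2 1)
  have n2 := qnorm_nonneg hα hβ (b.2 2)
  have hs : b.1 0 ^ 2 + b.1 1 ^ 2 + b.1 2 ^ 2 + 2 * (b.1 1 * b.1 2) + 2 * (b.1 0 * b.1 2) +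
      2 * (b.1 0 * b.1 1) = 0 := by
    have := congrArg (· ^ 2) h0
    linear_combination this
  have s0 := sq_nonneg (b.1 0)
  have s1 := sq_nonneg (b.1 1)
  have s2 := sq_nonneg (b.1 2)
  have e0 : b.1 0 ^ 2 = 0 := by linarith
  have e1 : b.1 1 ^ 2 = 0 := by linarith
  have e2 : b.1 2 ^ 2 = 0 := by linarith
  simp at e0 e1 e2
  refine hb (H3.eq_zero_of_sharp hα hβ h (funext fun i => ?_))
  fin_cases i <;> simp [e0, e1, e2]

omit hα hβ in
theorem imMat_fst (c : Fin 3 → ℚ) : imMat ((c, 0) : H3 ℚ α β) = 0 := by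
  ext i j; fin_cases j <;> rfl

/-- If the first coordinate stays zero under all moves, so does the last, by `weyl`. Then `b^# = 0`,
and opposite translations by the diagonal idempotents show that the diagonal of `b` vanishes.
Definiteness gives `b = 0`, and applying this after `weyl` gives `c = 0` too. -/
theorem IsRankOne.exists_fst_ne_zero {w : W ℚ α β} (hw : IsRankOne w) :
    ∃ w', RealMove w w' ∧ w'.1 ≠ 0 := by
  by_contra! H
  have key : ∀ u, RealMove w u → u.2.1 = 0 := by
    intro u hu
    have hr := isRankOne_of_mem_lineOrbit hw hu.mem_lineOrbit
    have h1 := H u hu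
    have h2 := H _ hu.weyl
    rw [weyl_apply, neg_eq_zero] at h2
    obtain ⟨a, b, c, d⟩ := u
    simp only at h1 h2
    subst h1 h2
    have h3 := hr.sharp_eq_zero hα.ne hβ.ne
    refine H3.eq_zero_of_sharp hα hβ h3 (funext fun i => ?_)
    have h4 := H _ (hu.lower (imMat_fst (Pi.single i 1)))
    have h5 : H3.sharp ((Pi.single i 1, 0) : H3 ℚ α β) = 0 := by
      fin_cases i <;> apply H3.ext_coord <;> simp [H3.sharp_fst, H3.sharp_snd, qnorm_eq]
    simp only [lowerFun, h5, H3.pair_zero_right] at h4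
    fin_cases i <;> simpa [H3.pair_eq, qtr_eq] using h4
  have h1 := key w (.refl w)
  have h2 := key _ (RealMove.refl w).weyl
  have h3 := H w (.refl w)
  have h4 := H _ (RealMove.refl w).weyl
  simp [weyl_apply] at h2 h4
  exact hw.1 (Prod.ext h3 (Prod.ext h1 (Prod.ext h2 h4)))

theorem IsRankOne.exists_rankOne {w : W ℚ α β} (hw : IsRankOne w) :
    ∃ X, RealMove w (rankOne X) := by
  obtain ⟨w', h, h0⟩ := hw.exists_fst_ne_zero hα hβ
  have hr := (isRankOne_of_mem_lineOrbit hw h.mem_lineOrbit).eq_smul_rankOne hα.ne hβ.ne h0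
  refine ⟨(w'.1)⁻¹ • w'.2.1, ?_⟩
  have e : w'.1⁻¹ • w' = rankOne (w'.1⁻¹ • w'.2.1) :=
    (congrArg (w'.1⁻¹ • ·) hr).trans (by simp only [smul_smul, inv_mul_cancel₀ h0, one_smul])
  exact e ▸ h.smul (inv_ne_zero h0)

theorem isRankOne_iff_mem_orbitGG {w : W ℚ α β} : IsRankOne w ↔ w ∈ orbitGG α β := by
  refine ⟨fun hw => ?_, isRankOne_of_mem_orbitGG⟩
  obtain ⟨X, hX⟩ := hw.exists_rankOne hα hβ
  obtain ⟨g, ν, h, hg, hh, t, ht⟩ := mem_lineOrbit_iff.1 hX.mem_lineOrbit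
  refine (orbitGG_map hh.mem).1 ?_
  have : h w = (t : ℚ)⁻¹ • rankOne X := by rw [ht, smul_smul]; simp
  exact this ▸ smul_rankOne_mem_orbitGG (inv_ne_zero t.ne_zero) X

omit hα hβ in
-- As `X` has zero diagonal, translating by a diagonal idempotent keeps the first coordinate equal
-- to `1`, so the result is again in normal form.
theorem exists_det_ne_zero_of_lower {M : Matrix (Fin 3) (Fin 3) ℚ} (k : Fin 3) {X : H3 ℚ α β}
    (hα : α ≠ 0) (hβ : β ≠ 0)
    (hX : X = (0, fun i => ⟨0, M i 0, M i 1, M i 2⟩))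
    (h : (imMat (lowerFun (Pi.single k 1, 0) (rankOne X)).2.1).det ≠ 0) :
    ∃ Y, (imMat Y).det ≠ 0 ∧ RealMove (rankOne X) (rankOne Y) := by
  have hm := (RealMove.refl (rankOne X)).lower (imMat_fst (Pi.single k 1))
  have h5 : H3.sharp ((Pi.single k 1, 0) : H3 ℚ α β) = 0 := by
    fin_cases k <;> apply H3.ext_coord <;> simp [H3.sharp_fst, H3.sharp_snd, qnorm_eq]
  have h6 : H3.norm ((Pi.single k 1, 0) : H3 ℚ α β) = 0 := by
    fin_cases k <;> simp [H3.norm, qnorm_eq, qtr_eq]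
  have h1 : (lowerFun (Pi.single k 1, 0) (rankOne X)).1 = 1 := by
    simp [lowerFun, h5, h6, rankOne, H3.pair_eq, hX, qtr_eq]
  have hr := (isRankOne_of_mem_lineOrbit (isRankOne_rankOne X) hm.mem_lineOrbit).eq_smul_rankOne
    hα hβ (by rw [h1]; exact one_ne_zero)
  rw [h1, inv_one, one_smul, one_smul] at hr
  exact ⟨_, h, hr ▸ hm⟩

omit hα hβ in
-- The move alters only row `k`, adding to it the imaginary part of a product of the other two
-- entries. That imaginary part is a weighted cross product of the other two rows, so the
-- determinant changes by a diagonal quadratic form in their minors.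
theorem det_imMat_lower {M : Matrix (Fin 3) (Fin 3) ℚ} (k : Fin 3) {X : H3 ℚ α β}
    (hX : X = (0, fun i => ⟨0, M i 0, M i 1, M i 2⟩)) :
    (imMat (lowerFun (Pi.single k 1, 0) (rankOne X)).2.1).det = M.det
      + β * (M (k + 1) 1 * M (k + 2) 2 - M (k + 1) 2 * M (k + 2) 1) ^ 2
      + α * (M (k + 1) 0 * M (k + 2) 2 - M (k + 1) 2 * M (k + 2) 0) ^ 2
      - (M (k + 1) 0 * M (k + 2) 1 - M (k + 1) 1 * M (k + 2) 0) ^ 2 := by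
  have h5 : H3.sharp ((Pi.single k 1, 0) : H3 ℚ α β) = 0 := by
    fin_cases k <;> apply H3.ext_coord <;> simp [H3.sharp_fst, H3.sharp_snd, qnorm_eq]
  rw [Matrix.det_fin_three, Matrix.det_fin_three]
  subst hX
  fin_cases k <;>
    simp [-Matrix.add_cons, -Matrix.sub_cons, -Matrix.cons_sub, lowerFun, rankOne, h5,
      H3.cross_snd, H3.sharp_snd, imMat] <;> ring

/-- For `α, β < 0` the correction in `det_imMat_lower` is negative definite in the minors of two
rows. If no move produces a nonzero determinant, every 2 × 2 minor vanishes. -/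
theorem exists_generic_or_collinear (X : H3 ℚ α β) :
    (∃ Y, (imMat Y).det ≠ 0 ∧ RealMove (rankOne X) (rankOne Y)) ∨
      ∃ c y, imMat X = Matrix.vecMulVec c y := by
  by_cases hdet : (imMat X).det ≠ 0
  · exact .inl ⟨X, hdet, .refl _⟩
  push Not at hdet
  refine or_iff_not_imp_left.2 fun H => ?_
  generalize hM : imMat X = M at *
  obtain ⟨Z, hZ⟩ : ∃ Z : H3 ℚ α β, Z = (0, fun i => ⟨0, M i 0, M i 1, M i 2⟩) := ⟨_, rfl⟩
  have hZM : imMat Z = M := by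
    rw [hZ]; ext i j; fin_cases j <;> rfl
  have hXZ : RealMove (rankOne X) (rankOne Z) := RealMove.rankOne_of_imMat_eq (by rw [hZM, hM])
  have hk : ∀ k : Fin 3, M (k + 1) 1 * M (k + 2) 2 = M (k + 1) 2 * M (k + 2) 1 ∧
      M (k + 1) 0 * M (k + 2) 2 = M (k + 1) 2 * M (k + 2) 0 ∧
      M (k + 1) 0 * M (k + 2) 1 = M (k + 1) 1 * M (k + 2) 0 := by
    intro k
    have h0 : (imMat (lowerFun (Pi.single k 1, 0) (rankOne Z)).2.1).det = 0 := by
      by_contra h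
      obtain ⟨Y, hY, hZY⟩ := exists_det_ne_zero_of_lower k hα.ne hβ.ne hZ h
      exact H ⟨Y, hY, hXZ.trans hZY⟩
    rw [det_imMat_lower k hZ, hdet] at h0
    set p := M (k + 1) 1 * M (k + 2) 2 - M (k + 1) 2 * M (k + 2) 1 with hp
    set q := M (k + 1) 0 * M (k + 2) 2 - M (k + 1) 2 * M (k + 2) 0 with hq
    set r := M (k + 1) 0 * M (k + 2) 1 - M (k + 1) 1 * M (k + 2) 0 with hr
    have h1 := mul_nonneg (neg_pos.2 hβ).le (sq_nonneg p)
    have h2 := mul_nonneg (neg_pos.2 hα).le (sq_nonneg q)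
    have h3 := sq_nonneg r
    have e1 : -β * p ^ 2 = 0 := by linarith
    have e2 : -α * q ^ 2 = 0 := by linarith
    have e3 : r ^ 2 = 0 := by linarith
    simp only [mul_eq_zero, neg_eq_zero, hα.ne, hβ.ne, false_or,
      ne_eq, OfNat.ofNat_ne_zero, not_false_eq_true, pow_eq_zero_iff] at e1 e2 e3
    exact ⟨sub_eq_zero.1 e1, sub_eq_zero.1 e2, sub_eq_zero.1 e3⟩
  by_cases hM0 : M = 0
  · exact ⟨0, 0, by simp [hM0]⟩
  obtain ⟨i, j, hij⟩ : ∃ i j, M i j ≠ 0 := by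
    by_contra! h
    exact hM0 (Matrix.ext h)
  -- A matrix of rank one is column `j` times row `i`, divided by a nonzero entry at `(i, j)`.
  refine ⟨fun l => M l j / M i j, M i, ?_⟩
  obtain ⟨a0, a1, a2⟩ := hk 0
  obtain ⟨b0, b1, b2⟩ := hk 1
  obtain ⟨c0, c1, c2⟩ := hk 2
  simp at a0 a1 a2 b0 b1 b2 c0 c1 c2
  ext l m
  rw [Matrix.vecMulVec_apply, div_mul_eq_mul_div, eq_div_iff hij]
  clear hij hM hZ hZM
  fin_cases i <;> fin_cases j <;> fin_cases l <;> fin_cases m <;> simp <;> linarith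

end Definite

/-! ### Moving `(0, 0, A, 0)` to normal form -/

section LowerOne
variable {K : Type*} [Field K] {α β : K} [CharZero K]

/-- If `A` is of rank one, then an opposite unipotent element moves `(0, 0, A, 0)` to an element with
first coordinate the trace of `A`. -/
theorem lowerFun_one {A : H3 K α β} (hA : H3.sharp A = 0)
    (ht : A.1 0 + A.1 1 + A.1 2 ≠ 0) :
    lowerFun (1, 0) ((0, 0, A, 0) : W K α β) = (A.1 0 + A.1 1 + A.1 2) •
      rankOne ((A.1 0 + A.1 1 + A.1 2)⁻¹ • -H3.cross A (1, 0)) := by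
  have k1 : (H3.sharp A).1 = 0 := by rw [hA]; rfl
  have k2 : (H3.sharp A).2 = 0 := by rw [hA]; rfl
  rw [H3.sharp_fst] at k1
  rw [H3.sharp_snd] at k2
  have c0 := congrFun k1 0
  have c1 := congrFun k1 1
  have c2 := congrFun k1 2
  have a0 := congrFun k2 0
  have a1 := congrFun k2 1
  have a2 := congrFun k2 2
  simp only [Matrix.cons_val, Pi.zero_apply, sub_eq_zero] at c0 c1 c2 a0 a1 a2
  set t := A.1 0 + A.1 1 + A.1 2 with htd
  have hs1 : H3.sharp ((1, 0) : H3 K α β) = (1, 0) := by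
    apply H3.ext_coord <;> simp [H3.sharp_fst, H3.sharp_snd, qnorm_eq]
  -- Here `-A × 1 = A - t`, where `t` is the trace of `A`. Since `A^# = 0`, its adjoint is `-t (A ×
  -- 1) + t² = t A`.
  have hS : H3.sharp (-H3.cross A (1, 0)) = t • A := by
    have q : ∀ x : ℍ[K,α,β], qnorm (-x) = qnorm x := fun x => by simp [qnorm_eq]
    apply H3.ext_coord
    all_goals simp [H3.sharp_fst, H3.sharp_snd, H3.cross_fst, H3.cross_snd, ← c0, ← c1, ← c2,
      a0, a1, a2, qtr_eq, q]
    · rw [htd]; ring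
    · rw [htd]; ring
    · rw [htd]; ring
    · rw [htd]; module
    · rw [htd]; module
    · rw [htd]; module
  have hN : H3.norm (-H3.cross A (1, 0)) = 0 := by
    -- From `A^# = 0`, the product `a₂ a₃` is `c₁ a₁*` and `n(a₁) = c₂ c₃`.
    have e : qtr (A.2 0 * A.2 1 * A.2 2) = 2 * (A.1 0 * (A.1 1 * A.1 2)) := by
      have h1 : A.2 1 * A.2 2 = A.1 0 • star (A.2 0) := by
        rw [← QuaternionAlgebra.star_smul, ← a0]; simp
      rw [mul_assoc, h1, mul_smul_comm, qtr_smul, c0]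
      simp [qtr_eq, qnorm_eq]; ring
    simp [H3.norm, H3.cross_fst, H3.cross_snd, qtr_eq, ← c0, ← c1, ← c2] at e ⊢
    linear_combination 2 * e
  rw [rankOne, H3.sharp_smul, H3.norm_smul, hS, hN]
  refine Prod.ext ?_ (Prod.ext ?_ (Prod.ext ?_ ?_))
  · simp [lowerFun, hs1, H3.pair_eq, H3.pair_zero_left, qtr_eq, htd]
  · simp [lowerFun, smul_smul, ht]
  · simp only [lowerFun, Prod.smul_mk, smul_smul]
    rw [show t * (t⁻¹ ^ 2 * t) = 1 by field_simp]
    simp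
  · simp [lowerFun]

theorem imMat_cross_one (A : H3 K α β) : imMat (-H3.cross A (1, 0)) = imMat A := by
  ext i j
  fin_cases i <;> fin_cases j <;> simp [imMat, H3.cross_snd]

end LowerOne

/-! ### The orbit of `f_O` and the other orbits -/

section FO
variable {α β : ℚ} {v : Fin 3 → ℍ[ℚ,α,β]}

/-- A relation between imaginary parts is a relation between the `v_i` up to a rational multiple of
`1`, which the independence of `1, v₁, v₂, v₃` excludes. -/
theorem linearIndependent_im (hv : LinearIndependent ℤ ![1, v 0, v 1, v 2]) {c : Fin 3 → ℚ}
    (h : ∀ j, ∑ i, c i * imMat ((0, v) : H3 ℚ α β) i j = 0) : c = 0 := by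
  rw [LinearIndependent.iff_fractionRing ℤ ℚ, Fintype.linearIndependent_iff] at hv
  have h0 := h 0
  have h1 := h 1
  have h2 := h 2
  simp [imMat, Fin.sum_univ_three] at h0 h1 h2
  have := hv ![-(c 0 * (v 0).re + c 1 * (v 1).re + c 2 * (v 2).re), c 0, c 1, c 2] (by
    rw [Fin.sum_univ_four]
    ext
    · simp; ring
    · simpa using h0
    · simpa using h1
    · simpa using h2)
  funext i
  fin_cases i
  exacts [this 1, this 2, this 3]

theorem det_imMat_ne_zero (hv : LinearIndependent ℤ ![1, v 0, v 1, v 2]) :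
    (imMat ((0, v) : H3 ℚ α β)).det ≠ 0 := by
  intro h
  obtain ⟨c, hc, h⟩ := Matrix.exists_vecMul_eq_zero_iff.2 h
  exact hc (linearIndependent_im hv fun j => by simpa [Matrix.vecMul, dotProduct] using congrFun h j)

variable (hα : α < 0) (hβ : β < 0)
include hα hβ

/-- The opposite translation by the identity matrix makes the first coordinate the trace of `A`,
nonzero by definiteness, and keeps the imaginary parts up to a scalar. -/
theorem exists_realMove_fO (hv : LinearIndependent ℤ ![1, v 0, v 1, v 2]) {n : Fin 3 → ℤ}
    (hA : (matA n v).IsRankOne) :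
    ∃ Y : H3 ℚ α β, (imMat Y).det ≠ 0 ∧ RealMove (fO n v) (rankOne Y) := by
  have ht := H3.trace_ne_zero hα hβ hA.1 hA.2
  have h := (RealMove.refl (fO n v)).lower (X := (1, 0)) (by ext i j; fin_cases j <;> rfl)
  rw [fO, lowerFun_one hA.1 ht] at h
  have h2 := h.smul (inv_ne_zero ht)
  rw [smul_smul, inv_mul_cancel₀ ht, one_smul] at h2
  refine ⟨_, ?_, h2⟩
  rw [imMat_smul, imMat_cross_one, Matrix.det_smul]
  exact mul_ne_zero (pow_ne_zero _ (inv_ne_zero ht)) (det_imMat_ne_zero hv)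

theorem isRankOne_fO (hv : LinearIndependent ℤ ![1, v 0, v 1, v 2]) {n : Fin 3 → ℤ}
    (hA : (matA n v).IsRankOne) : IsRankOne (fO n v) := by
  obtain ⟨Y, -, h⟩ := exists_realMove_fO hα hβ hv hA
  exact isRankOne_of_mem_lineOrbit (isRankOne_rankOne Y) (mem_lineOrbit_symm h.mem_lineOrbit)

omit hα hβ in
/-- Membership in the orbit of `f_O` is a property of the generic representatives. -/
theorem IsRankOne.dichotomy (hα : α < 0) (hβ : β < 0)
    (hv : LinearIndependent ℤ ![1, v 0, v 1, v 2]) {n : Fin 3 → ℤ}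
    (hA : (matA n v).IsRankOne) {w : W ℚ α β} (hw : IsRankOne w) :
    (w ∈ lineOrbit (fO n v) ∧ IsOpenOrbit w ∧ IsGeomOpenOrbit w) ∨
    (w ∉ lineOrbit (fO n v) ∧ ¬ IsOpenOrbit w ∧ ¬ IsGeomOpenOrbit w ∧
      ∃ q : ℍ[ℚ,α,β], w ∈ lineOrbit (rankOne (corner q))) := by
  obtain ⟨Y, hY, hfY⟩ := exists_realMove_fO hα hβ hv hA
  obtain ⟨X, hwX⟩ := hw.exists_rankOne hα hβ
  have hfYo := hfY.mem_lineOrbit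
  -- Generic representatives all lie in the orbit of `f_O` and stay generic over the algebraic
  -- closure; collinear ones stay collinear there. This settles both notions of openness at once.
  rcases exists_generic_or_collinear hα hβ X with ⟨Z, hZ, hXZ⟩ | ⟨c, y, hcy⟩
  · left
    have h := hwX.trans hXZ
    refine ⟨mem_lineOrbit_trans (mem_lineOrbit_trans hfYo
      (rankOne_mem_of_det_ne_zero hα.ne hβ.ne hY hZ)) (mem_lineOrbit_symm h.mem_lineOrbit),
      (isOpenOrbit_iff_of_mem h.mem_lineOrbit).1 (isOpenOrbit_rankOne hα.ne hβ.ne hZ), ?_⟩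
    have hL := (h.baseChange (AlgebraicClosure ℚ)).mem_lineOrbit
    refine (isOpenOrbit_iff_of_mem hL).1 ?_
    rw [wBaseChange_rankOne]
    refine isOpenOrbit_rankOne (by simpa using hα.ne) (by simpa using hβ.ne) ?_
    rw [imMat_baseChange, ← RingHom.mapMatrix_apply, ← RingHom.map_det]
    simpa using hZ
  · right
    have hc := isCollinear_of_imMat hcy
    refine ⟨fun h => ?_, fun h => ?_, fun h => ?_, ?_⟩
    · have := mem_lineOrbit_trans (mem_lineOrbit_trans (mem_lineOrbit_symm hwX.mem_lineOrbit)
        (mem_lineOrbit_symm h)) hfYo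
      exact hY (hc.of_mem_lineOrbit this).det_eq_zero
    · exact hc.not_isOpenOrbit ((isOpenOrbit_iff_of_mem hwX.mem_lineOrbit).2 h)
    · have hL := (hwX.baseChange (AlgebraicClosure ℚ)).mem_lineOrbit
      have h2 := (isOpenOrbit_iff_of_mem hL).2 h
      rw [wBaseChange_rankOne] at h2
      refine (isCollinear_of_imMat (c := fun i => algebraMap ℚ (AlgebraicClosure ℚ) (c i))
        (y := fun i => algebraMap ℚ (AlgebraicClosure ℚ) (y i)) ?_).not_isOpenOrbit h2
      rw [imMat_baseChange, hcy]
      ext i j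
      simp [Matrix.vecMulVec_apply]
    · obtain ⟨q, hq⟩ := rankOne_mem_lineOrbit_corner hα.ne hβ.ne hcy
      exact ⟨q, mem_lineOrbit_trans hq (mem_lineOrbit_symm hwX.mem_lineOrbit)⟩

omit hα hβ in
theorem contract_corner (q : ℍ[ℚ,α,β]) (l : Fin 3 ⊕ Fin 3) :
    ∃ c : ℚ, contract (rankOne (corner q)) l = c • (star q - q) := by
  rcases l with l | l
  · fin_cases l
    · exact ⟨1, by simp [contract, rankOne_snd_fst, corner]⟩
    · exact ⟨0, by simp [contract, rankOne_snd_fst, corner]⟩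
    · exact ⟨0, by simp [contract, rankOne_snd_fst, corner]⟩
  · refine ⟨0, ?_⟩
    fin_cases l <;> simp [contract, rankOne, H3.sharp_snd, corner]

omit hα hβ in
-- The contractions of `rankOne (corner q)` span the line of the imaginary part of `q`, and an orbit
-- cannot enlarge or move this span.
theorem corner_mem_lineOrbit {q q' : ℍ[ℚ,α,β]}
    (h : rankOne (corner q') ∈ lineOrbit (rankOne (corner q))) :
    ∃ c : ℚ, star q' - q' = c • (star q - q) := by
  obtain ⟨g, ν, k, hg, hk, t, ht⟩ := mem_lineOrbit_iff.1 h
  choose c hc using contract_corner q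
  have h1 : contract (rankOne (corner q')) (.inl 0) = star q' - q' := by
    simp [contract, rankOne_snd_fst, corner]
  refine ⟨t * ∑ m, g m (.inl 0) * c m, ?_⟩
  rw [← h1, ht, contract_smul, hk.contract_apply]
  simp only [hc, smul_smul, ← Finset.sum_smul]

/-- The quaternions `i + m j` for natural `m` are pairwise non-proportional, so their corners lie in
distinct orbits, all of them collinear and hence different from that of `f_O`. -/
theorem infinite_other_orbits (hv : LinearIndependent ℤ ![1, v 0, v 1, v 2]) {n : Fin 3 → ℤ}
    (hA : (matA n v).IsRankOne) :
    {S : Set (W ℚ α β) | (∃ w, IsRankOne w ∧ S = lineOrbit w) ∧ S ≠ lineOrbit (fO n v)}.Infinite := by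
  let q : ℕ → ℍ[ℚ,α,β] := fun m => ⟨0, 1, m, 0⟩
  refine Set.infinite_of_injective_forall_mem (f := fun m => lineOrbit (rankOne (corner (q m))))
    (fun m m' h => ?_) fun m => ⟨⟨_, isRankOne_rankOne _, rfl⟩, fun h => ?_⟩
  · have h1 : rankOne (corner (q m')) ∈ lineOrbit (rankOne (corner (q m))) := by
      have h' : lineOrbit (rankOne (corner (q m))) = lineOrbit (rankOne (corner (q m'))) := h
      rw [h']
      exact mem_lineOrbit_self _
    obtain ⟨c, hc⟩ := corner_mem_lineOrbit h1
    have hI := congrArg QuaternionAlgebra.imI hc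
    have hJ := congrArg QuaternionAlgebra.imJ hc
    simp [q] at hI hJ
    have hc1 : c = 1 := by linarith
    rw [hc1] at hJ
    have : (m : ℚ) = m' := by linarith
    exact_mod_cast this
  · obtain ⟨Y, hY, hfY⟩ := exists_realMove_fO hα hβ hv hA
    have h1 : rankOne Y ∈ lineOrbit (rankOne (corner (q m))) := by
      rw [h]; exact hfY.mem_lineOrbit
    refine hY (IsCollinear.of_mem_lineOrbit ?_ h1).det_eq_zero
    exact ⟨_, contract_corner _⟩

end FO

/-! ### Double cosets and orbits of lines -/

section DoubleCosets
variable {K : Type*} [Field K] {α β : K} [CharZero K]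

theorem inDoubleCoset_iff {γ γ' : (W K α β ≃ₗ[K] W K α β) × Kˣ} (hγ : γ ∈ GG K α β)
    (hγ' : γ' ∈ GG K α β) : InDoubleCoset γ γ' ↔ γ'.1 f₀ ∈ lineOrbit (γ.1 f₀) := by
  constructor
  · rintro ⟨p, ⟨-, t, ht⟩, h, ⟨g, hg, hh⟩, h1, -⟩
    refine ⟨g, h.2, hg, t, ?_⟩
    rw [h1]
    simp only [LinearEquiv.trans_apply, ht, map_smul]
    rw [emb_smul, hh]
  · intro h
    obtain ⟨g, ν, k, hg, hk, t, ht⟩ := mem_lineOrbit_iff.1 h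
    -- The element of `P` is forced to be `γ' k⁻¹ γ⁻¹` in right-action notation; it lies in `G`
    -- because `k` does, and it fixes the line of `f₀` by the choice of `k`.
    have hp := GG_trans (GG_trans hγ' (GG_symm hk.mem)) (GG_symm hγ)
    refine ⟨_, ⟨hp, t, ?_⟩, (k, ν), ⟨g, hg, hk.emb_apply⟩, ?_, ?_⟩
    · simp only [LinearEquiv.trans_apply, ht, map_smul, LinearEquiv.symm_apply_apply]
    · refine LinearEquiv.ext fun w => ?_
      simp only [LinearEquiv.trans_apply, LinearEquiv.apply_symm_apply]
    · simp only [inv_mul_cancel_right]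
end DoubleCosets

/-! ### Block scalar elements of `GSp₆` -/

section Stabilizer
variable {K : Type*} [Field K] {α β : K}

/-- The matrix `diag(λ₁, λ₁, λ₁, λ₂, λ₂, λ₂)`. -/
def diagMat (l₁ l₂ : K) : Matrix (Fin 3 ⊕ Fin 3) (Fin 3 ⊕ Fin 3) K :=
  Matrix.fromBlocks (l₁ • 1) 0 0 (l₂ • 1)

theorem eV_diagMat (l₁ l₂ : K) (i : Fin 3) : eV i ᵥ* diagMat l₁ l₂ = l₁ • eV i := by
  funext j
  rcases j with j | j <;> simp [eV, diagMat, Matrix.one_apply, Pi.single_apply, eq_comm]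

theorem fV_diagMat (l₁ l₂ : K) (i : Fin 3) : fV i ᵥ* diagMat l₁ l₂ = l₂ • fV i := by
  funext j
  rcases j with j | j <;> simp [fV, diagMat, Matrix.one_apply, Pi.single_apply, eq_comm]

/-- Each term contains two vectors `f` and one vector `e`, so the factor is `λ₁ λ₂²` divided by the
similitude `λ₁ λ₂`. -/
theorem act_diagMat (l₁ l₂ : Kˣ) (c : H3 K α β) :
    act (diagMat (l₁ : K) l₂) (l₁ * l₂) (emb ((0, 0, c, 0) : W K α β)) =
      (l₂ : K) • emb ((0, 0, c, 0) : W K α β) := by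
  have h1 := l₁.ne_zero
  have h2 := l₂.ne_zero
  have h : ((l₁ * l₂)⁻¹ : Kˣ) * (l₁ : K) * l₂ * l₂ = l₂ := by
    simp only [Units.val_inv_eq_inv_val, Units.val_mul]
    field_simp
  simp only [emb_eq, act_add, act_wedge_tmul, eV_diagMat, fV_diagMat, wedge_smul_left,
    wedge_smul_mid, wedge_smul_right, smul_smul, TensorProduct.smul_tmul', smul_add,
    Prod.fst_zero, Prod.snd_zero, Pi.zero_apply, QuaternionAlgebra.coe_zero, star_zero,
    TensorProduct.tmul_zero, smul_zero, add_zero, zero_add, ← mul_assoc]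
  simp only [← TensorProduct.smul_tmul', smul_smul, ← mul_assoc]
  rw [h]

theorem isGSp6_diagMat_mul_iff {l₁ l₂ : Kˣ} {U : Matrix (Fin 3) (Fin 3) K} {ν : Kˣ} :
    IsGSp6 (diagMat (l₁ : K) l₂ * Matrix.fromBlocks 1 U 0 1) ν ↔ U.IsSymm ∧ ν = l₁ * l₂ := by
  have h1 := l₁.ne_zero
  have h2 := l₂.ne_zero
  rw [diagMat, Matrix.fromBlocks_multiply, isGSp6_fromBlocks_iff]
  simp only [Matrix.smul_mul, Matrix.one_mul, Matrix.zero_mul, add_zero, zero_add, Matrix.mul_zero,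
    Matrix.mul_one, Matrix.transpose_smul, Matrix.transpose_one, Matrix.mul_smul, smul_smul,
    Matrix.transpose_zero, sub_zero, zero_sub, smul_zero, neg_inj, true_and, and_true]
  constructor
  · rintro ⟨hU, hν, -⟩
    refine ⟨?_, Units.ext ?_⟩
    · exact smul_right_injective _ (mul_ne_zero h1 h1) hU
    · have := congrFun (congrFun hν 0) 0
      simpa [mul_comm, eq_comm] using this
  · rintro ⟨hU, rfl⟩
    rw [hU.eq]
    simp [mul_comm]

theorem IsGSp6.exists_eq_diagMat_mul {g : Matrix (Fin 3 ⊕ Fin 3) (Fin 3 ⊕ Fin 3) K} {ν t : Kˣ}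
    (hg : IsGSp6 g ν) (hC : g.toBlocks₂₁ = 0) (hD : g.toBlocks₂₂ = (t : K) • 1) :
    ∃ (l : Kˣ) (U : Matrix (Fin 3) (Fin 3) K),
      g = diagMat (l : K) t * Matrix.fromBlocks 1 U 0 1 := by
  obtain ⟨A, B, C, D, rfl⟩ : ∃ A B C D, g = Matrix.fromBlocks A B C D :=
    ⟨_, _, _, _, (Matrix.fromBlocks_toBlocks g).symm⟩
  rw [Matrix.toBlocks_fromBlocks₂₁] at hC
  rw [Matrix.toBlocks_fromBlocks₂₂] at hD
  subst hC hD
  have h2 := ((isGSp6_fromBlocks_iff _ _ _ _ _).1 hg).2.1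
  simp only [Matrix.transpose_smul, Matrix.transpose_one, Matrix.mul_smul, Matrix.mul_one,
    Matrix.transpose_zero, Matrix.mul_zero, sub_zero] at h2
  have hA : A = ((ν * t⁻¹ : Kˣ) : K) • 1 := by
    rw [Units.val_mul, mul_comm, mul_smul, ← h2, smul_smul]
    simp
  refine ⟨ν * t⁻¹, ((ν * t⁻¹ : Kˣ) : K)⁻¹ • B, ?_⟩
  rw [diagMat, Matrix.fromBlocks_multiply, Matrix.fromBlocks_inj]
  have h0 := (ν * t⁻¹).ne_zero
  refine ⟨?_, ?_, ?_, ?_⟩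
  · simpa using hA
  · rw [Matrix.smul_mul, Matrix.one_mul, Matrix.zero_mul, add_zero, smul_smul, mul_inv_cancel₀ h0,
      one_smul]
  · simp
  · simp

end Stabilizer

/-! ### The stabilizer of the line of `f_O` -/

section FOStabilizer
variable {α β : ℚ} {v : Fin 3 → ℍ[ℚ,α,β]}

/-- The matrix `T` is the real part of `A`, and only the real part pairs with a real matrix. -/
theorem siegelFun_fO (n : Fin 3 → ℤ) {U : Matrix (Fin 3) (Fin 3) ℚ} (hU : U.IsSymm) :
    siegelFun (ofSymm U) (fO n v) = (0, 0, matA n v, (matT n v * U).trace) := by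
  have h1 := hU.apply 0 1
  have h2 := hU.apply 0 2
  have h3 := hU.apply 1 2
  simp only [siegelFun, fO, H3.cross_zero_left, H3.pair_zero_left, zero_smul, add_zero, zero_add,
    zero_mul]
  refine Prod.ext rfl (Prod.ext rfl (Prod.ext rfl ?_))
  simp [H3.pair_eq, ofSymm, realH3, matA, matT, Matrix.trace, Matrix.mul_apply,
    Matrix.vecMul, dotProduct, Fin.sum_univ_three, qtr_eq, h1, h2, h3]
  ring

theorem act_fO (n : Fin 3 → ℤ) {l₁ l₂ : ℚˣ} {U : Matrix (Fin 3) (Fin 3) ℚ} (hU : U.IsSymm) :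
    act (diagMat (l₁ : ℚ) l₂ * Matrix.fromBlocks 1 U 0 1) (l₁ * l₂) (emb (fO n v)) =
      (l₂ : ℚ) • emb ((0, 0, matA n v, (matT n v * U).trace) : W ℚ α β) := by
  have h := act_mul (α := α) (β := β) (diagMat (l₁ : ℚ) l₂) (siegelMat U) (l₁ * l₂) 1
    (emb (fO n v))
  rw [mul_one] at h
  have h2 := (actsAs_siegel (α := α) (β := β) hU).emb_apply (fO n v)
  rw [siegel_apply, siegelFun_fO n hU] at h2
  have h3 : act (diagMat (l₁ : ℚ) l₂) (l₁ * l₂) (emb (fO n v)) = (l₂ : ℚ) • emb (fO n v) :=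
    act_diagMat l₁ l₂ (matA n v)
  rw [← siegelMat, h, h3, act_smul, ← h2]

theorem lineStabilizer_fO (hv : LinearIndependent ℤ ![1, v 0, v 1, v 2]) (n : Fin 3 → ℤ) :
    lineStabilizer (fO n v) =
      {g | (∃ ν, IsGSp6 g ν) ∧ ∃ (l₁ l₂ : ℚˣ) (U : Matrix (Fin 3) (Fin 3) ℚ),
        g = Matrix.fromBlocks ((l₁ : ℚ) • 1) 0 0 ((l₂ : ℚ) • 1) * Matrix.fromBlocks 1 U 0 1 ∧
        (matT n v * U).trace = 0} := by
  ext g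
  constructor
  · rintro ⟨ν, hg, t, ht⟩
    refine ⟨⟨ν, hg⟩, ?_⟩
    obtain ⟨h, hh⟩ := hg.acts (α := α) (β := β)
    have hw : h (fO n v) = (t : ℚ) • fO n v := by
      apply emb_injective
      rw [hh.emb_apply, ht, emb_smul]
    -- Equivariance of the contraction at `f_O`, where only the `f`-components are nonzero. By
    -- independence of the `v_k - v_k*` it determines the lower blocks of `g` entry by entry.
    have hsum : ∀ l, (t : ℚ) • contract (fO n v) l =
        ∑ k, g (.inr k) l • (v k - star (v k)) := fun l => by
      rw [← contract_smul, ← hw, hh.contract_apply, Fintype.sum_sum_type]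
      simp [contract, fO, matA]
    have hind : ∀ (c : Fin 3 → ℚ), ∑ k, c k • (v k - star (v k)) = 0 → c = 0 := fun c hc => by
      have hI := congrArg QuaternionAlgebra.imI hc
      have hJ := congrArg QuaternionAlgebra.imJ hc
      have hK := congrArg QuaternionAlgebra.imK hc
      simp [Fin.sum_univ_three] at hI hJ hK
      refine linearIndependent_im hv fun j => ?_
      rw [Fin.sum_univ_three]
      fin_cases j <;> simp [imMat]
      · linear_combination hI / 2
      · linear_combination hJ / 2
      · linear_combination hK / 2
    have hC : g.toBlocks₂₁ = 0 := by
      ext k j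
      refine congrFun (hind (fun k => g (.inr k) (.inl j)) ?_) k
      rw [← hsum]
      simp [contract, fO]
    have hD : g.toBlocks₂₂ = (t : ℚ) • 1 := by
      ext k j
      have h0 := congrFun (hind (fun k => g (.inr k) (.inr j) - if k = j then (t : ℚ) else 0) ?_) k
      · simpa [Matrix.toBlocks₂₂, Matrix.one_apply, sub_eq_zero] using h0
      · simp only [sub_smul, Finset.sum_sub_distrib, ite_smul, zero_smul, Finset.sum_ite_eq',
          Finset.mem_univ, if_true]
        rw [← hsum]
        simp [contract, fO, matA]
    obtain ⟨l₁, U, hgd⟩ := hg.exists_eq_diagMat_mul hC hD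
    refine ⟨l₁, t, U, hgd.trans rfl, ?_⟩
    obtain ⟨hU, e⟩ := isGSp6_diagMat_mul_iff.1 (hgd ▸ hg)
    rw [hgd, e, act_fO n hU, ← emb_smul, ← emb_smul] at ht
    have := congrArg (fun w => w.2.2.2) (emb_injective ht)
    simpa [fO] using this
  · rintro ⟨⟨ν, hg⟩, l₁, l₂, U, rfl, hU⟩
    obtain ⟨hs, hν⟩ := isGSp6_diagMat_mul_iff.1 hg
    refine ⟨ν, hg, l₂, ?_⟩
    have := act_fO (v := v) n (l₁ := l₁) (l₂ := l₂) hs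
    rw [hU, ← hν] at this
    exact this

end FOStabilizer

/-! ### Negligibility of the collinear orbits -/

section Negligible
variable {K : Type*} [Field K] {α β : K} [CharZero K]

omit [CharZero K] in
theorem form6_apply (x y : W6 K) : form6 K x y = x ⬝ᵥ (J6 K *ᵥ y) := by
  rw [form6, Matrix.toBilin'_apply']

omit [CharZero K] in
theorem form6_vecMul {g : Matrix (Fin 3 ⊕ Fin 3) (Fin 3 ⊕ Fin 3) K} {ν : Kˣ} (hg : IsGSp6 g ν)
    (x y : W6 K) : form6 K (x ᵥ* g) (y ᵥ* g) = ν * form6 K x y := by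
  have h : y ᵥ* g = gᵀ *ᵥ y := by rw [Matrix.mulVec_transpose]
  rw [form6_apply, form6_apply, h, ← Matrix.dotProduct_mulVec, Matrix.mulVec_mulVec,
    Matrix.mulVec_mulVec, hg, Matrix.smul_mulVec, dotProduct_smul, smul_eq_mul]

omit [CharZero K] in
theorem form6_self (x : W6 K) : form6 K x x = 0 := by
  rw [form6_apply]
  simp [J6, Matrix.mulVec, dotProduct, Fin.sum_univ_three, Matrix.fromBlocks, Matrix.one_apply]
  ring

omit [CharZero K] in
/-- Elements of the unipotent radical of the stabilizer of a line. -/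
theorem mem_unipotentRadical_line {u : W6 K} {g : Matrix (Fin 3 ⊕ Fin 3) (Fin 3 ⊕ Fin 3) K}
    (hg : g ∈ unipotentRadical {K ∙ u}) :
    u ᵥ* g = u ∧ ∀ x, form6 K u x = 0 → ∃ c : K, x ᵥ* g = x + c • u := by
  have hle : (K ∙ u) ≤ (form6 K).orthogonal (K ∙ u) := by
    rw [Submodule.span_singleton_le_iff_mem, LinearMap.BilinForm.mem_orthogonal_iff]
    intro y hy
    obtain ⟨c, rfl⟩ := Submodule.mem_span_singleton.1 hy
    simp [form6_self]
  have hmem : ∀ Y, Y ∈ fullFlag {K ∙ u} ↔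
      Y = ⊥ ∨ Y = ⊤ ∨ Y = (K ∙ u) ∨ Y = (form6 K).orthogonal (K ∙ u) := fun Y => by
    simp [fullFlag, or_assoc, eq_comm]
    tauto
  constructor
  · have h := hg.2 (K ∙ u) ((hmem _).2 (by simp)) u (Submodule.mem_span_singleton_self u)
    -- Nothing but `0` lies below the line in the full flag, since the line is contained in its
    -- orthogonal.
    have h0 : sSup {Y | Y ∈ fullFlag {K ∙ u} ∧ Y < (K ∙ u)} ≤ ⊥ := by
      refine sSup_le fun Y hY => ?_
      rcases (hmem Y).1 hY.1 with rfl | rfl | rfl | rfl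
      · exact le_rfl
      · exact absurd hY.2 not_top_lt
      · exact absurd hY.2 (lt_irrefl _)
      · exact absurd hY.2 (not_lt_of_ge hle)
    have := h0 h
    rwa [Submodule.mem_bot, sub_eq_zero] at this
  · intro x hx
    have hx' : x ∈ (form6 K).orthogonal (K ∙ u) := by
      rw [LinearMap.BilinForm.mem_orthogonal_iff]
      intro y hy
      obtain ⟨c, rfl⟩ := Submodule.mem_span_singleton.1 hy
      simp [hx]
    have h := hg.2 _ ((hmem _).2 (by simp)) x hx'
    have h0 : sSup {Y | Y ∈ fullFlag {K ∙ u} ∧ Y < (form6 K).orthogonal (K ∙ u)} ≤ (K ∙ u) := by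
      refine sSup_le fun Y hY => ?_
      rcases (hmem Y).1 hY.1 with rfl | rfl | rfl | rfl
      · exact bot_le
      · exact absurd hY.2 not_top_lt
      · exact le_rfl
      · exact absurd hY.2 (lt_irrefl _)
    obtain ⟨c, hc⟩ := Submodule.mem_span_singleton.1 (h0 h)
    exact ⟨c, by rw [hc]; abel⟩

/-- Every term contains `eV 0`, and its other two factors are orthogonal to `eV 0`; this is what
makes the orbit negligible. -/
theorem emb_rankOne_corner (q : ℍ[K,α,β]) : emb (rankOne (corner q)) =
    wedge (eV 0) (eV 1) (eV 2) ⊗ₜ[K] (1 : ℍ[K,α,β]) + wedge (eV 2) (eV 0) (fV 2) ⊗ₜ[K] q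
      + wedge (eV 0) (eV 1) (fV 1) ⊗ₜ[K] star q
      + wedge (fV 1) (fV 2) (eV 0) ⊗ₜ[K] ((-qnorm q : K) : ℍ[K,α,β]) := by
  rw [emb_eq]
  have hN : H3.norm (corner q) = 0 := by simp [H3.norm, corner, qnorm_eq, qtr_eq]
  simp [rankOne, corner, H3.sharp_fst, H3.sharp_snd, qnorm_eq]
  simp [H3.norm, qnorm_eq, qtr_eq]
  abel

/-- The parabolic is the stabilizer of the line of `u = eV 0 ᵥ* g`. Its unipotent radical fixes `u`
and moves vectors orthogonal to `u` by multiples of `u`, which disappear after wedging with `u`. -/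
theorem isNegligible_of_mem_lineOrbit_corner {w : W K α β} {q : ℍ[K,α,β]}
    (h : w ∈ lineOrbit (rankOne (corner q))) : IsNegligible w := by
  obtain ⟨g, ν, hg, t, ht⟩ := h
  have hu0 : eV 0 ᵥ* g ≠ 0 := fun h0 => by
    have := congrArg (· ᵥ* g⁻¹) h0
    simp only [Matrix.vecMul_vecMul, Matrix.zero_vecMul, Matrix.mul_nonsing_inv g
      ((Matrix.isUnit_iff_isUnit_det g).1 hg.isUnit), Matrix.vecMul_one] at this
    simpa [eV] using congrFun this (.inl 0)
  refine ⟨{K ∙ (eV 0 ᵥ* g)}, ⟨Set.singleton_nonempty _, Set.subsingleton_singleton.isChain,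
    fun V hV => ?_⟩, fun k hk => ?_⟩
  · rw [Set.mem_singleton_iff.1 hV]
    refine ⟨by simpa using hu0, ?_⟩
    rw [Submodule.span_singleton_le_iff_mem, LinearMap.BilinForm.mem_orthogonal_iff]
    intro y hy
    obtain ⟨c, rfl⟩ := Submodule.mem_span_singleton.1 hy
    simp [form6_self]
  · obtain ⟨⟨μ, hμ⟩, -⟩ := id hk
    obtain ⟨hu, hx⟩ := mem_unipotentRadical_line hk
    -- The wedge products themselves are fixed, so the scalar is just the twist by `μ⁻¹`; that `μ =
    -- 1` is not needed.
    refine ⟨μ, hμ, μ⁻¹, ?_⟩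
    have horth : ∀ x, form6 K (eV 0) x = 0 →
        ∃ c : K, x ᵥ* g ᵥ* k = x ᵥ* g + c • eV 0 ᵥ* g := fun x h0 =>
      hx _ (by rw [form6_vecMul hg, h0, mul_zero])
    have hform : ∀ l, l ≠ Sum.inr 0 → form6 K (eV 0) (Pi.single l 1) = 0 := fun l hl => by
      rw [form6_apply]
      rcases l with l | l
      · simp [eV, J6]
      · have : l ≠ 0 := fun h => hl (by rw [h])
        simp [eV, J6, Matrix.one_apply, this.symm]
    obtain ⟨c₁, h1⟩ := horth (eV 1) (hform _ (by simp))
    obtain ⟨c₂, h2⟩ := horth (eV 2) (hform _ (by simp))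
    obtain ⟨d₁, k1⟩ := horth (fV 1) (hform _ (by simp))
    obtain ⟨d₂, k2⟩ := horth (fV 2) (hform _ (by simp))
    have key : act k μ (act g ν (emb (rankOne (corner q)))) =
        ((μ⁻¹ : Kˣ) : K) • act g ν (emb (rankOne (corner q))) := by
      rw [emb_rankOne_corner]
      simp only [act_add, act_wedge_tmul, act_smul, hu, h1, h2, k1, k2, wedge_add_left,
        wedge_add_mid, wedge_add_right, wedge_smul_left, wedge_smul_mid, wedge_smul_right,
        wedge_self_left, wedge_self_right, wedge_self_outer, smul_zero, add_zero, smul_add]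
      simp only [smul_smul, mul_comm]
    rw [ht, act_smul, key, smul_comm]

end Negligible
end
end Freudenthal

theorem proposition3p5 (α β : ℚ) (hB : RamifiedAtInfinity α β)
    (O : Subring ℍ[ℚ,α,β]) (hO : Maximal IsOrder O)
    (v : Fin 3 → ℍ[ℚ,α,β]) (hv : IsOrderBasis O v)
    (n : Fin 3 → ℤ) (hA : (matA n v).IsRankOne) :
    -- `P(ℚ) γ ↦ ℚ f γ` identifies `P(ℚ) \ G(ℚ)` with the set of rank one lines,
    -- and the double cosets with the orbits of `GSp₆(ℚ)` on these lines
    ((∀ w : W ℚ α β, IsRankOne w ↔ ∃ γ ∈ GG ℚ α β, γ.1 f₀ = w) ∧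
      ∀ γ ∈ GG ℚ α β, ∀ γ' ∈ GG ℚ α β,
        InDoubleCoset γ γ' ↔ γ'.1 f₀ ∈ lineOrbit (γ.1 f₀)) ∧
    -- `ℚ f_O` represents the unique open orbit
    IsRankOne (fO n v) ∧
    (∀ w : W ℚ α β, IsRankOne w → (IsGeomOpenOrbit w ↔ w ∈ lineOrbit (fO n v))) ∧
    (∀ w : W ℚ α β, IsRankOne w → (IsOpenOrbit w ↔ w ∈ lineOrbit (fO n v))) ∧
    -- there are infinitely many other orbits
    {S : Set (W ℚ α β) | (∃ w, IsRankOne w ∧ S = lineOrbit w) ∧ S ≠ lineOrbit (fO n v)}.Infinite ∧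
    -- all of them are negligible
    (∀ w : W ℚ α β, IsRankOne w → w ∉ lineOrbit (fO n v) → IsNegligible w) ∧
    -- the stabilizer of the line `ℚ f_O`
    lineStabilizer (fO n v) =
      {g | (∃ ν, IsGSp6 g ν) ∧ ∃ (l₁ l₂ : ℚˣ) (U : Matrix (Fin 3) (Fin 3) ℚ),
        g = Matrix.fromBlocks ((l₁ : ℚ) • 1) 0 0 ((l₂ : ℚ) • 1) * Matrix.fromBlocks 1 U 0 1 ∧
        (matT n v * U).trace = 0} := by
  obtain ⟨hα, hβ⟩ := hB.neg
  have hdich := fun (w : W ℚ α β) (hw : IsRankOne w) => hw.dichotomy hα hβ hv.1 hA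
  refine ⟨⟨fun w => isRankOne_iff_mem_orbitGG hα hβ, fun γ hγ γ' hγ' => inDoubleCoset_iff hγ hγ'⟩,
    isRankOne_fO hα hβ hv.1 hA, fun w hw => ?_, fun w hw => ?_,
    infinite_other_orbits hα hβ hv.1 hA, fun w hw hn => ?_, lineStabilizer_fO hv.1 n⟩
  · rcases hdich w hw with h | h
    · exact iff_of_true h.2.2 h.1
    · exact iff_of_false h.2.2.1 h.1
  · rcases hdich w hw with h | h
    · exact iff_of_true h.2.1 h.1
    · exact iff_of_false h.2.1 h.1
  · rcases hdich w hw with h | h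
    · exact absurd h.1 hn
    · exact isNegligible_of_mem_lineOrbit_corner h.2.2.2.choose_spec
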